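/- For every positive integer $r$ there is a real constant $C_r$ such that the following holds. Let $\Delta\ge 0$ be an integer and let $\mathcal F=\{F_1,F_2,\dots\}$ be any sequence of bipartite graphs such that, for every $i\ge 1$, $F_i$ has exactly $i$ vertices and maximum degree at most $\Delta$. A monochromatic $\mathcal F$-tiling of size $s$ of an edge-coloured complete graph $K_n$ is a collection of $s$ monochromatic subgraphs of $K_n$, each isomorphic to some member of $\mathcal F$, whose vertex sets partition $V(K_n)$. Let $\tau_r(\mathcal F)$ be the least $s$ such that, for every $n$, every $r$-edge-coloured complete graph $K_n$ has a monochromatic $\mathcal F$-tiling of size at most $s$ (and $\tau_r(\mathcal F)=\infty$ if there is no such $s$). Then $$\tau_r(\mathcal F)\le \exp(C_r\Delta).$$ Moreover, with the same constant $C_r$, for all integers $\Delta, n\ge 0$ and every bipartite graph $H$ with $n$ vertices and maximum degree at most $\Delta$, the $r$-colour Ramsey number $R_r(H)$, that is, the least $N$ such that every $r$-edge-colouring of $K_N$ contains a monochromatic copy of $H$ as a (not necessarily induced) subgraph, satisfies $$R_r(H)\le \exp(C_r\Delta)\,n.$$ -/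

import Mathlib

open SimpleGraph
open scoped ENNReal

/-- A sequence of graphs `F₁, F₂, …` in which `Fᵢ` has exactly `i` vertices, taken to be `Fin i`.
(The entry with index `0`, the graph without vertices, is not a member of the sequence.) -/
abbrev GraphSequence : Type := (i : ℕ) → SimpleGraph (Fin i)

open Classical in
/-- A bipartite `Δ`-bounded graph sequence: every `Fᵢ`, `i ≥ 1`, is bipartite and has maximum
degree at most `Δ`. -/
structure IsBipartiteBoundedSequence (Δ : ℕ) (F : GraphSequence) : Prop where
  bipartite : ∀ i, 1 ≤ i → (F i).IsBipartite
  maxDegree_le : ∀ i, 1 ≤ i → (F i).maxDegree ≤ Δ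

/-- A subgraph `H` of an edge-coloured complete graph is monochromatic if all its edges have one
and the same colour `c`. -/
def IsMonochromatic {V K : Type*} (χ : TopEdgeLabeling V K)
    (H : (⊤ : SimpleGraph V).Subgraph) : Prop :=
  ∃ c : K, ∀ u v, ∀ h : H.Adj u v, χ.get u v h.adj_sub = c

/-- A monochromatic `F`-tiling of an edge-coloured complete graph: a collection `T` of
monochromatic subgraphs, each isomorphic to a member of `F`, whose vertex sets partition the set
of all vertices. Its size is `T.card`. -/
structure IsMonochromaticTiling {V K : Type*} (F : GraphSequence) (χ : TopEdgeLabeling V K)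
    (T : Finset (⊤ : SimpleGraph V).Subgraph) : Prop where
  monochromatic : ∀ H ∈ T, IsMonochromatic χ H
  iso_member : ∀ H ∈ T, ∃ k, 1 ≤ k ∧ Nonempty (H.coe ≃g F k)
  disjoint : ∀ H ∈ T, ∀ H' ∈ T, H ≠ H' → Disjoint H.verts H'.verts
  cover : ∀ v : V, ∃ H ∈ T, v ∈ H.verts

/-- The `r`-colour tiling number `τ_r(F)`: the least `s` such that every `r`-edge-coloured
complete graph has a monochromatic `F`-tiling of size at most `s`, and `∞` if there is none. -/
noncomputable def tilingNumber (r : ℕ) (F : GraphSequence) : ℕ∞ :=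
  sInf ((fun s : ℕ => (s : ℕ∞)) '' {s : ℕ | ∀ (n : ℕ) (χ : TopEdgeLabeling (Fin n) (Fin r)),
    ∃ T, IsMonochromaticTiling F χ T ∧ T.card ≤ s})

/-- The `r`-colour Ramsey number `R_r(H)`: the least `N` such that every `r`-edge-colouring of the
complete graph on `N` vertices contains a monochromatic copy of `H` (as a subgraph, not necessarily
induced), and `∞` if there is none. -/
noncomputable def multicolourRamsey {W : Type*} (r : ℕ) (H : SimpleGraph W) : ℕ∞ :=
  sInf ((fun N : ℕ => (N : ℕ∞)) '' {N : ℕ | ∀ χ : TopEdgeLabeling (Fin N) (Fin r),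
    ∃ c : Fin r, H.IsContained (χ.labelGraph c)})

/-! Fix the number `r` of colours and a parameter `p` with `1/p = exp(O_r(Δ))`. Dependent random
choice in the densest colour between two halves of a vertex set (`exists_mono_copy`) shows that `N *
k` vertices, `N = 24 Δ r^Δ`, always contain a monochromatic copy of a given bipartite graph with `k`
vertices and degrees at most `Δ`. This is the Ramsey bound. For tilings, removing such copies
repeatedly shrinks the uncovered set by a factor `1 - 1/(2N)` each time, so `t` tiles leave at most
a proportion `exp(-p t)` (`TilingSetup.exists_cover`). What remains must be covered exactly, with a
number of tiles independent of `n`.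

The exact part takes place in bipartite pairs. It embeds not `F` but its bipartite double cover,
with both sides indexed by the vertices of `F`: for bipartite `F` this is two disjoint copies of
`F`, and it occupies equally many vertices on the two sides, however unbalanced `F` is
(`Coverable.of_double_cover`). The pairs are found by maximising density times a small power of the
relative size (`exists_regPair`). A maximiser is regular, has large minimum degrees, and keeps a
proportion `exp(-(1/p)^60)` of the vertices. Hence a number of greedy tiles polynomial in `1/p`,
still `exp(O_r(Δ))`, makes the leftover negligible compared with the pair.

In a regular pair one side is embedded vertex by vertex. Candidate sets for the other side are kept
large, and on average few of their pairwise intersections become too big. A second moment estimate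
(`few_light`) then puts almost every target vertex into many candidate sets. A sparse buffer
embedded last by Hall's theorem makes the first side exact (`buffer_lemma`), and another application
of Hall places the second side. This covers one side exactly (`exact_one_sided`) or both
(`exact_two_sided`); a variant swallows a small set of outer vertices of large degree into the pair
(`absorb`).

The tiling starts from a balanced regular pair `(X, Y)` in some colour. The rest is covered greedily
up to a tiny set `L`, then `L` is absorbed, then the pair is covered exactly. Vertices of `L` with
small degree to `X` in that colour cannot be absorbed; they are treated by recursion on the set `J`
of colours that are rare towards `X` (`CoversInto`, `TilingSetup.coversInto_of_insert`). Since every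
vertex sends some colour to every vertex of `X`, the recursion ends when `J` contains all colours.
-/

/-! ### Exact covers by tiles and double covers. -/

open scoped Classical in
/-- The vertex set `S` is exactly covered by at most `s` pairwise disjoint monochromatic tiles. -/
def Coverable {V K : Type*} (F : GraphSequence) (χ : TopEdgeLabeling V K) (S : Finset V)
    (s : ℕ) : Prop :=
  ∃ T : Finset (⊤ : SimpleGraph V).Subgraph,
    (∀ H ∈ T, IsMonochromatic χ H) ∧ (∀ H ∈ T, ∃ k, 1 ≤ k ∧ Nonempty (H.coe ≃g F k)) ∧
    (∀ H ∈ T, ∀ H' ∈ T, H ≠ H' → Disjoint H.verts H'.verts) ∧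
    (∀ v, v ∈ S ↔ ∃ H ∈ T, v ∈ H.verts) ∧ T.card ≤ s

/-- Every vertex has at most `Δ` neighbours. -/
def DegLE {α : Type*} (F : SimpleGraph α) (Δ : ℕ) : Prop :=
  ∀ v, ∀ s : Finset α, (∀ u ∈ s, F.Adj v u) → s.card ≤ Δ

namespace Coverable

variable {V K : Type*} {F : GraphSequence} {χ : TopEdgeLabeling V K}

lemma empty : Coverable F χ (∅ : Finset V) 0 :=
  ⟨∅, by simp⟩

lemma mono {S : Finset V} {s t : ℕ} (h : Coverable F χ S s) (hst : s ≤ t) : Coverable F χ S t := by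
  obtain ⟨T, h1, h2, h3, h4, h5⟩ := h
  exact ⟨T, h1, h2, h3, h4, h5.trans hst⟩

variable [DecidableEq V]

lemma union {S S' : Finset V} {s s' : ℕ} (h : Coverable F χ S s) (h' : Coverable F χ S' s')
    (hd : Disjoint S S') : Coverable F χ (S ∪ S') (s + s') := by
  classical
  obtain ⟨T, h1, h2, h3, h4, h5⟩ := h
  obtain ⟨T', h1', h2', h3', h4', h5'⟩ := h'
  have key : ∀ H ∈ T, ∀ H' ∈ T', Disjoint H.verts H'.verts := by
    intro H hH H' hH'
    rw [Set.disjoint_left]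
    intro v hv hv'
    exact (Finset.disjoint_left.1 hd) ((h4 v).2 ⟨H, hH, hv⟩) ((h4' v).2 ⟨H', hH', hv'⟩)
  refine ⟨T ∪ T', ?_, ?_, ?_, ?_, (Finset.card_union_le _ _).trans (by omega)⟩
  · intro H hH
    rcases Finset.mem_union.1 hH with hH | hH
    exacts [h1 H hH, h1' H hH]
  · intro H hH
    rcases Finset.mem_union.1 hH with hH | hH
    exacts [h2 H hH, h2' H hH]
  · intro H hH H' hH' hne
    rcases Finset.mem_union.1 hH with hH | hH <;> rcases Finset.mem_union.1 hH' with hH' | hH'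
    exacts [h3 H hH H' hH' hne, key H hH H' hH', (key H' hH' H hH).symm, h3' H hH H' hH' hne]
  · intro v
    rw [Finset.mem_union, h4, h4']
    simp only [Finset.mem_union]
    constructor
    · rintro (⟨H, hH, hv⟩ | ⟨H, hH, hv⟩)
      exacts [⟨H, .inl hH, hv⟩, ⟨H, .inr hH, hv⟩]
    · rintro ⟨H, hH | hH, hv⟩
      exacts [.inl ⟨H, hH, hv⟩, .inr ⟨H, hH, hv⟩]

/-- A monochromatic copy of `F k` is a tile. -/
lemma of_copy {k : ℕ} (hk : 1 ≤ k) (c : K) (f : Fin k → V) (hf : Function.Injective f)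
    (hadj : ∀ u v, (F k).Adj u v → (χ.labelGraph c).Adj (f u) (f v)) :
    Coverable F χ (Finset.univ.image f) 1 := by
  classical
  let g : Copy (F k) (⊤ : SimpleGraph V) :=
    ⟨⟨f, fun {u v} h => by simpa using hf.ne h.ne⟩, hf⟩
  refine ⟨{g.toSubgraph}, ?_, ?_, ?_, ?_, by simp⟩
  · intro H hH
    rw [Finset.mem_singleton] at hH
    subst hH
    refine ⟨c, fun u v h => ?_⟩
    obtain ⟨a, b, hab, rfl, rfl⟩ := h
    obtain ⟨_, h'⟩ := (TopEdgeLabeling.labelGraph_adj _ _).1 (hadj a b (by simpa using hab))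
    exact h'
  · intro H hH
    rw [Finset.mem_singleton] at hH
    subst hH
    exact ⟨k, hk, ⟨g.isoToSubgraph.symm⟩⟩
  · intro H hH H' hH' hne
    rw [Finset.mem_singleton] at hH hH'
    exact absurd (hH.trans hH'.symm) hne
  · intro v
    simp [g, Copy.toSubgraph]

lemma singleton [Nonempty K] (v : V) : Coverable F χ {v} 1 := by
  obtain ⟨c⟩ := ‹Nonempty K›
  have := of_copy (F := F) (χ := χ) (k := 1) le_rfl c (fun _ => v)
    (fun _ _ _ => Subsingleton.elim _ _)
    (fun u v h => absurd (Subsingleton.elim u v) h.ne)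
  simpa using this

/-- An embedding of the bipartite double cover of a bipartite `F k` gives two disjoint copies
of `F k`. -/
lemma of_double_cover {k : ℕ} (hk : 1 ≤ k) (hF : (F k).IsBipartite) (c : K) (φ ψ : Fin k → V)
    (hφ : Function.Injective φ) (hψ : Function.Injective ψ) (hd : ∀ a b, φ a ≠ ψ b)
    (hadj : ∀ a b, (F k).Adj a b → (χ.labelGraph c).Adj (φ a) (ψ b)) :
    Coverable F χ (Finset.univ.image φ ∪ Finset.univ.image ψ) 2 := by
  classical
  obtain ⟨col⟩ := hF
  -- Copy `i` takes `φ` on colour class `i` and `ψ` on the other one, so the two copies together use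
  -- every value of `φ` and `ψ` exactly once.
  have key : ∀ i : Fin 2, Coverable F χ
      (Finset.univ.image (fun v => if col v = i then φ v else ψ v)) 1 := by
    intro i
    refine of_copy hk c _ ?_ ?_
    · intro u v h
      dsimp only at h
      split_ifs at h with h1 h2 h2
      · exact hφ h
      · exact absurd h (hd _ _)
      · exact absurd h.symm (hd _ _)
      · exact hψ h
    · intro u v h
      have hne := col.valid h
      split_ifs with h1 h2 h2
      · exact absurd (h1.trans h2.symm) hne
      · exact hadj u v h
      · exact (hadj v u h.symm).symm
      · exfalso; generalize col u = x at *; generalize col v = y at *; omega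
  have := (key 0).union (key 1) (by
    rw [Finset.disjoint_left]
    intro x hx hx'
    simp only [Finset.mem_image, Finset.mem_univ, true_and] at hx hx'
    obtain ⟨u, rfl⟩ := hx
    obtain ⟨v, hv⟩ := hx'
    split_ifs at hv with h1 h2 h2
    · exact absurd (by rw [← hφ hv, h1]) (show ¬ col u = 1 by rw [h2]; decide)
    · exact hd _ _ hv
    · exact hd _ _ hv.symm
    · have := hψ hv
      subst this
      omega)
  convert this using 1
  ext x
  simp only [Finset.mem_union, Finset.mem_image, Finset.mem_univ, true_and]
  constructor
  · rintro (⟨a, rfl⟩ | ⟨a, rfl⟩)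
    · by_cases h : col a = 0
      · exact .inl ⟨a, by simp [h]⟩
      · exact .inr ⟨a, by rw [if_pos (by omega)]⟩
    · by_cases h : col a = 0
      · exact .inr ⟨a, by simp [h]⟩
      · exact .inl ⟨a, by simp [h]⟩
  · rintro (⟨a, rfl⟩ | ⟨a, rfl⟩) <;> split_ifs
    exacts [.inl ⟨a, rfl⟩, .inr ⟨a, rfl⟩, .inl ⟨a, rfl⟩, .inr ⟨a, rfl⟩]

end Coverable

/-! ### Greedy embedding with a cost function. -/

/-- Sequential choice of an injective extension: at most `m` choices at each step violate the
invariant, and the cost grows on average by at most `M / t`. -/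
lemma greedy_extend {α V : Type*} [DecidableEq α] [DecidableEq V]
    (Inv : Finset α → (α → V) → Prop) (cost : Finset α → (α → V) → ℝ) (X : Finset V) (m M t : ℝ)
    (ht : 0 < t)
    (hstep : ∀ D φ a, a ∉ D → Inv D φ → ∀ B ⊆ X,
      (∀ x ∈ B, ¬ Inv (insert a D) (Function.update φ a x)) → (B.card : ℝ) ≤ m)
    (hcost : ∀ D φ a, a ∉ D → Inv D φ → ∀ B ⊆ X,
      ∑ x ∈ B, (cost (insert a D) (Function.update φ a x) - cost D φ) ≤ M)
    (Z : α → Finset V) (E : Finset α) (hZ : ∀ a ∈ E, Z a ⊆ X) :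
    ∀ (D : Finset α) (φ : α → V), Inv D φ → Disjoint D E → Set.InjOn φ D →
      (∀ a ∈ E, (D.card : ℝ) + E.card + m + t ≤ (Z a).card) →
      ∃ φ' : α → V, (∀ a ∉ E, φ' a = φ a) ∧ Set.InjOn φ' (D ∪ E : Finset α) ∧
        (∀ a ∈ E, φ' a ∈ Z a) ∧ Inv (D ∪ E) φ' ∧
        cost (D ∪ E) φ' ≤ cost D φ + E.card * (M / t) := by
  classical
  induction E using Finset.induction_on with
  | empty =>
    intro D φ hI _ hinj _
    exact ⟨φ, by simp, by simpa using hinj, by simp, by simpa using hI, by simp⟩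
  | insert a E ha ih =>
    intro D φ hI hd hinj hcard
    rw [Finset.disjoint_insert_right] at hd
    obtain ⟨haD, hdE⟩ := hd
    have hZa := hcard a (Finset.mem_insert_self _ _)
    set A := (Z a \ D.image φ).filter
      (fun x => Inv (insert a D) (Function.update φ a x)) with hA
    have hAX : A ⊆ X := fun x hx => hZ a (Finset.mem_insert_self _ _)
      (Finset.mem_sdiff.1 (Finset.mem_filter.1 hx).1).1
    -- Of the vertices of `Z a`, at most `D.card` are occupied and at most `m` break the invariant.
    have hAcard : t ≤ (A.card : ℝ) := by
      have h1 : ((Z a \ D.image φ).filter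
          (fun x => ¬ Inv (insert a D) (Function.update φ a x))).card ≤ m := by
        refine hstep D φ a haD hI _ ?_ ?_
        · intro x hx
          exact hZ a (Finset.mem_insert_self _ _)
            (Finset.mem_sdiff.1 (Finset.mem_filter.1 hx).1).1
        · intro x hx
          exact (Finset.mem_filter.1 hx).2
      have h2 := Finset.card_filter_add_card_filter_not (s := Z a \ D.image φ)
        (fun x => Inv (insert a D) (Function.update φ a x))
      have h3 : (Z a).card ≤ (Z a \ D.image φ).card + D.card :=
        (Finset.card_le_card_sdiff_add_card (t := D.image φ)).trans
          (by gcongr; exact Finset.card_image_le)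
      rw [Finset.card_insert_of_notMem ha] at hZa
      have h2' : (A.card : ℝ) + ((Z a \ D.image φ).filter
          (fun x => ¬ Inv (insert a D) (Function.update φ a x))).card
          = (Z a \ D.image φ).card := by exact_mod_cast h2
      have h3' : ((Z a).card : ℝ) ≤ (Z a \ D.image φ).card + D.card := by exact_mod_cast h3
      push_cast at hZa
      have : (0 : ℝ) ≤ E.card := by positivity
      linarith
    have hApos : 0 < A.card := by
      have : (0 : ℝ) < A.card := ht.trans_le hAcard
      exact_mod_cast this
    -- Averaging: the increments over `A` sum to at most `M` and `A` has at least `t` elements. The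
    -- case `B = ∅` of `hcost` supplies `0 ≤ M`.
    obtain ⟨x, hxA, hx⟩ : ∃ x ∈ A,
        cost (insert a D) (Function.update φ a x) - cost D φ ≤ M / t := by
      by_contra hcon
      push Not at hcon
      have h1 : ∑ _x ∈ A, M / t <
          ∑ x ∈ A, (cost (insert a D) (Function.update φ a x) - cost D φ) :=
        Finset.sum_lt_sum_of_nonempty (Finset.card_pos.1 hApos) hcon
      have h2 := hcost D φ a haD hI A hAX
      have hM : 0 ≤ M := by simpa using hcost D φ a haD hI ∅ (by simp)
      rw [Finset.sum_const, nsmul_eq_mul] at h1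
      have h3 : M ≤ A.card * (M / t) := by
        rw [mul_div_assoc', le_div_iff₀ ht, mul_comm]
        gcongr
      linarith
    have hxA' := Finset.mem_filter.1 hxA
    have hxZ := Finset.mem_sdiff.1 hxA'.1
    obtain ⟨φ', h1, h2, h3, h4, h5⟩ := ih (fun b hb => hZ b (Finset.mem_insert_of_mem hb))
      (insert a D) (Function.update φ a x) hxA'.2
      (by rw [Finset.disjoint_insert_left]; exact ⟨ha, hdE⟩)
      (by
        intro u hu v hv huv
        simp only [Finset.coe_insert, Set.mem_insert_iff, Finset.mem_coe] at hu hv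
        by_cases hua : u = a <;> by_cases hva : v = a
        · rw [hua, hva]
        · exfalso
          have hv' := hv.resolve_left hva
          rw [hua, Function.update_self, Function.update_of_ne hva] at huv
          exact hxZ.2 (huv ▸ Finset.mem_image_of_mem _ hv')
        · exfalso
          have hu' := hu.resolve_left hua
          rw [hva, Function.update_self, Function.update_of_ne hua] at huv
          exact hxZ.2 (huv ▸ Finset.mem_image_of_mem _ hu')
        · rw [Function.update_of_ne hua, Function.update_of_ne hva] at huv
          exact hinj (hu.resolve_left hua) (hv.resolve_left hva) huv)
      (by
        intro b hb
        have := hcard b (Finset.mem_insert_of_mem hb)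
        rw [Finset.card_insert_of_notMem ha] at this
        rw [Finset.card_insert_of_notMem haD]
        push_cast at this ⊢
        linarith)
    have hDE : insert a D ∪ E = D ∪ insert a E := by
      ext; simp
    rw [hDE] at h2 h4 h5
    refine ⟨φ', ?_, h2, ?_, h4, ?_⟩
    · intro b hb
      rw [Finset.mem_insert, not_or] at hb
      rw [h1 b hb.2, Function.update_of_ne hb.1]
    · intro b hb
      rcases Finset.mem_insert.1 hb with rfl | hb
      · rw [h1 _ ha, Function.update_self]
        exact hxZ.1
      · exact h3 b hb
    · rw [Finset.card_insert_of_notMem ha]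
      push_cast
      linarith


/-! ### Regular pairs by density maximisation. -/

section Regular

set_option linter.unusedSectionVars false

variable {V : Type*} [DecidableEq V]

open scoped Classical in
/-- The neighbours of `x` in `Y`. -/
noncomputable def nbh (G : SimpleGraph V) (Y : Finset V) (x : V) : Finset V := Y.filter (G.Adj x)

/-- The number of edges between `X` and `Y`. -/
noncomputable def eb (G : SimpleGraph V) (X Y : Finset V) : ℝ := ∑ x ∈ X, ((nbh G Y x).card : ℝ)

/-- A pair in which all large subpairs have density close to `d` and all degrees are at least
about `d`. -/
structure RegPair (G : SimpleGraph V) (X Y : Finset V) (ε e d : ℝ) : Prop where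
  lower : ∀ X' ⊆ X, ∀ Y' ⊆ Y, ε * X.card ≤ X'.card → ε * Y.card ≤ Y'.card →
    (1 - e) * d * X'.card * Y'.card ≤ eb G X' Y'
  upper : ∀ X' ⊆ X, ∀ Y' ⊆ Y, ε * X.card ≤ X'.card → ε * Y.card ≤ Y'.card →
    eb G X' Y' ≤ (1 + e) * d * X'.card * Y'.card
  degX : ∀ x ∈ X, (1 - e) * d * Y.card ≤ (nbh G Y x).card
  degY : ∀ y ∈ Y, (1 - e) * d * X.card ≤ (nbh G X y).card

variable {G : SimpleGraph V}

@[simp] lemma mem_nbh {Y : Finset V} {x y : V} : y ∈ nbh G Y x ↔ y ∈ Y ∧ G.Adj x y := by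
  simp [nbh]

lemma nbh_subset (Y : Finset V) (x : V) : nbh G Y x ⊆ Y := fun _ h => (mem_nbh.1 h).1

open scoped Classical in
lemma eb_eq_sum_sum (X Y : Finset V) :
    eb G X Y = ∑ x ∈ X, ∑ y ∈ Y, if G.Adj x y then (1 : ℝ) else 0 := by
  unfold eb nbh
  refine Finset.sum_congr rfl fun x _ => ?_
  rw [Finset.sum_boole]

lemma eb_comm (X Y : Finset V) : eb G X Y = eb G Y X := by
  classical
  rw [eb_eq_sum_sum, eb_eq_sum_sum, Finset.sum_comm]
  simp_rw [G.adj_comm]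

lemma eb_nonneg (X Y : Finset V) : 0 ≤ eb G X Y := Finset.sum_nonneg fun _ _ => by positivity

lemma eb_sdiff_left {X X' : Finset V} (h : X' ⊆ X) (Y : Finset V) :
    eb G (X \ X') Y = eb G X Y - eb G X' Y := by
  unfold eb
  rw [← Finset.sum_sdiff h]; ring

lemma eb_le (X Y : Finset V) : eb G X Y ≤ X.card * Y.card := by
  unfold eb
  calc _ ≤ ∑ _x ∈ X, (Y.card : ℝ) := by
        gcongr
        exact nbh_subset _ _
    _ = _ := by simp

lemma eb_singleton (x : V) (Y : Finset V) : eb G {x} Y = (nbh G Y x).card := by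
  simp [eb]

/-- Deleting a vertex of minimum degree does not lower the density. This serves to balance the two
sides of an extremal pair. -/
lemma exists_erase_eb (X Y : Finset V) (hX : X.Nonempty) :
    ∃ x ∈ X, eb G X Y * (X.card - 1) ≤ eb G (X.erase x) Y * X.card := by
  obtain ⟨x, hx, hmin⟩ := Finset.exists_min_image X (fun x => ((nbh G Y x).card : ℝ)) hX
  refine ⟨x, hx, ?_⟩
  have h1 : eb G (X.erase x) Y = eb G X Y - (nbh G Y x).card := by
    rw [← Finset.sdiff_singleton_eq_erase, eb_sdiff_left (by simpa using hx), eb_singleton]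
  have h2 : (X.card : ℝ) * (nbh G Y x).card ≤ eb G X Y := by
    unfold eb
    rw [← nsmul_eq_mul]
    exact Finset.card_nsmul_le_sum _ _ _ hmin
  rw [h1]
  nlinarith

/-- If no subpair has density much above `d`, then deleting a part removes at least
its share of the edges. -/
lemma eb_sdiff_le_of_max {X Y : Finset V} {μ d ε κ : ℝ} (hμ0 : 0 ≤ μ) (hμ1 : μ ≤ 1) (hd : 0 ≤ d)
    (hε : 0 < ε) (hε1 : ε ≤ 1) (hκ0 : 0 ≤ κ) (hκ : 1 ≤ ε ^ μ * (1 + κ))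
    (hstar : ∀ X' ⊆ X, ∀ Y' ⊆ Y, ∀ t : ℝ, 0 < t → t ≤ 1 → t * X.card ≤ X'.card →
      t * Y.card ≤ Y'.card → eb G X' Y' * t ^ μ ≤ d * X'.card * Y'.card)
    {X' Y' : Finset V} (hX' : X' ⊆ X) (hY' : Y' ⊆ Y) :
    (Y' = Y → eb G (X \ X') Y' ≤ d * Y'.card * (X.card - (1 - μ) * X'.card)) ∧
    (ε * Y.card ≤ Y'.card →
      eb G (X \ X') Y' ≤ d * Y'.card * (X.card * (1 + κ) - (1 - μ) * X'.card)) := by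
  have hcard : ((X \ X').card : ℝ) = X.card - X'.card := by
    rw [Finset.card_sdiff_of_subset hX', Nat.cast_sub (Finset.card_le_card hX')]
  have hle : (X'.card : ℝ) ≤ X.card := by exact_mod_cast Finset.card_le_card hX'
  rcases eq_or_lt_of_le hle with heq | hlt
  · have h0 : X' = X := Finset.eq_of_subset_of_card_le hX' (by exact_mod_cast heq.ge)
    subst h0
    have : eb G (X' \ X') Y' = 0 := by simp [eb]
    rw [this]
    constructor
    · intro _
      have : (0 : ℝ) ≤ X'.card - (1 - μ) * X'.card := by nlinarith [Nat.cast_nonneg (α := ℝ) X'.card]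
      positivity
    · intro _
      have : (0 : ℝ) ≤ X'.card * (1 + κ) - (1 - μ) * X'.card := by
        have : (0 : ℝ) ≤ X'.card := by positivity
        nlinarith [mul_nonneg this hκ0, mul_nonneg this hμ0]
      positivity
  have hst : ∀ t : ℝ, 0 < t → t ≤ 1 → t * X.card ≤ (X.card : ℝ) - X'.card →
      t * Y.card ≤ Y'.card → eb G (X \ X') Y' * t ^ μ ≤ d * (X.card - X'.card) * Y'.card := by
    intro t h1 h2 h3 h4
    have := hstar (X \ X') Finset.sdiff_subset Y' hY' t h1 h2 (by rwa [hcard]) h4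
    rwa [hcard] at this
  have hYY : Y' = Y → (Y.card : ℝ) = Y'.card := by rintro rfl; rfl
  suffices h : (Y.card : ℝ) = Y'.card →
      eb G (X \ X') Y' ≤ d * Y'.card * (X.card - (1 - μ) * X'.card) from ⟨fun hy => h (hYY hy), ?_⟩
  all_goals
    have hx'0 : (0 : ℝ) ≤ X'.card := Nat.cast_nonneg _
    have hy'0 : (0 : ℝ) ≤ Y'.card := Nat.cast_nonneg _
    have hy0 : (0 : ℝ) ≤ Y.card := Nat.cast_nonneg _
    clear hYY hstar hcard
    generalize (X.card : ℝ) = x at *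
    generalize (X'.card : ℝ) = x' at *
    generalize (Y.card : ℝ) = y at *
    generalize (Y'.card : ℝ) = y' at *
    generalize eb G (X \ X') Y' = E at *
    have hXpos : 0 < x := lt_of_le_of_lt hx'0 hlt
    obtain ⟨α, rfl⟩ : ∃ α : ℝ, x' = α * x := ⟨x' / x, by field_simp⟩
    have hα0 : 0 ≤ α := nonneg_of_mul_nonneg_left hx'0 hXpos
    have hα1 : α < 1 := by nlinarith
    -- With `t = 1 - α` extremality bounds the remaining edges by `d x y' (1 - α)^(1 - μ)`, and
    -- Bernoulli's inequality makes this linear in `α`: the deleted part carried nearly its share of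
    -- the edges.
    have hbern : (1 - α) ^ (1 - μ) ≤ 1 - (1 - μ) * α := by
      have := rpow_one_add_le_one_add_mul_self (s := -α) (by linarith) (p := 1 - μ)
        (by linarith) (by linarith)
      calc (1 - α) ^ (1 - μ) = (1 + -α) ^ (1 - μ) := by ring_nf
        _ ≤ _ := this
        _ = _ := by ring
    have hpow : (1 - α) ^ (1 - μ) * (1 - α) ^ μ = 1 - α := by
      rw [← Real.rpow_add (by linarith)]; simp
    have hpos : 0 < (1 - α) ^ μ := Real.rpow_pos_of_pos (by linarith) _
    have hcase1 : (1 - α) * y ≤ y' → E ≤ d * y' * (x - (1 - μ) * (α * x)) := by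
      intro hYc
      have h1 := hst (1 - α) (by linarith) (by linarith) (by linarith) hYc
      have h2 : E ≤ d * x * y' * (1 - α) ^ (1 - μ) := by
        have : E * (1 - α) ^ μ ≤ (d * x * y' * (1 - α) ^ (1 - μ)) * (1 - α) ^ μ := by
          rw [mul_assoc _ ((1 - α) ^ (1 - μ)), hpow]
          linarith
        exact le_of_mul_le_mul_right this hpos
      calc _ ≤ _ := h2
        _ ≤ d * x * y' * (1 - (1 - μ) * α) := by gcongr
        _ = _ := by ring
  · intro hYc
    -- If the remaining proportion is at most `ε`, then `t = 1 - α` is admissible for `Y'` as well.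
    -- Otherwise `t = ε` is used, and `1 + κ` pays for `ε^(-μ)`.
    rcases le_total (1 - α) ε with hc | hc
    · refine (hcase1 (le_trans (by gcongr) hYc)).trans ?_
      have : x - (1 - μ) * (α * x) ≤ x * (1 + κ) - (1 - μ) * (α * x) := by nlinarith
      gcongr
    · have h1 := hst ε hε hε1 (by nlinarith) hYc
      have hεpos : 0 < ε ^ μ := Real.rpow_pos_of_pos hε _
      have h0 : 0 ≤ d * (x * (1 - α)) * y' := by
        have : 0 ≤ 1 - α := by linarith
        positivity
      have h2 : E ≤ d * (x * (1 - α)) * y' * (1 + κ) := by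
        refine le_of_mul_le_mul_right (h1.trans ?_) hεpos
        nlinarith [mul_le_mul_of_nonneg_left hκ h0]
      refine h2.trans ?_
      have h3 : (1 - α) * (1 + κ) ≤ 1 + κ - (1 - μ) * α := by
        nlinarith [mul_nonneg hα0 hκ0, mul_nonneg hμ0 hα0]
      calc d * (x * (1 - α)) * y' * (1 + κ) = d * y' * (x * ((1 - α) * (1 + κ))) := by ring
        _ ≤ d * y' * (x * (1 + κ - (1 - μ) * α)) := by gcongr
        _ = _ := by ring
  · rintro rfl
    exact hcase1 (by nlinarith)

/-- Because `log (1/ε) ≤ 1/ε`, one has `ε^(-μ) ≤ exp (μ/ε) ≤ 1 + 2μ/ε`. So an extremal pair allows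
only a slight gain of density in subpairs of proportion `ε`. -/
lemma one_le_rpow_mul {ε μ : ℝ} (hε : 0 < ε) (hμ : 0 ≤ μ) (hμε : μ ≤ ε) :
    1 ≤ ε ^ μ * (1 + 2 * μ / ε) := by
  have h1 : ε ^ μ = (Real.exp (μ * Real.log (1 / ε)))⁻¹ := by
    rw [Real.rpow_def_of_pos hε, ← Real.exp_neg, one_div, Real.log_inv]
    ring_nf
  have h2 : Real.log (1 / ε) ≤ 1 / ε := (Real.log_le_sub_one_of_pos (by positivity)).trans (by linarith)
  have h3 : Real.exp (μ * Real.log (1 / ε)) ≤ Real.exp (μ / ε) := by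
    rw [Real.exp_le_exp, div_eq_mul_one_div μ ε]
    exact mul_le_mul_of_nonneg_left h2 hμ
  have hx0 : 0 ≤ μ / ε := by positivity
  have hx1 : μ / ε ≤ 1 := by rw [div_le_one hε]; exact hμε
  have h4 : Real.exp (μ / ε) ≤ 1 + 2 * μ / ε := by
    have := (abs_le.1 (Real.abs_exp_sub_one_sub_id_le (x := μ / ε) (by rwa [abs_of_nonneg hx0]))).2
    have h5 : (μ / ε) ^ 2 ≤ μ / ε := by nlinarith
    have h6 : 2 * μ / ε = μ / ε + μ / ε := by ring
    linarith
  rw [h1, inv_mul_eq_div, one_le_div (Real.exp_pos _)]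
  exact h3.trans h4

/-- A pair maximising the density up to a small power of the size is regular. -/
lemma regPair_of_max {X Y : Finset V} {d ε e : ℝ} (hd : 0 ≤ d)
    (hε : 0 < ε) (hε1 : ε ≤ 1) (he : 0 < e) (he1 : e ≤ 1) (heb : eb G X Y = d * X.card * Y.card)
    (hstar : ∀ X' ⊆ X, ∀ Y' ⊆ Y, ∀ t : ℝ, 0 < t → t ≤ 1 → t * X.card ≤ X'.card →
      t * Y.card ≤ Y'.card → eb G X' Y' * t ^ (ε ^ 2 * e / 4) ≤ d * X'.card * Y'.card) :
    RegPair G X Y ε e d := by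
  -- This choice gives `κ = 2μ/ε = εe/2`, so the error `(μ + κ)|X|` is at most `(3/4) e |X'|` as
  -- soon as `|X'| ≥ ε|X|`.
  set μ := ε ^ 2 * e / 4 with hμ
  have hμ0 : 0 ≤ μ := by positivity
  have hμe : μ ≤ ε * (ε / 4) := by
    rw [hμ]; nlinarith [mul_pos hε hε]
  have hμε : μ ≤ ε := by nlinarith
  have hμ1 : μ ≤ 1 := hμε.trans hε1
  have hμe' : μ ≤ e / 4 := by
    have : ε ^ 2 ≤ 1 := pow_le_one₀ hε.le hε1
    rw [hμ]; nlinarith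
  set κ := 2 * μ / ε with hκ
  have hκ' : κ = ε * e / 2 := by rw [hκ, hμ]; field_simp; ring
  have hκ0 : 0 ≤ κ := by positivity
  have hrp := one_le_rpow_mul hε hμ0 hμε
  have hstar' : ∀ Y' ⊆ Y, ∀ X' ⊆ X, ∀ t : ℝ, 0 < t → t ≤ 1 → t * Y.card ≤ Y'.card →
      t * X.card ≤ X'.card → eb G Y' X' * t ^ μ ≤ d * Y'.card * X'.card := by
    intro Y' hY' X' hX' t h1 h2 h3 h4
    rw [eb_comm]
    exact (hstar X' hX' Y' hY' t h1 h2 h4 h3).trans (by linarith)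
  -- The edges at `Y'` are all edges minus those at `Y \ Y'`, so the upper bound for the complement
  -- becomes a lower bound. No size condition on `Y'` is involved, which is why singletons give the
  -- minimum degrees below.
  have hY : ∀ Y' ⊆ Y, (1 - μ) * d * X.card * Y'.card ≤ eb G X Y' := by
    intro Y' hY'
    have h := (eb_sdiff_le_of_max hμ0 hμ1 hd hε hε1 hκ0 hrp hstar' hY' (subset_refl X)).1 rfl
    rw [eb_sdiff_left hY', eb_comm Y X, heb, eb_comm Y' X] at h
    linarith
  have hX : ∀ X' ⊆ X, (1 - μ) * d * X'.card * Y.card ≤ eb G X' Y := by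
    intro X' hX'
    have h := (eb_sdiff_le_of_max hμ0 hμ1 hd hε hε1 hκ0 hrp hstar hX' (subset_refl Y)).1 rfl
    rw [eb_sdiff_left hX', heb] at h
    linarith
  refine ⟨?_, ?_, ?_, ?_⟩
  · intro X' hX' Y' hY' h1 h2
    have h := (eb_sdiff_le_of_max hμ0 hμ1 hd hε hε1 hκ0 hrp hstar hX' hY').2 h2
    rw [eb_sdiff_left hX'] at h
    have h3 := hY Y' hY'
    have h4 : (1 - e) * X'.card ≤ (1 - μ) * X'.card - (μ + κ) * X.card := by
      have : (μ + κ) * X.card ≤ (3 / 4 * e) * X'.card := by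
        have h5 : μ + κ ≤ (3 / 4 * e) * ε := by
          rw [hκ', hμ]; nlinarith [mul_pos hε hε, mul_pos hε he]
        calc _ ≤ ((3 / 4 * e) * ε) * (X.card : ℝ) := by gcongr
          _ = (3 / 4 * e) * (ε * X.card) := by ring
          _ ≤ _ := by gcongr
      have : (0 : ℝ) ≤ X'.card := by positivity
      nlinarith
    have h5 : d * Y'.card * ((1 - e) * X'.card) ≤
        d * Y'.card * ((1 - μ) * X'.card - (μ + κ) * X.card) := by gcongr
    linarith
  · intro X' hX' Y' hY' h1 h2
    have h := hstar X' hX' Y' hY' ε hε hε1 h1 h2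
    have hpos : 0 < ε ^ μ := Real.rpow_pos_of_pos hε _
    refine le_of_mul_le_mul_right (h.trans ?_) hpos
    have : (1 : ℝ) ≤ ε ^ μ * (1 + e) := hrp.trans (by
      gcongr
      change κ ≤ e
      rw [hκ']; nlinarith)
    calc d * X'.card * Y'.card = d * X'.card * Y'.card * 1 := by ring
      _ ≤ d * X'.card * Y'.card * (ε ^ μ * (1 + e)) := by gcongr
      _ = _ := by ring
  · intro x hx
    have := hX {x} (by simpa using hx)
    rw [eb_singleton, Finset.card_singleton] at this
    refine le_trans ?_ this
    push_cast
    have h0 : 0 ≤ d * Y.card := by positivity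
    nlinarith
  · intro y hy
    have := hY {y} (by simpa using hy)
    rw [eb_comm, eb_singleton, Finset.card_singleton] at this
    refine le_trans ?_ this
    push_cast
    have h0 : 0 ≤ d * X.card := by positivity
    nlinarith

/-- Every dense bipartite graph contains a regular pair of controlled relative size, balanced if
the original pair is. -/
lemma exists_regPair (X0 Y0 : Finset V) (hX0 : X0.Nonempty) (hY0 : Y0.Nonempty) {d0 ε e : ℝ}
    (hd0 : 0 < d0) (hε : 0 < ε) (hε1 : ε ≤ 1) (he : 0 < e) (he1 : e ≤ 1)
    (heb : d0 * X0.card * Y0.card ≤ eb G X0 Y0) :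
    ∃ X ⊆ X0, ∃ Y ⊆ Y0, ∃ d : ℝ, d0 ≤ d ∧ d ≤ 1 ∧ RegPair G X Y ε e d ∧
      d0 ^ (4 / (ε ^ 2 * e)) * X0.card ≤ X.card ∧ d0 ^ (4 / (ε ^ 2 * e)) * Y0.card ≤ Y.card ∧
      (X0.card = Y0.card → X.card = Y.card) := by
  classical
  set μ := ε ^ 2 * e / 4 with hμ
  have hμ0 : 0 < μ := by positivity
  have hx0 : (0 : ℝ) < X0.card := by exact_mod_cast hX0.card_pos
  have hy0 : (0 : ℝ) < Y0.card := by exact_mod_cast hY0.card_pos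
  -- The whole pair has value at least `d0` and densities are at most `1`, so a maximiser has
  -- relative size at least `d0^(1/μ)`, where `1/μ = 4/(ε² e)`. Passing to a subpair of proportion
  -- `t` can raise the density of a maximiser by at most `t^(-μ)`.
  set f : Finset V × Finset V → ℝ := fun P => eb G P.1 P.2 / (P.1.card * P.2.card) *
    (min ((P.1.card : ℝ) / X0.card) (P.2.card / Y0.card)) ^ μ with hf
  set C := ((X0.powerset.filter (·.Nonempty)) ×ˢ (Y0.powerset.filter (·.Nonempty))) with hC
  have hmem : ∀ P : Finset V × Finset V,
      P ∈ C ↔ (P.1 ⊆ X0 ∧ P.1.Nonempty) ∧ P.2 ⊆ Y0 ∧ P.2.Nonempty := by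
    intro P; simp [hC]
  have h0 : (X0, Y0) ∈ C := by rw [hmem]; exact ⟨⟨subset_refl _, hX0⟩, subset_refl _, hY0⟩
  obtain ⟨P1, hP1, hmax1⟩ := Finset.exists_max_image C f ⟨_, h0⟩
  -- A maximiser of least total size; minimality is needed only for the balance of the two sides.
  obtain ⟨⟨X, Y⟩, hP, hmin⟩ := Finset.exists_min_image (C.filter (fun P => f P1 ≤ f P))
    (fun P => P.1.card + P.2.card) ⟨P1, by simp [hP1]⟩
  rw [Finset.mem_filter] at hP
  have hmax : ∀ Q ∈ C, f Q ≤ f (X, Y) := fun Q hQ => (hmax1 Q hQ).trans hP.2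
  have hmin' : ∀ Q ∈ C, f (X, Y) ≤ f Q → X.card + Y.card ≤ Q.1.card + Q.2.card := fun Q hQ h =>
    hmin Q (Finset.mem_filter.2 ⟨hQ, hP.2.trans h⟩)
  obtain ⟨⟨hX, hXn⟩, hY, hYn⟩ := (hmem _).1 hP.1
  dsimp only at hX hXn hY hYn
  have hx : (0 : ℝ) < X.card := by exact_mod_cast hXn.card_pos
  have hy : (0 : ℝ) < Y.card := by exact_mod_cast hYn.card_pos
  set d := eb G X Y / (X.card * Y.card) with hd
  set m := min ((X.card : ℝ) / X0.card) (Y.card / Y0.card) with hm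
  have hfXY : f (X, Y) = d * m ^ μ := rfl
  have hd_nonneg : 0 ≤ d := div_nonneg (eb_nonneg _ _) (by positivity)
  have hd1 : d ≤ 1 := by rw [hd, div_le_one (by positivity)]; exact eb_le _ _
  have hm0 : 0 < m := lt_min (by positivity) (by positivity)
  have hm1 : m ≤ 1 := (min_le_left _ _).trans (by
    rw [div_le_one hx0]; exact_mod_cast Finset.card_le_card hX)
  have hmμ : m ^ μ ≤ 1 := Real.rpow_le_one hm0.le hm1 hμ0.le
  have hmμ0 : 0 < m ^ μ := Real.rpow_pos_of_pos hm0 _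
  have hd0f : d0 ≤ d * m ^ μ := by
    rw [← hfXY]
    refine le_trans ?_ (hmax _ h0)
    simp only [hf]
    rw [div_self hx0.ne', div_self hy0.ne', min_self, Real.one_rpow, mul_one,
      le_div_iff₀ (by positivity)]
    linarith
  have hdd : d0 ≤ d := hd0f.trans (by nlinarith)
  have hmd : d0 ^ (4 / (ε ^ 2 * e)) ≤ m := by
    have h1 : d0 ≤ m ^ μ := hd0f.trans (by nlinarith)
    calc d0 ^ (4 / (ε ^ 2 * e)) ≤ (m ^ μ) ^ (4 / (ε ^ 2 * e)) := by gcongr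
      _ = m := by
        rw [← Real.rpow_mul hm0.le]
        have : μ * (4 / (ε ^ 2 * e)) = 1 := by rw [hμ]; field_simp
        rw [this, Real.rpow_one]
  have hstar : ∀ X' ⊆ X, ∀ Y' ⊆ Y, ∀ t : ℝ, 0 < t → t ≤ 1 → t * X.card ≤ X'.card →
      t * Y.card ≤ Y'.card → eb G X' Y' * t ^ μ ≤ d * X'.card * Y'.card := by
    intro X' hX' Y' hY' t ht ht1 h1 h2
    have hx' : (0 : ℝ) < X'.card := lt_of_lt_of_le (by positivity) h1
    have hy' : (0 : ℝ) < Y'.card := lt_of_lt_of_le (by positivity) h2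
    have hQ : (X', Y') ∈ C := by
      rw [hmem]
      exact ⟨⟨hX'.trans hX, Finset.card_pos.1 (by exact_mod_cast hx')⟩, hY'.trans hY,
        Finset.card_pos.1 (by exact_mod_cast hy')⟩
    have h3 := hmax _ hQ
    rw [hfXY] at h3
    have h4 : t * m ≤ min ((X'.card : ℝ) / X0.card) (Y'.card / Y0.card) := by
      refine le_min ?_ ?_
      · calc t * m ≤ t * (X.card / X0.card) := by gcongr; exact min_le_left _ _
          _ = t * X.card / X0.card := by ring
          _ ≤ _ := by gcongr
      · calc t * m ≤ t * (Y.card / Y0.card) := by gcongr; exact min_le_right _ _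
          _ = t * Y.card / Y0.card := by ring
          _ ≤ _ := by gcongr
    have h5 : eb G X' Y' / (X'.card * Y'.card) * (t ^ μ * m ^ μ) ≤ d * m ^ μ := by
      refine le_trans ?_ h3
      simp only [hf]
      rw [← Real.mul_rpow ht.le hm0.le]
      have := eb_nonneg (G := G) X' Y'
      gcongr
    rw [← mul_assoc] at h5
    have h6 := le_of_mul_le_mul_right h5 hmμ0
    rw [div_mul_eq_mul_div, div_le_iff₀ (by positivity)] at h6
    linarith
  refine ⟨X, hX, Y, hY, d, hdd, hd1, regPair_of_max hd_nonneg hε hε1 he he1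
    (by rw [hd]; field_simp) hstar, ?_, ?_, ?_⟩
  · have := hmd.trans (min_le_left _ _)
    rwa [le_div_iff₀ hx0] at this
  · have := hmd.trans (min_le_right _ _)
    rwa [le_div_iff₀ hy0] at this
  · intro heq
    rcases lt_trichotomy X.card Y.card with h | h | h
    · exfalso
      -- Erasing a vertex of minimum degree from the larger side keeps the smaller relative size and
      -- does not lower the density, so it would give a smaller maximiser.
      obtain ⟨y, hyY, hye⟩ := exists_erase_eb (G := G) Y X hYn
      have hc : ((Y.erase y).card : ℝ) = Y.card - 1 := by
        rw [Finset.card_erase_of_mem hyY, Nat.cast_sub hYn.card_pos]; simp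
      have hlt : (X.card : ℝ) ≤ Y.card - 1 := by
        have : (X.card : ℝ) + 1 ≤ Y.card := by exact_mod_cast h
        linarith
      have hQ : (X, Y.erase y) ∈ C := by
        rw [hmem]
        refine ⟨⟨hX, hXn⟩, (Finset.erase_subset _ _).trans hY, Finset.card_pos.1 ?_⟩
        rw [Finset.card_erase_of_mem hyY]
        have := hXn.card_pos
        omega
      have := hmin' _ hQ (by
        rw [hfXY]
        simp only [hf]
        have hmm : min ((X.card : ℝ) / X0.card) ((Y.erase y).card / Y0.card) = m := by
          rw [hm, hc, heq, min_eq_left (div_le_div_of_nonneg_right hlt hy0.le),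
            min_eq_left (div_le_div_of_nonneg_right (by linarith) hy0.le)]
        rw [hmm]
        refine mul_le_mul_of_nonneg_right ?_ hmμ0.le
        rw [hd, hc, div_le_div_iff₀ (by positivity) (mul_pos hx (by linarith))]
        rw [eb_comm Y X, eb_comm (Y.erase y) X] at hye
        nlinarith)
      dsimp only at this
      rw [Finset.card_erase_of_mem hyY] at this
      have := hYn.card_pos
      omega
    · exact h
    · exfalso
      obtain ⟨x, hxX, hxe⟩ := exists_erase_eb (G := G) X Y hXn
      have hc : ((X.erase x).card : ℝ) = X.card - 1 := by
        rw [Finset.card_erase_of_mem hxX, Nat.cast_sub hXn.card_pos]; simp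
      have hlt : (Y.card : ℝ) ≤ X.card - 1 := by
        have : (Y.card : ℝ) + 1 ≤ X.card := by exact_mod_cast h
        linarith
      have hQ : (X.erase x, Y) ∈ C := by
        rw [hmem]
        refine ⟨⟨(Finset.erase_subset _ _).trans hX, Finset.card_pos.1 ?_⟩, hY, hYn⟩
        rw [Finset.card_erase_of_mem hxX]
        have := hYn.card_pos
        omega
      have := hmin' _ hQ (by
        rw [hfXY]
        simp only [hf]
        have hmm : min (((X.erase x).card : ℝ) / X0.card) (Y.card / Y0.card) = m := by
          rw [hm, hc, heq, min_eq_right (div_le_div_of_nonneg_right hlt hy0.le),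
            min_eq_right (div_le_div_of_nonneg_right (by linarith) hy0.le)]
        rw [hmm]
        refine mul_le_mul_of_nonneg_right ?_ hmμ0.le
        rw [hd, hc, div_le_div_iff₀ (by positivity) (mul_pos (by linarith) hy)]
        nlinarith)
      dsimp only at this
      rw [Finset.card_erase_of_mem hxX] at this
      have := hXn.card_pos
      omega

/-- Regularity survives the deletion of few vertices. -/
lemma RegPair.mono {X Y X' Y' : Finset V} {ε e d : ℝ} (h : RegPair G X Y ε e d)
    (hX : X' ⊆ X) (hY : Y' ⊆ Y) (hε : 0 < ε) (he : 0 ≤ e) (hd : 0 < d)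
    (hXc : (X.card : ℝ) - X'.card ≤ e * d * X.card) (hYc : (Y.card : ℝ) - Y'.card ≤ e * d * Y.card)
    (hed : e * d ≤ 1 / 2) : RegPair G X' Y' (2 * ε) (2 * e) d := by
  -- At least half of each side survives, so a proportion `2 * ε` of a new side is a proportion `ε`
  -- of the old one. The error `e` doubles because a degree may lose a further `e * d * |Y|`.
  have hX1 : (X.card : ℝ) ≤ 2 * X'.card := by
    have : (0 : ℝ) ≤ X.card := by positivity
    nlinarith
  have hY1 : (Y.card : ℝ) ≤ 2 * Y'.card := by
    have : (0 : ℝ) ≤ Y.card := by positivity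
    nlinarith
  have hX2 : (X'.card : ℝ) ≤ X.card := by exact_mod_cast Finset.card_le_card hX
  have hY2 : (Y'.card : ℝ) ≤ Y.card := by exact_mod_cast Finset.card_le_card hY
  have key : ∀ (A B A' B' : Finset V), (B' ⊆ B) → (A' ⊆ A) → (B'.card : ℝ) ≤ B.card →
      (B.card : ℝ) - B'.card ≤ e * d * B.card → ∀ x, (1 - e) * d * B.card ≤ (nbh G B x).card →
      (1 - 2 * e) * d * B'.card ≤ (nbh G B' x).card := by
    intro A B A' B' hB _ hB2 hBc x hx
    have h1 : (nbh G B x).card ≤ (nbh G B' x).card + (B \ B').card := by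
      rw [← Finset.card_union_of_disjoint]
      · refine Finset.card_le_card fun y hy => ?_
        simp only [Finset.mem_union, mem_nbh, Finset.mem_sdiff] at hy ⊢
        tauto
      · rw [Finset.disjoint_left]
        intro y hy hy'
        simp only [mem_nbh, Finset.mem_sdiff] at hy hy'
        tauto
    have h2 : ((B \ B').card : ℝ) = B.card - B'.card := by
      rw [Finset.card_sdiff_of_subset hB, Nat.cast_sub (Finset.card_le_card hB)]
    have h3 : ((nbh G B x).card : ℝ) ≤ (nbh G B' x).card + (B \ B').card := by exact_mod_cast h1
    rw [h2] at h3
    rcases le_total (1 - 2 * e) 0 with h4 | h4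
    · refine le_trans ?_ (Nat.cast_nonneg _)
      have : 0 ≤ d * B'.card := by positivity
      nlinarith
    · have : (1 - 2 * e) * d * B'.card ≤ (1 - 2 * e) * d * B.card := by gcongr
      linarith
  refine ⟨?_, ?_, ?_, ?_⟩
  · intro A hA B hB h1 h2
    have := h.lower A (hA.trans hX) B (hB.trans hY) (by nlinarith) (by nlinarith)
    refine le_trans ?_ this
    gcongr
    linarith
  · intro A hA B hB h1 h2
    have := h.upper A (hA.trans hX) B (hB.trans hY) (by nlinarith) (by nlinarith)
    refine le_trans this ?_
    gcongr
    linarith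
  · intro x hx
    exact key X Y X' Y' hY hX hY2 hYc x (h.degX x (hX hx))
  · intro y hy
    exact key Y X Y' X' hX hY hX2 hXc y (h.degY y (hY hy))

end Regular


/-! ### Candidate sets and their intersections during the embedding. -/

section Candidates

set_option linter.unusedSectionVars false

variable {V α : Type*} [DecidableEq V] [DecidableEq α] {G : SimpleGraph V}
  {F : SimpleGraph α}

open scoped Classical in
/-- The vertices of `Y` that are still possible as image of `b` when the vertices in `D` have been
embedded by `φ`. -/
noncomputable def cand (G : SimpleGraph V) (F : SimpleGraph α) (Y : Finset V) (D : Finset α)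
    (φ : α → V) (b : α) : Finset V :=
  Y.filter (fun w => ∀ a ∈ D, F.Adj a b → G.Adj (φ a) w)

lemma mem_cand {Y : Finset V} {D : Finset α} {φ : α → V} {b : α} {w : V} :
    w ∈ cand G F Y D φ b ↔ w ∈ Y ∧ ∀ a ∈ D, F.Adj a b → G.Adj (φ a) w := by
  simp [cand]

lemma cand_subset (Y : Finset V) (D : Finset α) (φ : α → V) (b : α) : cand G F Y D φ b ⊆ Y :=
  fun _ h => (mem_cand.1 h).1

lemma cand_congr {Y : Finset V} {D D' : Finset α} {φ φ' : α → V} {b : α}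
    (hD : ∀ a, F.Adj a b → (a ∈ D ↔ a ∈ D')) (hφ : ∀ a ∈ D, F.Adj a b → φ a = φ' a) :
    cand G F Y D φ b = cand G F Y D' φ' b := by
  ext w
  rw [mem_cand, mem_cand]
  refine and_congr_right fun _ => ⟨fun h a ha hab => ?_, fun h a ha hab => ?_⟩
  · rw [← hφ a ((hD a hab).2 ha) hab]; exact h a ((hD a hab).2 ha) hab
  · rw [hφ a ha hab]; exact h a ((hD a hab).1 ha) hab

lemma cand_insert_of_adj {Y : Finset V} {D : Finset α} {φ : α → V} {a b : α} (ha : a ∉ D) (x : V)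
    (h : F.Adj a b) :
    cand G F Y (insert a D) (Function.update φ a x) b = nbh G (cand G F Y D φ b) x := by
  ext w
  simp only [mem_cand, mem_nbh, Finset.mem_insert, forall_eq_or_imp, Function.update_self]
  constructor
  · rintro ⟨h1, h2, h3⟩
    refine ⟨⟨h1, fun c hc hcb => ?_⟩, h2 h⟩
    have := h3 c hc hcb
    rwa [Function.update_of_ne (show c ≠ a from fun hca => ha (hca ▸ hc))] at this
  · rintro ⟨⟨h1, h2⟩, h3⟩
    refine ⟨h1, fun _ => h3, fun c hc hcb => ?_⟩
    rw [Function.update_of_ne (show c ≠ a from fun hca => ha (hca ▸ hc))]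
    exact h2 c hc hcb

lemma cand_insert_of_not_adj {Y : Finset V} {D : Finset α} {φ : α → V} {a b : α} (ha : a ∉ D)
    (x : V) (h : ¬ F.Adj a b) :
    cand G F Y (insert a D) (Function.update φ a x) b = cand G F Y D φ b := by
  refine cand_congr (fun c hc => ?_) (fun c hc hcb => ?_)
  · rw [Finset.mem_insert, or_iff_right]
    rintro rfl; exact h hc
  · rw [Function.update_of_ne]
    rintro rfl; exact h hcb

lemma nbh_insert_of_adj {D : Finset α} {a b : α} (ha : a ∉ D) (h : F.Adj a b) :
    (nbh F (insert a D) b).card = (nbh F D b).card + 1 := by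
  have : nbh F (insert a D) b = insert a (nbh F D b) := by
    ext c
    simp only [mem_nbh, Finset.mem_insert]
    constructor
    · rintro ⟨rfl | h1, h2⟩
      exacts [.inl rfl, .inr ⟨h1, h2⟩]
    · rintro (rfl | ⟨h1, h2⟩)
      exacts [⟨.inl rfl, h.symm⟩, ⟨.inr h1, h2⟩]
  rw [this, Finset.card_insert_of_notMem]
  simp [ha]

lemma nbh_insert_of_not_adj {D : Finset α} {a b : α} (h : ¬ F.Adj a b) :
    nbh F (insert a D) b = nbh F D b := by
  ext c
  simp only [mem_nbh, Finset.mem_insert]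
  constructor
  · rintro ⟨rfl | h1, h2⟩
    exacts [absurd h2.symm h, ⟨h1, h2⟩]
  · rintro ⟨h1, h2⟩
    exact ⟨.inr h1, h2⟩

lemma DegLE.card_nbh_le {Δ : ℕ} (hF : DegLE F Δ) (D : Finset α) (b : α) :
    (nbh F D b).card ≤ Δ :=
  hF b _ fun _ hu => (mem_nbh.1 hu).2

-- Otherwise the exceptional vertices and `C` would form a large subpair of too small density.
-- `few_high` is the same argument for too large density.
open scoped Classical in
lemma RegPair.few_low {X Y C : Finset V} {ε e d : ℝ} (h : RegPair G X Y ε e d) (hε : 0 ≤ ε)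
    (hC : C ⊆ Y) (hCc : ε * Y.card ≤ C.card) :
    ((X.filter (fun x => ((nbh G C x).card : ℝ) < (1 - e) * d * C.card)).card : ℝ)
      ≤ ε * X.card := by
  set B := X.filter (fun x => ((nbh G C x).card : ℝ) < (1 - e) * d * C.card) with hB
  by_contra hcon
  push Not at hcon
  have hBpos : B.Nonempty := by
    rw [← Finset.card_pos]
    have : (0 : ℝ) < B.card := lt_of_le_of_lt (by positivity) hcon
    exact_mod_cast this
  have h1 := h.lower B (Finset.filter_subset _ _) C hC hcon.le hCc
  have h2 : eb G B C < ∑ _x ∈ B, (1 - e) * d * C.card :=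
    Finset.sum_lt_sum_of_nonempty hBpos fun x hx => (Finset.mem_filter.1 hx).2
  rw [Finset.sum_const, nsmul_eq_mul] at h2
  linarith

open scoped Classical in
lemma RegPair.few_high {X Y C : Finset V} {ε e d : ℝ} (h : RegPair G X Y ε e d) (hε : 0 ≤ ε)
    (hC : C ⊆ Y) (hCc : ε * Y.card ≤ C.card) :
    ((X.filter (fun x => (1 + e) * d * C.card < ((nbh G C x).card : ℝ))).card : ℝ)
      ≤ ε * X.card := by
  set B := X.filter (fun x => (1 + e) * d * C.card < ((nbh G C x).card : ℝ)) with hB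
  by_contra hcon
  push Not at hcon
  have hBpos : B.Nonempty := by
    rw [← Finset.card_pos]
    have : (0 : ℝ) < B.card := lt_of_le_of_lt (by positivity) hcon
    exact_mod_cast this
  have h1 := h.upper B (Finset.filter_subset _ _) C hC hcon.le hCc
  have h2 : ∑ _x ∈ B, (1 + e) * d * C.card < eb G B C :=
    Finset.sum_lt_sum_of_nonempty hBpos fun x hx => (Finset.mem_filter.1 hx).2
  rw [Finset.sum_const, nsmul_eq_mul] at h2
  linarith

/-- All candidate sets are large. -/
def CandLarge (G : SimpleGraph V) (F : SimpleGraph α) (Y : Finset V) (c q : ℝ) (D : Finset α)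
    (φ : α → V) : Prop :=
  ∀ b, c * q ^ (nbh F D b).card * Y.card ≤ (cand G F Y D φ b).card

variable [Fintype α]

/-- Only the at most `Δ` neighbours of `a` lose candidates, and each is spoiled by at most `ε |X|`
images. Regularity applies because `hcq` keeps every candidate set above `ε |Y|`. -/
lemma candLarge_step {X Y : Finset V} {ε e d c : ℝ} {Δ : ℕ} (h : RegPair G X Y ε e d)
    (hF : DegLE F Δ) (hε : 0 ≤ ε) (hq0 : 0 ≤ (1 - e) * d) (hq1 : (1 - e) * d ≤ 1) (hc : 0 ≤ c)
    (hcq : ε ≤ c * ((1 - e) * d) ^ Δ) {D : Finset α} {φ : α → V} {a : α} (ha : a ∉ D)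
    (hI : CandLarge G F Y c ((1 - e) * d) D φ) {B : Finset V} (hB : B ⊆ X)
    (hB' : ∀ x ∈ B, ¬ CandLarge G F Y c ((1 - e) * d) (insert a D) (Function.update φ a x)) :
    (B.card : ℝ) ≤ Δ * (ε * X.card) := by
  classical
  set q := (1 - e) * d
  set L : α → Finset V := fun b =>
    X.filter (fun x => ((nbh G (cand G F Y D φ b) x).card : ℝ) < q * (cand G F Y D φ b).card)
  have hsub : B ⊆ (nbh F Finset.univ a).biUnion L := by
    intro x hx
    have := hB' x hx
    unfold CandLarge at this
    push Not at this
    obtain ⟨b, hb⟩ := this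
    by_cases hab : F.Adj a b
    · rw [Finset.mem_biUnion]
      refine ⟨b, by simp [hab], Finset.mem_filter.2 ⟨hB hx, ?_⟩⟩
      rw [cand_insert_of_adj ha x hab, nbh_insert_of_adj ha hab] at hb
      refine hb.trans_le ?_
      calc c * q ^ ((nbh F D b).card + 1) * Y.card = q * (c * q ^ (nbh F D b).card * Y.card) := by
            ring
        _ ≤ _ := by gcongr; exact hI b
    · rw [cand_insert_of_not_adj ha x hab, nbh_insert_of_not_adj hab] at hb
      exact absurd (hI b) (not_le.2 hb)
  have hL : ∀ b, ((L b).card : ℝ) ≤ ε * X.card := by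
    intro b
    refine h.few_low hε (cand_subset _ _ _ _) (le_trans ?_ (hI b))
    gcongr
    refine hcq.trans ?_
    gcongr c * ?_
    exact pow_le_pow_of_le_one hq0 hq1 (hF.card_nbh_le _ _)
  calc (B.card : ℝ) ≤ ((nbh F Finset.univ a).biUnion L).card := by
        exact_mod_cast Finset.card_le_card hsub
    _ ≤ ∑ b ∈ nbh F Finset.univ a, ((L b).card : ℝ) := by exact_mod_cast Finset.card_biUnion_le
    _ ≤ ∑ _b ∈ nbh F Finset.univ a, ε * X.card := Finset.sum_le_sum fun b _ => hL b
    _ = (nbh F Finset.univ a).card * (ε * X.card) := by rw [Finset.sum_const, nsmul_eq_mul]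
    _ ≤ _ := by
      gcongr
      exact hF.card_nbh_le _ _

/-- The candidate sets of `b` and `b'` do not intersect much more than expected. -/
def PairOK (G : SimpleGraph V) (F : SimpleGraph α) (Y : Finset V) (h ε : ℝ) (D : Finset α)
    (φ : α → V) (b b' : α) : Prop :=
  ((cand G F Y D φ b ∩ cand G F Y D φ b').card : ℝ)
    ≤ max (h ^ ((nbh F D b).card + (nbh F D b').card)) ε * Y.card

open scoped Classical in
/-- The pairs without common neighbour whose candidate sets intersect too much. -/
noncomputable def badPairs (G : SimpleGraph V) (F : SimpleGraph α) (Y : Finset V) (h ε : ℝ)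
    (D : Finset α) (φ : α → V) : Finset (α × α) :=
  Finset.univ.filter (fun P => (∀ a, F.Adj a P.1 → ¬ F.Adj a P.2) ∧
    ¬ PairOK G F Y h ε D φ P.1 P.2)

lemma PairOK.symm {Y : Finset V} {h ε : ℝ} {D : Finset α} {φ : α → V} {b b' : α}
    (hp : PairOK G F Y h ε D φ b b') : PairOK G F Y h ε D φ b' b := by
  unfold PairOK at *
  rwa [Finset.inter_comm, add_comm]

-- Since `a` is adjacent to `b` only, just one of the two candidate sets shrinks, and their
-- intersection `I` becomes the neighbourhood of `x` inside `I`. If `I` is large, regularity shrinks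
-- it by the right factor for nearly all `x`; if `I` is small, the truncation at `ε` in `PairOK`
-- makes it harmless.
open scoped Classical in
lemma pair_step {X Y : Finset V} {ε e d : ℝ} (h : RegPair G X Y ε e d) (hε : 0 ≤ ε)
    (hh : 0 ≤ (1 + e) * d)
    {D : Finset α} {φ : α → V} {a b b' : α} (ha : a ∉ D) (hab : F.Adj a b) (hab' : ¬ F.Adj a b')
    (hok : PairOK G F Y ((1 + e) * d) ε D φ b b') :
    ((X.filter (fun x => ¬ PairOK G F Y ((1 + e) * d) ε (insert a D) (Function.update φ a x)
      b b')).card : ℝ) ≤ ε * X.card := by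
  set r := (1 + e) * d
  set I := cand G F Y D φ b ∩ cand G F Y D φ b' with hI
  have hinter : ∀ x, cand G F Y (insert a D) (Function.update φ a x) b ∩
      cand G F Y (insert a D) (Function.update φ a x) b' = nbh G I x := by
    intro x
    rw [cand_insert_of_adj ha x hab, cand_insert_of_not_adj ha x hab', hI]
    ext w
    simp only [Finset.mem_inter, mem_nbh]
    tauto
  have hIY : I ⊆ Y := Finset.inter_subset_left.trans (cand_subset _ _ _ _)
  unfold PairOK at hok ⊢
  simp only [hinter, nbh_insert_of_adj ha hab, nbh_insert_of_not_adj hab']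
  rw [← hI] at hok
  rcases le_total (ε * Y.card) I.card with hc | hc
  · refine le_trans ?_ (h.few_high hε hIY hc)
    refine Nat.cast_le.2 (Finset.card_le_card fun x hx => ?_)
    rw [Finset.mem_filter] at hx ⊢
    refine ⟨hx.1, ?_⟩
    by_contra hcon
    push Not at hcon
    refine hx.2 ?_
    rcases le_total (r ^ ((nbh F D b).card + (nbh F D b').card)) ε with hm | hm
    · rw [max_eq_right hm] at hok
      calc ((nbh G I x).card : ℝ) ≤ I.card := by exact_mod_cast Finset.card_le_card (nbh_subset _ _)
        _ ≤ ε * Y.card := hok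
        _ ≤ _ := by gcongr; exact le_max_right _ _
    · rw [max_eq_left hm] at hok
      calc ((nbh G I x).card : ℝ) ≤ r * I.card := hcon
        _ ≤ r * (r ^ ((nbh F D b).card + (nbh F D b').card) * Y.card) := by gcongr
        _ = r ^ ((nbh F D b).card + 1 + (nbh F D b').card) * Y.card := by ring
        _ ≤ _ := by gcongr; exact le_max_left _ _
  · rw [Finset.filter_false_of_mem]
    · simp; positivity
    · intro x _ hx
      refine hx ?_
      calc ((nbh G I x).card : ℝ) ≤ I.card := by exact_mod_cast Finset.card_le_card (nbh_subset _ _)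
        _ ≤ ε * Y.card := hc
        _ ≤ _ := by gcongr; exact le_max_right _ _

/-- A new bad pair contains a neighbour of `a`, so there are at most `2 Δ |α|` possible ones, and
each becomes bad for at most `ε |X|` images. A single image might create many, so only the sum is
controlled; this is the cost in `greedy_extend`. -/
lemma badPairs_step {X Y : Finset V} {ε e d : ℝ} {Δ : ℕ} (h : RegPair G X Y ε e d)
    (hF : DegLE F Δ) (hε : 0 ≤ ε) (hh : 0 ≤ (1 + e) * d)
    {D : Finset α} {φ : α → V} {a : α} (ha : a ∉ D) {B : Finset V} (hB : B ⊆ X) :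
    ∑ x ∈ B, (((badPairs G F Y ((1 + e) * d) ε (insert a D) (Function.update φ a x)).card : ℝ)
      - (badPairs G F Y ((1 + e) * d) ε D φ).card) ≤ 2 * Δ * Fintype.card α * (ε * X.card) := by
  classical
  set r := (1 + e) * d
  set N := nbh F Finset.univ a with hN
  set Q : Finset (α × α) := ((N ×ˢ Finset.univ) ∪ (Finset.univ ×ˢ N)).filter
    (fun P => (∀ c, F.Adj c P.1 → ¬ F.Adj c P.2) ∧ PairOK G F Y r ε D φ P.1 P.2) with hQ
  have h1 : ∀ x ∈ B, ((badPairs G F Y r ε (insert a D) (Function.update φ a x)).card : ℝ)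
      - (badPairs G F Y r ε D φ).card ≤ ∑ P ∈ Q,
        if ¬ PairOK G F Y r ε (insert a D) (Function.update φ a x) P.1 P.2 then (1 : ℝ) else 0 := by
    intro x _
    rw [Finset.sum_boole, sub_le_iff_le_add, ← Nat.cast_add, Nat.cast_le]
    refine (Finset.card_le_card fun P hP => ?_).trans (Finset.card_union_le _ _)
    simp only [badPairs, Finset.mem_filter, Finset.mem_univ, true_and] at hP
    by_cases hok : PairOK G F Y r ε D φ P.1 P.2
    · refine Finset.mem_union_left _ (Finset.mem_filter.2 ⟨?_, hP.2⟩)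
      rw [hQ, Finset.mem_filter]
      refine ⟨?_, hP.1, hok⟩
      by_contra hcon
      simp only [hN, Finset.mem_union, Finset.mem_product, mem_nbh, Finset.mem_univ, true_and,
        and_true, not_or] at hcon
      refine hP.2 ?_
      unfold PairOK at hok ⊢
      rwa [cand_insert_of_not_adj ha x hcon.1, cand_insert_of_not_adj ha x hcon.2,
        nbh_insert_of_not_adj hcon.1, nbh_insert_of_not_adj hcon.2]
    · refine Finset.mem_union_right _ ?_
      simp only [badPairs, Finset.mem_filter, Finset.mem_univ, true_and]
      exact ⟨hP.1, hok⟩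
  have hcardN : (N.card : ℝ) ≤ Δ := by exact_mod_cast hF.card_nbh_le _ _
  calc _ ≤ ∑ x ∈ B, ∑ P ∈ Q,
        (if ¬ PairOK G F Y r ε (insert a D) (Function.update φ a x) P.1 P.2 then (1 : ℝ) else 0) :=
        Finset.sum_le_sum h1
    _ = ∑ P ∈ Q, ((B.filter (fun x => ¬ PairOK G F Y r ε (insert a D) (Function.update φ a x)
          P.1 P.2)).card : ℝ) := by
        rw [Finset.sum_comm]
        simp_rw [Finset.sum_boole]
    _ ≤ ∑ _P ∈ Q, ε * X.card := by
        refine Finset.sum_le_sum fun P hP => ?_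
        rw [hQ, Finset.mem_filter] at hP
        obtain ⟨hPm, hPc, hok⟩ := hP
        refine le_trans (Nat.cast_le.2 (Finset.card_le_card (Finset.filter_subset_filter _ hB))) ?_
        simp only [hN, Finset.mem_union, Finset.mem_product, mem_nbh, Finset.mem_univ, true_and,
          and_true] at hPm
        rcases hPm with hPm | hPm
        · exact pair_step h hε hh ha hPm (hPc a hPm) hok
        · have := pair_step h hε hh ha hPm (fun h' => hPc a h' hPm) hok.symm
          refine le_trans (Nat.cast_le.2 (Finset.card_le_card fun x hx => ?_)) this
          rw [Finset.mem_filter] at hx ⊢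
          exact ⟨hx.1, fun h' => hx.2 h'.symm⟩
    _ = Q.card * (ε * X.card) := by rw [Finset.sum_const, nsmul_eq_mul]
    _ ≤ _ := by
        gcongr
        have : Q.card ≤ N.card * Fintype.card α + Fintype.card α * N.card := by
          refine (Finset.card_filter_le _ _).trans ((Finset.card_union_le _ _).trans ?_)
          rw [Finset.card_product, Finset.card_product, Finset.card_univ]
        calc (Q.card : ℝ) ≤ N.card * Fintype.card α + Fintype.card α * N.card := by
              exact_mod_cast this
          _ ≤ Δ * Fintype.card α + Fintype.card α * Δ := by gcongr
          _ = _ := by ring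

open scoped Classical in
/-- Second moment estimate for a family of sets with small pairwise intersections. -/
lemma second_moment {β : Type*} (Y : Finset V) (S : Finset β) (C : β → Finset V)
    (hC : ∀ b, C b ⊆ Y) (p : β → ℝ) {p0 η η' : ℝ} (hp0 : 0 < p0) (hp : ∀ b ∈ S, p0 ≤ p b)
    (hlow : ∀ b ∈ S, (1 - η) * p b * Y.card ≤ (C b).card)
    (Bad : Finset (β × β)) (hη' : 0 ≤ η')
    (hpair : ∀ b ∈ S, ∀ b' ∈ S, (b, b') ∉ Bad →
      ((C b ∩ C b').card : ℝ) ≤ (1 + η') * (p b * p b') * Y.card) :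
    ((Y.filter (fun w => (∑ b ∈ S, if w ∈ C b then 1 / p b else 0) ≤ S.card / 2)).card : ℝ)
      * (S.card / 2) ^ 2 ≤ ((η' + 2 * η) * S.card ^ 2 + Bad.card / p0 ^ 2) * Y.card := by
  -- Weighting each set by the inverse of its expected density makes `|S|` the expected value of
  -- `g`. The lower bound on the first moment and the upper bound on the second bound the variance
  -- about `|S|`, and Chebyshev's inequality finishes.
  set g : V → ℝ := fun w => ∑ b ∈ S, if w ∈ C b then 1 / p b else 0 with hg
  have hppos : ∀ b ∈ S, 0 < p b := fun b hb => hp0.trans_le (hp b hb)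
  have hsum1 : (1 - η) * S.card * Y.card ≤ ∑ w ∈ Y, g w := by
    have : ∑ w ∈ Y, g w = ∑ b ∈ S, (C b).card / p b := by
      simp only [hg]
      rw [Finset.sum_comm]
      refine Finset.sum_congr rfl fun b _ => ?_
      rw [← Finset.sum_filter, Finset.sum_const, nsmul_eq_mul, Finset.filter_mem_eq_inter,
        Finset.inter_eq_right.2 (hC b)]
      ring
    rw [this]
    calc (1 - η) * S.card * Y.card = ∑ _b ∈ S, (1 - η) * Y.card := by
          rw [Finset.sum_const, nsmul_eq_mul]; ring
      _ ≤ _ := by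
        refine Finset.sum_le_sum fun b hb => ?_
        rw [le_div_iff₀ (hppos b hb)]
        linarith [hlow b hb]
  have hsum2 : ∑ w ∈ Y, g w ^ 2 ≤ ((1 + η') * S.card ^ 2 + Bad.card / p0 ^ 2) * Y.card := by
    have h1 : ∑ w ∈ Y, g w ^ 2 = ∑ P ∈ S ×ˢ S, ((C P.1 ∩ C P.2).card : ℝ) / (p P.1 * p P.2) := by
      have : ∀ w, g w ^ 2 = ∑ P ∈ S ×ˢ S, if w ∈ C P.1 ∩ C P.2 then 1 / (p P.1 * p P.2) else 0 := by
        intro w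
        rw [sq, hg, Finset.sum_mul_sum, Finset.sum_product]
        refine Finset.sum_congr rfl fun b _ => Finset.sum_congr rfl fun b' _ => ?_
        simp only [Finset.mem_inter]
        by_cases h1 : w ∈ C b <;> by_cases h2 : w ∈ C b' <;> simp [h1, h2, mul_comm]
      simp_rw [this]
      rw [Finset.sum_comm]
      refine Finset.sum_congr rfl fun P _ => ?_
      rw [← Finset.sum_filter, Finset.sum_const, nsmul_eq_mul, Finset.filter_mem_eq_inter,
        Finset.inter_eq_right.2 (Finset.inter_subset_left.trans (hC _))]
      ring
    rw [h1]
    have h2 : ∀ P ∈ S ×ˢ S, ((C P.1 ∩ C P.2).card : ℝ) / (p P.1 * p P.2) ≤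
        (1 + η') * Y.card + if P ∈ Bad then Y.card / p0 ^ 2 else 0 := by
      intro P hP
      obtain ⟨hP1, hP2⟩ := Finset.mem_product.1 hP
      have hpp : 0 < p P.1 * p P.2 := mul_pos (hppos _ hP1) (hppos _ hP2)
      split_ifs with hb
      · have : ((C P.1 ∩ C P.2).card : ℝ) / (p P.1 * p P.2) ≤ Y.card / p0 ^ 2 := by
          have h3 : p0 ^ 2 ≤ p P.1 * p P.2 := by
            rw [sq]
            exact mul_le_mul (hp _ hP1) (hp _ hP2) hp0.le (hppos _ hP1).le
          have h4 : ((C P.1 ∩ C P.2).card : ℝ) ≤ Y.card := by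
            exact_mod_cast Finset.card_le_card (Finset.inter_subset_left.trans (hC _))
          gcongr
        have : 0 ≤ (1 + η') * Y.card := by positivity
        linarith
      · rw [add_zero, div_le_iff₀ hpp]
        linarith [hpair _ hP1 _ hP2 hb]
    refine (Finset.sum_le_sum h2).trans ?_
    rw [Finset.sum_add_distrib, Finset.sum_const, nsmul_eq_mul, Finset.card_product,
      ← Finset.sum_filter, Finset.sum_const, nsmul_eq_mul]
    have h3 : (((S ×ˢ S).filter (· ∈ Bad)).card : ℝ) ≤ Bad.card := by
      rw [Finset.filter_mem_eq_inter]
      exact_mod_cast Finset.card_le_card Finset.inter_subset_right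
    have h4 : (((S ×ˢ S).filter (· ∈ Bad)).card : ℝ) * (Y.card / p0 ^ 2) ≤
        Bad.card * (Y.card / p0 ^ 2) := by gcongr
    push_cast
    calc _ ≤ (S.card * S.card : ℝ) * ((1 + η') * Y.card) + Bad.card * (Y.card / p0 ^ 2) := by
          linarith
      _ = _ := by ring
  have hvar : ∑ w ∈ Y, (g w - S.card) ^ 2 ≤
      ((η' + 2 * η) * S.card ^ 2 + Bad.card / p0 ^ 2) * Y.card := by
    have : ∑ w ∈ Y, (g w - S.card) ^ 2 =
        ∑ w ∈ Y, g w ^ 2 - 2 * S.card * ∑ w ∈ Y, g w + S.card ^ 2 * Y.card := by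
      simp_rw [sub_sq]
      rw [Finset.sum_add_distrib, Finset.sum_sub_distrib, Finset.sum_const, nsmul_eq_mul,
        Finset.mul_sum]
      simp only [mul_comm, mul_assoc]
    rw [this]
    have h3 : 2 * (S.card : ℝ) * ((1 - η) * S.card * Y.card) ≤ 2 * S.card * ∑ w ∈ Y, g w := by
      gcongr
    nlinarith
  refine le_trans ?_ hvar
  rw [← nsmul_eq_mul, ← Finset.sum_const]
  refine le_trans (Finset.sum_le_sum (g := fun w => (g w - S.card) ^ 2) fun w hw => ?_)
    (Finset.sum_le_sum_of_subset_of_nonneg (Finset.filter_subset _ _) fun _ _ _ => sq_nonneg _)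
  have h5 := (Finset.mem_filter.1 hw).2
  have h6 : g w ≤ S.card / 2 := h5
  have h7 : (0 : ℝ) ≤ S.card := by positivity
  have h8 : (S.card : ℝ) / 2 ≤ S.card - g w := by linarith
  calc ((S.card : ℝ) / 2) ^ 2 ≤ (S.card - g w) ^ 2 := by gcongr
    _ = _ := by ring

end Candidates


/-! ### Independent sets, Hall's theorem and the distribution of candidate sets. -/

section Exact

set_option linter.unusedSectionVars false

lemma Real.exp_le_one_add_two_mul {x : ℝ} (h0 : 0 ≤ x) (h1 : x ≤ 1) : Real.exp x ≤ 1 + 2 * x := by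
  have := (abs_le.1 (Real.abs_exp_sub_one_sub_id_le (x := x) (by rwa [abs_of_nonneg h0]))).2
  nlinarith

/-- The smallness conditions on the basic parameter `p` in terms of a density `d` and a degree
bound `Δ`. -/
structure SmallParam (p d : ℝ) (Δ : ℕ) : Prop where
  pos : 0 < p
  le_sixteenth : p ≤ 1 / 16
  degree : Δ * p ≤ 1
  density_pos : 0 < d
  density_le_one : d ≤ 1
  le_density : 16 * p ≤ d
  le_density_pow : 16 * p ≤ d ^ Δ

lemma exists_injOn_of_hall {β V : Type*} [DecidableEq V] [Nonempty V] (A : Finset β)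
    (t : β → Finset V) (h : ∀ S ⊆ A, S.card ≤ (S.biUnion t).card) :
    ∃ f : β → V, Set.InjOn f A ∧ ∀ a ∈ A, f a ∈ t a := by
  classical
  obtain ⟨f, hf, hft⟩ := (Finset.all_card_le_biUnion_card_iff_exists_injective
    (fun a : {a // a ∈ A} => t a)).1 (by
      intro s
      have := h (s.map (Function.Embedding.subtype _)) (by
        intro x hx
        obtain ⟨y, _, rfl⟩ := Finset.mem_map.1 hx
        exact y.2)
      rw [Finset.card_map] at this
      refine this.trans (Finset.card_le_card ?_)
      intro v hv
      simp only [Finset.mem_biUnion, Finset.mem_map, Function.Embedding.subtype_apply] at hv ⊢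
      obtain ⟨_, ⟨y, hy, rfl⟩, hv⟩ := hv
      exact ⟨y, hy, hv⟩)
  refine ⟨fun b => if hb : b ∈ A then f ⟨b, hb⟩ else Classical.arbitrary V, ?_, ?_⟩
  · intro a ha b hb hab
    simp only [Finset.mem_coe] at ha hb
    simp only [ha, hb, dif_pos] at hab
    exact congrArg Subtype.val (hf hab)
  · intro a ha
    simp only [ha, dif_pos]
    exact hft ⟨a, ha⟩

/-- A relation of bounded degree has large independent sets. -/
lemma exists_independent {β : Type*} [DecidableEq β] (R : β → β → Prop) [DecidableRel R]
    (hR : ∀ a b, R a b → R b a) (K : ℕ) :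
    ∀ (n : ℕ) (Pool : Finset β), (∀ b ∈ Pool, (Pool.filter (R b)).card ≤ K) →
      n * (K + 1) ≤ Pool.card →
      ∃ I ⊆ Pool, I.card = n ∧ ∀ a ∈ I, ∀ b ∈ I, a ≠ b → ¬ R a b := by
  intro n
  induction n with
  | zero => intro Pool _ _; exact ⟨∅, by simp, by simp, by simp⟩
  | succ n ih =>
    intro Pool hK hc
    have hne : Pool.Nonempty := by
      rw [← Finset.card_pos]
      have : 0 < (n + 1) * (K + 1) := by positivity
      omega
    obtain ⟨b, hb⟩ := hne
    -- Greedy choice: each chosen element costs itself and at most `K` related ones.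
    set P' := (Pool.erase b) \ Pool.filter (R b) with hP'
    have hP'sub : P' ⊆ Pool := Finset.sdiff_subset.trans (Finset.erase_subset _ _)
    obtain ⟨I, hI, hIc, hind⟩ := ih P' (fun c hc => (Finset.card_le_card
      (Finset.filter_subset_filter _ hP'sub)).trans (hK c (hP'sub hc))) (by
        have h1 := Finset.le_card_sdiff (Pool.filter (R b)) (Pool.erase b)
        rw [Finset.card_erase_of_mem hb] at h1
        have h2 := hK b hb
        have h3 : (n + 1) * (K + 1) = n * (K + 1) + K + 1 := by ring
        rw [hP']
        omega)
    have hbI : b ∉ I := fun h => by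
      have := hI h
      simp [hP'] at this
    have hbR : ∀ c ∈ I, ¬ R b c := fun c hc h => by
      have h1 := hI hc
      rw [hP', Finset.mem_sdiff] at h1
      exact h1.2 (Finset.mem_filter.2 ⟨hP'sub (hI hc), h⟩)
    refine ⟨insert b I, ?_, ?_, ?_⟩
    · intro c hc
      rcases Finset.mem_insert.1 hc with rfl | hc
      exacts [hb, hP'sub (hI hc)]
    · rw [Finset.card_insert_of_notMem hbI, hIc]
    · intro c hc c' hc' hne
      rcases Finset.mem_insert.1 hc with h1 | h1 <;> rcases Finset.mem_insert.1 hc' with h2 | h2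
      · exact absurd (h1.trans h2.symm) hne
      · subst h1; exact hbR _ h2
      · subst h2; exact fun h => hbR _ h1 (hR _ _ h)
      · exact hind _ h1 _ h2 hne

variable {V α : Type*} [DecidableEq V] [DecidableEq α] [Fintype α] {G : SimpleGraph V}
  {F : SimpleGraph α}

lemma DegLE.card_biUnion_nbh_le {Δ : ℕ} (hF : DegLE F Δ) (S : Finset α) :
    (S.biUnion (nbh F Finset.univ)).card ≤ S.card * Δ :=
  Finset.card_biUnion_le_card_mul _ _ _ fun _ _ => hF.card_nbh_le _ _

open scoped Classical in
/-- At most `Δ²` vertices share a neighbour with a given one. -/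
lemma DegLE.card_common_le {Δ : ℕ} (hF : DegLE F Δ) (P : Finset α) (b : α) :
    (P.filter (fun b' => ∃ a, F.Adj a b ∧ F.Adj a b')).card ≤ Δ * Δ := by
  have : P.filter (fun b' => ∃ a, F.Adj a b ∧ F.Adj a b') ⊆
      (nbh F Finset.univ b).biUnion (nbh F Finset.univ) := by
    intro b' hb'
    obtain ⟨_, a, h1, h2⟩ := Finset.mem_filter.1 hb'
    simp only [Finset.mem_biUnion, mem_nbh, Finset.mem_univ, true_and]
    exact ⟨a, h1.symm, h2⟩
  refine (Finset.card_le_card this).trans ((hF.card_biUnion_nbh_le _).trans ?_)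
  exact Nat.mul_le_mul_right _ (hF.card_nbh_le _ _)

open scoped Classical in
/-- In a state with few bad pairs almost all vertices of `Y` belong to about the expected number of
candidate sets of every large family. -/
lemma few_light {Y : Finset V} {p d : ℝ} {Δ : ℕ} (hp : SmallParam p d Δ) (hF : DegLE F Δ)
    {D : Finset α} {φ : α → V} (hI : CandLarge G F Y 1 ((1 - p ^ 8) * d) D φ)
    (hk : 1 ≤ p ^ 17 * Fintype.card α)
    (hbad : ((badPairs G F Y ((1 + p ^ 8) * d) (p ^ 25) D φ).card : ℝ)
      ≤ p ^ 18 / 4 * (Fintype.card α : ℝ) ^ 2)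
    (S : Finset α) (hS : p ^ 5 * Fintype.card α ≤ S.card) :
    ((Y.filter (fun w => (∑ b ∈ S, if w ∈ cand G F Y D φ b then
      1 / d ^ (nbh F D b).card else 0) ≤ S.card / 2)).card : ℝ) ≤ 4 * p ^ 6 * Y.card := by
  obtain ⟨p0, p16, hΔ, hd0, hd1, -, hpd⟩ := hp
  set k : ℝ := (Fintype.card α : ℝ) with hkdef
  have hk0 : 0 < k := by
    by_contra hcon
    have : p ^ 17 * k ≤ 0 := mul_nonpos_of_nonneg_of_nonpos (by positivity) (not_lt.1 hcon)
    linarith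
  have hS0 : (0 : ℝ) < S.card := lt_of_lt_of_le (by positivity) hS
  have hp1 : p ≤ 1 := by linarith
  have hΔe : Δ * p ^ 8 ≤ p ^ 7 := by
    calc Δ * p ^ 8 = Δ * p * p ^ 7 := by ring
      _ ≤ 1 * p ^ 7 := by gcongr
      _ = _ := one_mul _
  have hdeg : ∀ b, (nbh F D b).card ≤ Δ := fun b => hF.card_nbh_le _ _
  -- `badPairs` says nothing about pairs with a common neighbour. There are at most `|S| Δ²` of
  -- them, which is negligible against `|S|²` by `hk`, so they join the bad pairs.
  set C2 := (S ×ˢ S).filter (fun P : α × α => ∃ a, F.Adj a P.1 ∧ F.Adj a P.2) with hC2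
  have hC2c : (C2.card : ℝ) ≤ S.card * (Δ * Δ) := by
    have : C2.card ≤ ∑ b ∈ S, (S.filter (fun b' => ∃ a, F.Adj a b ∧ F.Adj a b')).card := by
      rw [← Finset.card_sigma]
      refine Finset.card_le_card_of_injOn (fun P => ⟨P.1, P.2⟩) ?_ ?_
      · intro P hP
        have hP' := Finset.mem_filter.1 (Finset.mem_coe.1 hP)
        have := Finset.mem_product.1 hP'.1
        simp only [Finset.mem_coe, Finset.mem_sigma, Finset.mem_filter]
        exact ⟨this.1, this.2, hP'.2⟩
      · rintro ⟨a, b⟩ _ ⟨a', b'⟩ _ h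
        simpa using h
    have h2 : C2.card ≤ S.card * (Δ * Δ) := by
      refine this.trans ((Finset.sum_le_sum fun b _ => hF.card_common_le S b).trans ?_)
      simp
    exact_mod_cast h2
  -- As `Δ p ≤ 1`, the powers `(1 ± p^8)^j` with `j ≤ 2Δ` differ from `1` by a multiple of `p^7`;
  -- this gives `η` and `η'`. The bound `16 p ≤ d^Δ` allows `p0 = p` and puts the truncation `p^25`
  -- below every relevant `d^n`.
  have key := second_moment Y S (cand G F Y D φ) (cand_subset Y D φ)
    (fun b => d ^ (nbh F D b).card) (p0 := p) (η := p ^ 7) (η' := 4 * p ^ 7) p0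
    (fun b _ => by
      have := pow_le_pow_of_le_one hd0.le hd1 (hdeg b)
      linarith)
    (fun b _ => by
      refine le_trans ?_ (hI b)
      rw [one_mul, mul_pow]
      gcongr
      have h1 := one_add_mul_le_pow (a := -p ^ 8) (by nlinarith [pow_le_one₀ p0.le hp1 (n := 8)])
        (nbh F D b).card
      have h2 : ((nbh F D b).card : ℝ) * p ^ 8 ≤ Δ * p ^ 8 := by
        gcongr; exact_mod_cast hdeg b
      have h3 : (1 - p ^ 8) = 1 + -p ^ 8 := by ring
      rw [h3]
      refine le_trans ?_ h1
      linarith)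
    (badPairs G F Y ((1 + p ^ 8) * d) (p ^ 25) D φ ∪ C2) (by positivity)
    (fun b hb b' hb' hnot => by
      rw [Finset.mem_union, not_or] at hnot
      obtain ⟨h1, h2⟩ := hnot
      have hnc : ∀ a, F.Adj a b → ¬ F.Adj a b' := by
        intro a ha hb2
        exact h2 (Finset.mem_filter.2 ⟨Finset.mem_product.2 ⟨hb, hb'⟩, a, ha, hb2⟩)
      have hok : PairOK G F Y ((1 + p ^ 8) * d) (p ^ 25) D φ b b' := by
        by_contra hcon
        exact h1 (by simp only [badPairs, Finset.mem_filter, Finset.mem_univ, true_and]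
                     exact ⟨hnc, hcon⟩)
      refine hok.trans ?_
      gcongr
      rw [← pow_add]
      set n := (nbh F D b).card + (nbh F D b').card with hn
      have hn2 : n ≤ 2 * Δ := by have := hdeg b; have := hdeg b'; omega
      refine max_le ?_ ?_
      · rw [mul_pow]
        gcongr
        have h3 : (1 + p ^ 8) ^ n ≤ Real.exp (n * p ^ 8) := by
          rw [Real.exp_nat_mul]
          gcongr
          rw [add_comm]; exact Real.add_one_le_exp _
        have h4 : (n : ℝ) * p ^ 8 ≤ 2 * p ^ 7 := by
          calc (n : ℝ) * p ^ 8 ≤ (2 * Δ : ℕ) * p ^ 8 := by gcongr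
            _ = 2 * (Δ * p ^ 8) := by push_cast; ring
            _ ≤ _ := by gcongr
        have h5 : 2 * p ^ 7 ≤ 1 := by
          have : p ^ 7 ≤ p := by
            calc p ^ 7 ≤ p ^ 1 := pow_le_pow_of_le_one p0.le hp1 (by norm_num)
              _ = p := pow_one p
          linarith
        refine h3.trans ((Real.exp_le_one_add_two_mul (by positivity) (h4.trans h5)).trans ?_)
        linarith
      · have h3 : p ^ 25 ≤ p ^ 2 := pow_le_pow_of_le_one p0.le hp1 (by norm_num)
        have h4 : p ^ 2 ≤ (d ^ Δ) ^ 2 := by gcongr; linarith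
        have h5 : (d ^ Δ) ^ 2 ≤ d ^ n := by
          rw [← pow_mul]; exact pow_le_pow_of_le_one hd0.le hd1 (by omega)
        have h6 : 0 ≤ 4 * p ^ 7 * d ^ n := by positivity
        linarith)
  have hcu : ((badPairs G F Y ((1 + p ^ 8) * d) (p ^ 25) D φ ∪ C2).card : ℝ) / p ^ 2 ≤
      p ^ 6 / 2 * (S.card : ℝ) ^ 2 := by
    rw [div_le_iff₀ (by positivity)]
    have h1 : ((badPairs G F Y ((1 + p ^ 8) * d) (p ^ 25) D φ ∪ C2).card : ℝ) ≤
        p ^ 18 / 4 * k ^ 2 + S.card * (Δ * Δ) := by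
      refine le_trans ?_ (add_le_add hbad hC2c)
      exact_mod_cast Finset.card_union_le _ _
    have h2 : p ^ 18 / 4 * k ^ 2 ≤ p ^ 8 / 4 * (S.card : ℝ) ^ 2 := by
      calc p ^ 18 / 4 * k ^ 2 = p ^ 8 / 4 * (p ^ 5 * k) ^ 2 := by ring
        _ ≤ _ := by gcongr
    have h3 : (S.card : ℝ) * (Δ * Δ) ≤ p ^ 8 / 4 * (S.card : ℝ) ^ 2 := by
      have h4 : (Δ * Δ : ℝ) ≤ p ^ 8 / 4 * S.card := by
        have h5 : 1 ≤ p ^ 12 * S.card := by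
          calc 1 ≤ p ^ 17 * k := hk
            _ = p ^ 12 * (p ^ 5 * k) := by ring
            _ ≤ _ := by gcongr
        have h6 : (Δ * Δ : ℝ) * p ^ 2 ≤ 1 := by
          calc (Δ * Δ : ℝ) * p ^ 2 = (Δ * p) * (Δ * p) := by ring
            _ ≤ 1 * 1 := by gcongr
            _ = 1 := by ring
        have h7 : p ^ 10 * S.card ≤ p ^ 10 * S.card * 1 := by simp
        have h8 : (4 * p ^ 2) * p ^ 8 * S.card ≤ p ^ 8 * S.card := by
          have : 4 * p ^ 2 ≤ 1 := by nlinarith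
          calc (4 * p ^ 2) * p ^ 8 * S.card = (4 * p ^ 2) * (p ^ 8 * S.card) := by ring
            _ ≤ 1 * (p ^ 8 * S.card) := by gcongr
            _ = _ := one_mul _
        have h9 : (Δ * Δ : ℝ) ≤ p ^ 10 * S.card := by
          have : (Δ * Δ : ℝ) * 1 ≤ (Δ * Δ : ℝ) * (p ^ 12 * S.card) := by gcongr
          calc (Δ * Δ : ℝ) = (Δ * Δ : ℝ) * 1 := by ring
            _ ≤ _ := this
            _ = ((Δ * Δ : ℝ) * p ^ 2) * (p ^ 10 * S.card) := by ring
            _ ≤ 1 * (p ^ 10 * S.card) := by gcongr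
            _ = _ := by ring
        have h10 : (4 * p ^ 2) * p ^ 8 * S.card = 4 * (p ^ 10 * S.card) := by ring
        linarith
      calc (S.card : ℝ) * (Δ * Δ) ≤ S.card * (p ^ 8 / 4 * S.card) := by gcongr
        _ = _ := by ring
    calc _ ≤ _ := h1
      _ ≤ p ^ 8 / 4 * (S.card : ℝ) ^ 2 + p ^ 8 / 4 * (S.card : ℝ) ^ 2 := add_le_add h2 h3
      _ = _ := by ring
  have h67 : 6 * p ^ 7 ≤ p ^ 6 / 2 := by
    have : p ^ 7 = p * p ^ 6 := by ring
    rw [this]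
    have : 0 < p ^ 6 := by positivity
    nlinarith
  have hfin : ((4 * p ^ 7 + 2 * p ^ 7) * (S.card : ℝ) ^ 2 +
      ((badPairs G F Y ((1 + p ^ 8) * d) (p ^ 25) D φ ∪ C2).card : ℝ) / p ^ 2) * Y.card
      ≤ (4 * p ^ 6 * Y.card) * (S.card / 2) ^ 2 := by
    calc _ ≤ (p ^ 6 / 2 * (S.card : ℝ) ^ 2 + p ^ 6 / 2 * (S.card : ℝ) ^ 2) * Y.card := by
          gcongr
          linarith
      _ = _ := by ring
  exact le_of_mul_le_mul_right (key.trans hfin) (by positivity)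

end Exact


/-! ### Embedding one side exactly by means of a sparse buffer. -/

section Buffer

set_option linter.unusedSectionVars false

variable {V α : Type*} [DecidableEq V] [DecidableEq α] [Fintype α] {G : SimpleGraph V}
  {F : SimpleGraph α}

lemma CandLarge.congr {Y : Finset V} {c q : ℝ} {D : Finset α} {φ φ' : α → V}
    (h : CandLarge G F Y c q D φ) (hφ : ∀ a ∈ D, φ' a = φ a) : CandLarge G F Y c q D φ' := by
  intro b
  rw [cand_congr (D := D) (D' := D) (φ := φ') (φ' := φ) (fun _ _ => Iff.rfl)
    fun a ha _ => hφ a ha]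
  exact h b

lemma badPairs_congr {Y : Finset V} {h ε : ℝ} {D : Finset α} {φ φ' : α → V}
    (hφ : ∀ a ∈ D, φ' a = φ a) : badPairs G F Y h ε D φ' = badPairs G F Y h ε D φ := by
  have : ∀ b, cand G F Y D φ' b = cand G F Y D φ b := fun b =>
    cand_congr (fun _ _ => Iff.rfl) fun a ha _ => hφ a ha
  have hP : ∀ b b', PairOK G F Y h ε D φ' b b' ↔ PairOK G F Y h ε D φ b b' := fun b b' => by
    unfold PairOK
    rw [this, this]
  ext P
  simp only [badPairs, Finset.mem_filter, hP]

/-- Bernoulli's inequality and `Δ p ≤ 1`: exchanging `(1 - p^8) d` for `d` in the size of a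
candidate set costs at most a factor `2`. -/
lemma SmallParam.half_le_pow {p d : ℝ} {Δ : ℕ} (hp : SmallParam p d Δ) {j : ℕ} (hj : j ≤ Δ) :
    (1 / 2 : ℝ) ≤ (1 - p ^ 8) ^ j := by
  obtain ⟨p0, p16, hΔ, -, -, -, -⟩ := hp
  have hpow : ∀ n, p ^ n ≤ 1 := fun n => pow_le_one₀ p0.le (by linarith)
  have h8 := one_add_mul_le_pow (a := -p ^ 8) (by linarith [hpow 8]) j
  have h9 : (j : ℝ) * p ^ 8 ≤ 1 / 2 := by
    calc (j : ℝ) * p ^ 8 ≤ Δ * p ^ 8 := by gcongr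
      _ = (Δ * p) * (p * p ^ 6) := by ring
      _ ≤ 1 * (1 / 16 * 1) := by gcongr; exact hpow 6
      _ ≤ _ := by norm_num
  have : (1 - p ^ 8) = 1 + -p ^ 8 := by ring
  rw [this]
  linarith

/-- Extending a good state to a set `E` of new vertices with prescribed target sets. -/
lemma extend_state {X Y : Finset V} {p d t : ℝ} {Δ : ℕ} (hp : SmallParam p d Δ)
    (h : RegPair G X Y (p ^ 25) (p ^ 8) d) (hF : DegLE F Δ) (hcard : Fintype.card α = X.card)
    (ht : 0 < t) (Z : α → Finset V) (E : Finset α) (hZ : ∀ a ∈ E, Z a ⊆ X)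
    (D : Finset α) (φ : α → V) (hI : CandLarge G F Y 1 ((1 - p ^ 8) * d) D φ)
    (hd : Disjoint D E) (hinj : Set.InjOn φ D)
    (hroom : ∀ a ∈ E, (D.card : ℝ) + E.card + p ^ 24 * X.card + t ≤ (Z a).card) :
    ∃ φ' : α → V, (∀ a ∉ E, φ' a = φ a) ∧ Set.InjOn φ' (D ∪ E : Finset α) ∧
      (∀ a ∈ E, φ' a ∈ Z a) ∧ CandLarge G F Y 1 ((1 - p ^ 8) * d) (D ∪ E) φ' ∧
      ((badPairs G F Y ((1 + p ^ 8) * d) (p ^ 25) (D ∪ E) φ').card : ℝ) ≤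
        (badPairs G F Y ((1 + p ^ 8) * d) (p ^ 25) D φ).card +
          E.card * (2 * p ^ 24 * (X.card : ℝ) ^ 2 / t) := by
  have hp' := hp
  obtain ⟨p0, p16, hΔ, hd0, hd1, -, hpd⟩ := hp'
  have hp1 : p ≤ 1 := by linarith
  have hpow : ∀ n, p ^ n ≤ 1 := fun n => pow_le_one₀ p0.le hp1
  have hq0 : 0 ≤ (1 - p ^ 8) * d := mul_nonneg (by linarith [hpow 8]) hd0.le
  have hq1 : (1 - p ^ 8) * d ≤ 1 := by
    have : 0 ≤ p ^ 8 := by positivity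
    nlinarith
  have hΔp : Δ * (p ^ 25 * X.card) ≤ p ^ 24 * X.card := by
    calc Δ * (p ^ 25 * X.card) = (Δ * p) * (p ^ 24 * X.card) := by ring
      _ ≤ 1 * (p ^ 24 * X.card) := by gcongr
      _ = _ := one_mul _
  -- Even after `Δ` reductions a candidate set exceeds a proportion `p^25` of `Y`, so regularity
  -- applies at every step.
  have hcq : p ^ 25 ≤ 1 * ((1 - p ^ 8) * d) ^ Δ := by
    rw [one_mul, mul_pow]
    have h3 := hp.half_le_pow le_rfl
    have h4 : p ^ 25 ≤ p := by
      calc p ^ 25 = p ^ 24 * p := by ring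
        _ ≤ 1 * p := by gcongr; exact hpow 24
        _ = p := one_mul _
    calc p ^ 25 ≤ 1 / 2 * d ^ Δ := by linarith
      _ ≤ _ := by gcongr
  refine greedy_extend (CandLarge G F Y 1 ((1 - p ^ 8) * d))
    (fun D φ => ((badPairs G F Y ((1 + p ^ 8) * d) (p ^ 25) D φ).card : ℝ)) X (p ^ 24 * X.card)
    (2 * p ^ 24 * (X.card : ℝ) ^ 2) t ht ?_ ?_ Z E hZ D φ hI hd hinj hroom
  · intro D φ a ha hI B hB hB'
    exact (candLarge_step h hF (by positivity) hq0 hq1 zero_le_one hcq ha hI hB hB').trans hΔp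
  · intro D φ a ha _ B hB
    refine (badPairs_step h hF (by positivity) (by positivity) ha hB).trans ?_
    rw [hcard]
    calc 2 * (Δ : ℝ) * X.card * (p ^ 25 * X.card) = 2 * X.card * (Δ * (p ^ 25 * X.card)) := by ring
      _ ≤ 2 * X.card * (p ^ 24 * X.card) := by gcongr
      _ = _ := by ring

open scoped Classical in
/-- Every vertex `x ∈ X` splits few candidate sets badly. -/
lemma few_incompatible {X Y : Finset V} {p d : ℝ} {Δ : ℕ} (hp : SmallParam p d Δ)
    (h : RegPair G X Y (p ^ 25) (p ^ 8) d) (hF : DegLE F Δ) (hY : Y.Nonempty)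
    {D : Finset α} {φ : α → V} (hI : CandLarge G F Y 1 ((1 - p ^ 8) * d) D φ)
    (hk : 1 ≤ p ^ 17 * Fintype.card α)
    (hbad : ((badPairs G F Y ((1 + p ^ 8) * d) (p ^ 25) D φ).card : ℝ)
      ≤ p ^ 18 / 4 * (Fintype.card α : ℝ) ^ 2) {x : V} (hx : x ∈ X) :
    ((Finset.univ.filter (fun b => ((nbh G (cand G F Y D φ b) x).card : ℝ) <
      d ^ ((nbh F D b).card + 1) * Y.card / 8)).card : ℝ) < p ^ 5 * Fintype.card α := by
  set S := Finset.univ.filter (fun b => ((nbh G (cand G F Y D φ b) x).card : ℝ) <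
      d ^ ((nbh F D b).card + 1) * Y.card / 8) with hS
  by_contra hcon
  push Not at hcon
  have hlight := few_light hp hF hI hk hbad S hcon
  obtain ⟨p0, p16, hΔ, hd0, hd1, hpd', hpd⟩ := hp
  set T := Y.filter (fun w => (∑ b ∈ S, if w ∈ cand G F Y D φ b then
      1 / d ^ (nbh F D b).card else 0) ≤ S.card / 2) with hT
  have hk0 : (0 : ℝ) < Fintype.card α := by
    by_contra hcon
    have : p ^ 17 * (Fintype.card α : ℝ) ≤ 0 :=
      mul_nonpos_of_nonneg_of_nonpos (by positivity) (not_lt.1 hcon)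
    linarith
  have hS0 : (0 : ℝ) < S.card := lt_of_lt_of_le (by positivity) hcon
  have hY0 : (0 : ℝ) < Y.card := by exact_mod_cast hY.card_pos
  have hp1 : p ≤ 1 := by linarith
  set Dx := nbh G Y x with hDx
  -- The weight on the neighbourhood `Dx` is counted twice. Each `b ∈ S` contributes at most `d |Y|
  -- / 8` by definition of `S`, whereas all but `4 p^6 |Y|` vertices of `Dx` carry more than `|S| /
  -- 2`. With `|Dx| ≥ (3/4) d |Y|` the two are incompatible.
  have hup : ∑ w ∈ Dx, (∑ b ∈ S, if w ∈ cand G F Y D φ b then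
      1 / d ^ (nbh F D b).card else 0) ≤ S.card * (d * Y.card / 8) := by
    rw [Finset.sum_comm, ← nsmul_eq_mul]
    refine Finset.sum_le_card_nsmul _ _ _ fun b hb => ?_
    have hb' := (Finset.mem_filter.1 hb).2
    rw [← Finset.sum_filter, Finset.sum_const, nsmul_eq_mul]
    have : Dx.filter (fun w => w ∈ cand G F Y D φ b) = nbh G (cand G F Y D φ b) x := by
      ext w
      simp only [hDx, Finset.mem_filter, mem_nbh, mem_cand]
      tauto
    rw [this, mul_one_div, div_le_iff₀ (by positivity)]
    refine hb'.le.trans (le_of_eq ?_)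
    ring
  have hDT : (Dx.card : ℝ) - T.card ≤ (Dx \ T).card := by
    have := Finset.le_card_sdiff T Dx
    have h2 : Dx.card ≤ (Dx \ T).card + T.card := by omega
    have h3 : (Dx.card : ℝ) ≤ (Dx \ T).card + T.card := by exact_mod_cast h2
    linarith
  have hlow : (Dx \ T).card * ((S.card : ℝ) / 2) ≤ ∑ w ∈ Dx, (∑ b ∈ S, if w ∈ cand G F Y D φ b then
      1 / d ^ (nbh F D b).card else 0) := by
    have hnn : ∀ w, 0 ≤ ∑ b ∈ S, if w ∈ cand G F Y D φ b then
        1 / d ^ (nbh F D b).card else 0 := fun w => Finset.sum_nonneg fun b _ => by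
      split_ifs <;> positivity
    refine le_trans ?_ (Finset.sum_le_sum_of_subset_of_nonneg (s := Dx \ T)
      Finset.sdiff_subset fun w _ _ => hnn w)
    rw [← nsmul_eq_mul]
    refine Finset.card_nsmul_le_sum _ _ _ fun w hw => ?_
    rw [Finset.mem_sdiff, hT, Finset.mem_filter, not_and, not_le] at hw
    exact (hw.2 (nbh_subset _ _ hw.1)).le
  have hdeg := h.degX x hx
  have hcontr : (Dx.card : ℝ) - 4 * p ^ 6 * Y.card ≤ d * Y.card / 4 := by
    have h1 : ((Dx.card : ℝ) - T.card) * (S.card / 2) ≤ S.card * (d * Y.card / 8) :=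
      (mul_le_mul_of_nonneg_right hDT (by positivity)).trans (hlow.trans hup)
    have h2 : ((Dx.card : ℝ) - T.card) ≤ d * Y.card / 4 := by
      have : ((Dx.card : ℝ) - T.card) * (S.card / 2) ≤ (d * Y.card / 4) * (S.card / 2) :=
        h1.trans (le_of_eq (by ring))
      exact le_of_mul_le_mul_right this (by positivity)
    linarith
  have h8 : p ^ 8 ≤ 1 / 4 := by
    calc p ^ 8 = p ^ 7 * p := by ring
      _ ≤ 1 * (1 / 16) := by gcongr; exact pow_le_one₀ p0.le hp1
      _ ≤ _ := by norm_num
  have h6 : 4 * p ^ 6 ≤ d / 4 := by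
    have : p ^ 6 ≤ p := by
      calc p ^ 6 = p ^ 5 * p := by ring
        _ ≤ 1 * p := by gcongr; exact pow_le_one₀ p0.le hp1
        _ = p := one_mul _
    linarith
  have h9 : 3 / 4 * d * Y.card ≤ Dx.card := by
    refine le_trans ?_ hdeg
    gcongr
    linarith
  have h10 : 4 * p ^ 6 * Y.card ≤ d / 4 * Y.card := by gcongr
  have h11 : 0 < d * Y.card := by positivity
  linarith

set_option maxHeartbeats 1000000 in
/-- A good state avoiding a sparse buffer `A0` extends to a bijection onto `X` with large candidate
sets. -/
lemma buffer_lemma {X Y : Finset V} {p d : ℝ} {Δ : ℕ} (hp : SmallParam p d Δ)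
    (h : RegPair G X Y (p ^ 25) (p ^ 8) d) (hF : DegLE F Δ) (hcard : Fintype.card α = X.card)
    (hY : Y.Nonempty) (hk : 1 ≤ p ^ 17 * Fintype.card α)
    (A0 : Finset α) (hA0l : p ^ 4 / 2 * Fintype.card α ≤ A0.card)
    (hA0 : ∀ a ∈ A0, ∀ a' ∈ A0, a ≠ a' → ∀ b, F.Adj a b → ¬ F.Adj a' b)
    (D : Finset α) (φ : α → V) (hI : CandLarge G F Y 1 ((1 - p ^ 8) * d) D φ)
    (hbad : ((badPairs G F Y ((1 + p ^ 8) * d) (p ^ 25) D φ).card : ℝ)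
      ≤ p ^ 18 / 8 * (Fintype.card α : ℝ) ^ 2)
    (hd : Disjoint D A0) (hinj : Set.InjOn φ D) (hX : ∀ a ∈ D, φ a ∈ X) :
    ∃ φ' : α → V, (∀ a ∈ D, φ' a = φ a) ∧ Function.Injective φ' ∧ (∀ a, φ' a ∈ X) ∧
      (∀ b, p * Y.card ≤ (cand G F Y Finset.univ φ' b).card) ∧
      CandLarge G F Y 1 ((1 - p ^ 8) * d) (Finset.univ \ A0) φ' ∧
      ((badPairs G F Y ((1 + p ^ 8) * d) (p ^ 25) (Finset.univ \ A0) φ').card : ℝ)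
        ≤ p ^ 18 / 4 * (Fintype.card α : ℝ) ^ 2 := by
  classical
  have hp' := hp
  obtain ⟨p0, p16, hΔ, hd0, hd1, hpd', hpd⟩ := hp'
  obtain ⟨k, hkdef⟩ : ∃ k : ℝ, (Fintype.card α : ℝ) = k := ⟨_, rfl⟩
  have hkX : (X.card : ℝ) = k := by rw [← hkdef, hcard]
  have hk' := hk
  rw [hkdef] at hk hbad hA0l ⊢
  have hk0 : 0 < k := by
    by_contra hcon
    have : p ^ 17 * k ≤ 0 := mul_nonpos_of_nonneg_of_nonpos (by positivity) (not_lt.1 hcon)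
    linarith
  have hp1 : p ≤ 1 := by linarith
  have hpow : ∀ n, p ^ n ≤ 1 := fun n => pow_le_one₀ p0.le hp1
  have hA0pos : (0 : ℝ) < A0.card := lt_of_lt_of_le (by positivity) hA0l
  set E := Finset.univ \ (D ∪ A0) with hE
  have hDE : D ∪ E = Finset.univ \ A0 := by
    ext a
    simp only [hE, Finset.mem_union, Finset.mem_sdiff, Finset.mem_univ, true_and, not_or]
    constructor
    · rintro (h1 | h1)
      exacts [Finset.disjoint_left.1 hd h1, h1.2]
    · intro h1
      by_cases h2 : a ∈ D
      exacts [.inl h2, .inr ⟨h2, h1⟩]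
  have hEcard : (D.card : ℝ) + E.card = k - A0.card := by
    have h1 : D.card + E.card = (D ∪ E).card := by
      rw [Finset.card_union_of_disjoint]
      rw [Finset.disjoint_left]
      intro a ha ha'
      simp [hE, ha] at ha'
    have h2 : (D ∪ E).card + A0.card = Fintype.card α := by
      rw [hDE, Finset.card_sdiff_add_card_eq_card (Finset.subset_univ _), Finset.card_univ]
    have h3 : (D.card : ℝ) + E.card + A0.card = k := by rw [← hkdef]; exact_mod_cast h1 ▸ h2
    linarith
  have hm : p ^ 24 * k ≤ A0.card / 4 := by
    have : p ^ 24 * k = p ^ 20 * (p ^ 4 * k) := by ring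
    have h20 : p ^ 20 ≤ 1 / 8 := by
      calc p ^ 20 = p ^ 19 * p := by ring
        _ ≤ 1 * (1 / 16) := by gcongr; exact hpow 19
        _ ≤ _ := by norm_num
    have h4 : 0 ≤ p ^ 4 * k := by positivity
    nlinarith
  -- While the vertices outside `A0` are embedded, at least `|A0|` vertices of `X` are kept in
  -- reserve. So `|A0| / 2` admissible choices remain at each step and the number of bad pairs stays
  -- small.
  obtain ⟨φ1, h1, h2, h3, h4, h5⟩ := extend_state hp h hF hcard (t := (A0.card : ℝ) / 2)
    (by positivity) (fun _ => X) E (fun _ _ => subset_rfl) D φ hI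
    (by
      rw [Finset.disjoint_left]
      intro a ha ha'
      simp [hE, ha] at ha') hinj
    (by
      intro a _
      rw [hkX]
      linarith)
  rw [hDE] at h2 h4 h5
  have hφ1D : ∀ a ∈ D, φ1 a = φ a := fun a ha => h1 a (by simp [hE, ha])
  have hφ1X : ∀ a ∉ A0, φ1 a ∈ X := by
    intro a ha
    by_cases haD : a ∈ D
    · rw [hφ1D a haD]; exact hX a haD
    · exact h3 a (by simp [hE, haD, ha])
  have hbad1 : ((badPairs G F Y ((1 + p ^ 8) * d) (p ^ 25) (Finset.univ \ A0) φ1).card : ℝ)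
        ≤ p ^ 18 / 4 * k ^ 2 := by
    refine h5.trans ?_
    have h6 : (E.card : ℝ) ≤ k := by
      rw [← hkdef]; exact_mod_cast Finset.card_le_univ E
    have h7 : 2 * p ^ 24 * (X.card : ℝ) ^ 2 / (A0.card / 2) ≤ 8 * p ^ 20 * k := by
      rw [hkX, div_le_iff₀ (by positivity)]
      calc 2 * p ^ 24 * k ^ 2 = 8 * p ^ 20 * k * ((p ^ 4 / 2 * k) / 2) := by ring
        _ ≤ _ := by gcongr
    have h8 : (E.card : ℝ) * (2 * p ^ 24 * (X.card : ℝ) ^ 2 / (A0.card / 2)) ≤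
        p ^ 18 / 8 * k ^ 2 := by
      calc _ ≤ k * (8 * p ^ 20 * k) := by gcongr
        _ = (64 * p ^ 2) * (p ^ 18 / 8 * k ^ 2) := by ring
        _ ≤ 1 * (p ^ 18 / 8 * k ^ 2) := by
          gcongr
          nlinarith
        _ = _ := one_mul _
    linarith
  -- the remaining vertices of `X`
  set R := X \ (Finset.univ \ A0).image φ1 with hR
  have hRcard : R.card = A0.card := by
    have h6 : ((Finset.univ \ A0).image φ1) ⊆ X := by
      intro x hx
      obtain ⟨a, ha, rfl⟩ := Finset.mem_image.1 hx
      exact hφ1X a (Finset.mem_sdiff.1 ha).2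
    rw [hR, Finset.card_sdiff_of_subset h6, Finset.card_image_of_injOn h2,
      Finset.card_sdiff_of_subset (Finset.subset_univ _), Finset.card_univ, hcard]
    have : A0.card ≤ X.card := hcard ▸ Finset.card_le_univ A0
    omega
  set C := cand G F Y (Finset.univ \ A0) φ1 with hC
  set j : α → ℕ := fun b => (nbh F (Finset.univ \ A0) b).card with hj
  -- The admissible images of a buffer vertex `a`: those keeping a fixed part of the expected
  -- candidates of every neighbour of `a`.
  set t : α → Finset V := fun a => R.filter (fun x => ∀ b, F.Adj a b →
    d ^ (j b + 1) * Y.card / 8 ≤ ((nbh G (C b) x).card : ℝ)) with ht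
  have hrow : ∀ a, ((R \ t a).card : ℝ) ≤ p ^ 24 * k := by
    intro a
    have hsub : R \ t a ⊆ (nbh F Finset.univ a).biUnion (fun b =>
        X.filter (fun x => ((nbh G (C b) x).card : ℝ) < (1 - p ^ 8) * d * (C b).card)) := by
      intro x hx
      simp only [ht, Finset.mem_sdiff, Finset.mem_filter, not_and, not_forall, not_le] at hx
      obtain ⟨hxR, hx2⟩ := hx
      obtain ⟨b, hab, hb⟩ := hx2 hxR
      simp only [Finset.mem_biUnion, mem_nbh, Finset.mem_univ, true_and, Finset.mem_filter]
      refine ⟨b, hab, (Finset.mem_sdiff.1 hxR).1, hb.trans_le ?_⟩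
      have h6 : (1 - p ^ 8) ^ (j b) * d ^ (j b) * Y.card ≤ (C b).card := by
        have := h4 b
        rwa [one_mul, mul_pow] at this
      have h7 : (1 / 2 : ℝ) ≤ (1 - p ^ 8) ^ (j b) := hp.half_le_pow (hF.card_nbh_le _ _)
      have h10 : (1 / 2 : ℝ) ≤ 1 - p ^ 8 := by
        have : p ^ 8 = p * p ^ 7 := by ring
        nlinarith [hpow 7, pow_pos p0 7]
      calc d ^ (j b + 1) * Y.card / 8 ≤ d ^ (j b + 1) * Y.card / 4 := by
            have : 0 ≤ d ^ (j b + 1) * Y.card := by positivity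
            linarith
        _ = 1 / 2 * d * (1 / 2 * d ^ (j b) * Y.card) := by ring
        _ ≤ (1 - p ^ 8) * d * ((1 - p ^ 8) ^ (j b) * d ^ (j b) * Y.card) := by gcongr
        _ ≤ _ := by gcongr
    have hcq : ∀ b, p ^ 25 * (Y.card : ℝ) ≤ (C b).card := by
      intro b
      have h6 := h4 b
      refine le_trans ?_ h6
      rw [one_mul, mul_pow]
      gcongr
      have h7 : (1 / 2 : ℝ) ≤ (1 - p ^ 8) ^ (j b) := hp.half_le_pow (hF.card_nbh_le _ _)
      have h8 : 16 * p ≤ d ^ (j b) :=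
        hpd.trans (pow_le_pow_of_le_one hd0.le hd1 (hF.card_nbh_le _ _))
      have h9 : p ^ 25 ≤ p := by
        calc p ^ 25 = p ^ 24 * p := by ring
          _ ≤ 1 * p := by gcongr; exact hpow 24
          _ = p := one_mul _
      calc p ^ 25 ≤ 1 / 2 * (16 * p) := by linarith
        _ ≤ _ := by gcongr
    calc ((R \ t a).card : ℝ) ≤ _ := Nat.cast_le.2 (Finset.card_le_card hsub)
      _ ≤ ∑ b ∈ nbh F Finset.univ a, ((X.filter (fun x => ((nbh G (C b) x).card : ℝ) <
          (1 - p ^ 8) * d * (C b).card)).card : ℝ) := by exact_mod_cast Finset.card_biUnion_le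
      _ ≤ ∑ _b ∈ nbh F Finset.univ a, p ^ 25 * (X.card : ℝ) := Finset.sum_le_sum fun b _ =>
          h.few_low (by positivity) (cand_subset _ _ _ _) (hcq b)
      _ = (nbh F Finset.univ a).card * (p ^ 25 * X.card) := by rw [Finset.sum_const, nsmul_eq_mul]
      _ ≤ Δ * (p ^ 25 * X.card) := by
          gcongr
          exact hF.card_nbh_le _ _
      _ = (Δ * p) * (p ^ 24 * k) := by rw [hkX]; ring
      _ ≤ 1 * (p ^ 24 * k) := by gcongr
      _ = _ := one_mul _
  have hcol : ∀ x ∈ R, ((A0.filter (fun a => x ∉ t a)).card : ℝ) < p ^ 5 * k := by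
    intro x hx
    rw [← hkdef]
    refine lt_of_le_of_lt ?_ (few_incompatible hp h hF hY h4 hk' (hkdef ▸ hbad1)
      (Finset.mem_sdiff.1 hx).1)
    -- Each buffer vertex that refuses `x` has a neighbour whose candidates are split badly by `x`.
    -- Distinct buffer vertices share no neighbour, so these witnesses are distinct and
    -- `few_incompatible` bounds their number.
    have hch : ∀ a ∈ A0.filter (fun a => x ∉ t a), ∃ b, F.Adj a b ∧
        ((nbh G (C b) x).card : ℝ) < d ^ (j b + 1) * Y.card / 8 := by
      intro a ha
      have h6 := (Finset.mem_filter.1 ha).2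
      simp only [ht, Finset.mem_filter, not_and, not_forall, not_le] at h6
      obtain ⟨b, hab, hb⟩ := h6 hx
      exact ⟨b, hab, hb⟩
    choose! bb hbb1 hbb2 using hch
    refine Nat.cast_le.2 (Finset.card_le_card_of_injOn bb ?_ ?_)
    · intro a ha
      simp only [Finset.coe_filter, Finset.mem_univ, true_and, Set.mem_ofPred_eq]
      exact hbb2 a ha
    · intro a ha a' ha' heq
      by_contra hne
      have h6 := hbb1 a ha
      have h7 := hbb1 a' ha'
      rw [← heq] at h7
      exact hA0 a (Finset.mem_filter.1 ha).1 a' (Finset.mem_filter.1 ha').1 hne _ h6 h7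
  have : Nonempty V := ⟨hY.choose⟩
  obtain ⟨f, hfinj, hft⟩ := exists_injOn_of_hall A0 t (by
    intro S hS
    rcases S.eq_empty_or_nonempty with rfl | ⟨a, ha⟩
    · simp
    have hta : t a ⊆ S.biUnion t := fun x hx => Finset.mem_biUnion.2 ⟨a, ha, hx⟩
    have htaR : ∀ a, t a ⊆ R := fun a => Finset.filter_subset _ _
    have hta2 : (R.card : ℝ) - p ^ 24 * k ≤ (t a).card := by
      have h6 := hrow a
      rw [Finset.card_sdiff_of_subset (htaR a), Nat.cast_sub (Finset.card_le_card (htaR a))] at h6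
      linarith
    -- Hall's condition: the images admissible for one `a` suffice for up to half of the buffer. A
    -- larger `S` reaches all of `R`, since each `x` is refused by fewer than `p^5 k ≤ |A0| / 2`
    -- buffer vertices.
    by_cases hcase : (S.card : ℝ) ≤ A0.card / 2
    · have : (S.card : ℝ) ≤ (S.biUnion t).card := by
        calc (S.card : ℝ) ≤ A0.card / 2 := hcase
          _ ≤ R.card - p ^ 24 * k := by rw [hRcard]; linarith
          _ ≤ (t a).card := hta2
          _ ≤ _ := by exact_mod_cast Finset.card_le_card hta
      exact_mod_cast this
    · push Not at hcase
      have hsub : R ⊆ S.biUnion t := by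
        intro x hx
        by_contra hcon
        have h6 : S ⊆ A0.filter (fun a => x ∉ t a) := by
          intro b hb
          refine Finset.mem_filter.2 ⟨hS hb, fun hxb => hcon (Finset.mem_biUnion.2 ⟨b, hb, hxb⟩)⟩
        have h7 : (S.card : ℝ) < p ^ 5 * k := lt_of_le_of_lt
          (Nat.cast_le.2 (Finset.card_le_card h6)) (hcol x hx)
        have h8 : p ^ 5 * k ≤ A0.card / 2 := by
          have : p ^ 5 * k = p * (p ^ 4 * k) := by ring
          have : 0 ≤ p ^ 4 * k := by positivity
          nlinarith
        linarith
      calc S.card ≤ A0.card := Finset.card_le_card hS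
        _ = R.card := hRcard.symm
        _ ≤ _ := Finset.card_le_card hsub)
  set φ2 : α → V := fun a => if a ∈ A0 then f a else φ1 a with hφ2
  have hφ2in : ∀ a ∈ A0, φ2 a = f a := fun a ha => by simp [hφ2, ha]
  have hφ2out : ∀ a ∉ A0, φ2 a = φ1 a := fun a ha => by simp [hφ2, ha]
  have hfR : ∀ a ∈ A0, f a ∈ R := fun a ha => (Finset.mem_filter.1 (hft a ha)).1
  have hagree : ∀ a ∈ Finset.univ \ A0, φ2 a = φ1 a := fun a ha =>
    hφ2out a (Finset.mem_sdiff.1 ha).2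
  have hcross : ∀ a ∈ A0, ∀ a' ∉ A0, f a ≠ φ1 a' := by
    intro a ha a' ha' heq
    have := (Finset.mem_sdiff.1 (hfR a ha)).2
    exact this (heq ▸ Finset.mem_image_of_mem _ (by simp [ha']))
  refine ⟨φ2, ?_, ?_, ?_, ?_, h4.congr hagree, ?_⟩
  · intro a ha
    rw [hφ2out a (Finset.disjoint_left.1 hd ha), hφ1D a ha]
  · intro a a' heq
    by_cases ha : a ∈ A0 <;> by_cases ha' : a' ∈ A0
    · rw [hφ2in a ha, hφ2in a' ha'] at heq
      exact hfinj ha ha' heq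
    · rw [hφ2in a ha, hφ2out a' ha'] at heq
      exact absurd heq (hcross a ha a' ha')
    · rw [hφ2out a ha, hφ2in a' ha'] at heq
      exact absurd heq.symm (hcross a' ha' a ha)
    · rw [hφ2out a ha, hφ2out a' ha'] at heq
      exact h2 (by simp [ha]) (by simp [ha']) heq
  · intro a
    by_cases ha : a ∈ A0
    · rw [hφ2in a ha]; exact (Finset.mem_sdiff.1 (hfR a ha)).1
    · rw [hφ2out a ha]; exact hφ1X a ha
  · intro b
    by_cases hb : ∃ a ∈ A0, F.Adj a b
    · obtain ⟨a, ha, hab⟩ := hb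
      -- By sparseness the buffer cuts the candidate set of `b` only once, and the admissibility of
      -- `f a` controls this cut.
      have huniq : ∀ a' ∈ A0, F.Adj a' b → a' = a := by
        intro a' ha' hab'
        by_contra hne
        exact hA0 a' ha' a ha hne b hab' hab
      have hcand : cand G F Y Finset.univ φ2 b = nbh G (C b) (f a) := by
        ext w
        simp only [mem_nbh, hC, mem_cand, Finset.mem_univ, true_implies, Finset.mem_sdiff, true_and]
        constructor
        · rintro ⟨hw, h6⟩
          refine ⟨⟨hw, fun a' ha' hab' => ?_⟩, ?_⟩
          · rw [← hφ2out a' ha']; exact h6 a' hab'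
          · rw [← hφ2in a ha]; exact h6 a hab
        · rintro ⟨⟨hw, h6⟩, h7⟩
          refine ⟨hw, fun a' hab' => ?_⟩
          by_cases ha' : a' ∈ A0
          · rw [huniq a' ha' hab', hφ2in a ha]; exact h7
          · rw [hφ2out a' ha']; exact h6 a' ha' hab'
      rw [hcand]
      refine le_trans ?_ ((Finset.mem_filter.1 (hft a ha)).2 b hab)
      have hjb : j b + 1 ≤ Δ := by
        have h6 : a ∉ nbh F (Finset.univ \ A0) b := by simp [ha]
        have h7 : insert a (nbh F (Finset.univ \ A0) b) ⊆ nbh F Finset.univ b := by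
          intro x hx
          rcases Finset.mem_insert.1 hx with rfl | hx
          · simp [hab.symm]
          · simp only [mem_nbh] at hx ⊢
            exact ⟨Finset.mem_univ _, hx.2⟩
        have h8 := Finset.card_le_card h7
        rw [Finset.card_insert_of_notMem h6] at h8
        exact h8.trans (hF.card_nbh_le _ _)
      have h9 : 16 * p ≤ d ^ (j b + 1) := hpd.trans (pow_le_pow_of_le_one hd0.le hd1 hjb)
      have h10 : 16 * p * Y.card ≤ d ^ (j b + 1) * Y.card :=
        mul_le_mul_of_nonneg_right h9 (Nat.cast_nonneg _)
      have h11 : 0 ≤ p * Y.card := mul_nonneg p0.le (Nat.cast_nonneg _)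
      linarith
    · push Not at hb
      have hcand : cand G F Y Finset.univ φ2 b = C b := by
        rw [hC]
        refine cand_congr (fun a hab => ?_) (fun a _ hab => ?_)
        · simp only [Finset.mem_univ, Finset.mem_sdiff, true_and, true_iff]
          exact fun ha => hb a ha hab
        · exact hφ2out a fun ha => hb a ha hab
      rw [hcand]
      refine le_trans ?_ (h4 b)
      rw [one_mul, mul_pow]
      gcongr
      have h7 : (1 / 2 : ℝ) ≤ (1 - p ^ 8) ^ (j b) := hp.half_le_pow (hF.card_nbh_le _ _)
      have h8 : 16 * p ≤ d ^ (j b) :=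
        hpd.trans (pow_le_pow_of_le_one hd0.le hd1 (hF.card_nbh_le _ _))
      calc p ≤ 1 / 2 * (16 * p) := by linarith
        _ ≤ _ := by gcongr
  · rw [badPairs_congr hagree]
    exact hbad1

end Buffer


/-! ### One-sided and two-sided exact embeddings. -/

section Spanning

set_option linter.unusedSectionVars false

variable {V α : Type*} [DecidableEq V] [DecidableEq α] [Fintype α] {G : SimpleGraph V}
  {F : SimpleGraph α}

/-- Sharing a neighbour is a relation of degree at most `Δ²`. Sets without two such vertices serve
as buffers and as places for prescribed images, since every vertex has at most one neighbour in
them. -/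
lemma exists_sparse {Δ : ℕ} (hF : DegLE F Δ) (Pool : Finset α) (n : ℕ)
    (hn : n * (Δ * Δ + 1) ≤ Pool.card) :
    ∃ I ⊆ Pool, I.card = n ∧ ∀ a ∈ I, ∀ a' ∈ I, a ≠ a' → ∀ b, F.Adj a b → ¬ F.Adj a' b := by
  classical
  obtain ⟨I, hI, hc, h⟩ := exists_independent (fun b b' => ∃ a, F.Adj a b ∧ F.Adj a b')
    (fun b b' ⟨a, h1, h2⟩ => ⟨a, h2, h1⟩) (Δ * Δ) n Pool
    (fun b _ => hF.card_common_le Pool b) hn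
  exact ⟨I, hI, hc, fun a ha a' ha' hne b h1 h2 => h a ha a' ha' hne ⟨b, h1.symm, h2.symm⟩⟩

lemma candLarge_empty (Y : Finset V) (q : ℝ) (φ : α → V) : CandLarge G F Y 1 q ∅ φ := by
  intro b
  have h1 : cand G F Y ∅ φ b = Y := by
    ext w; simp [mem_cand]
  have h2 : nbh F ∅ b = ∅ := by
    ext w; simp
  rw [h1, h2]
  simp

lemma badPairs_empty (Y : Finset V) (h ε : ℝ) (φ : α → V) : badPairs G F Y h ε ∅ φ = ∅ := by
  have h1 : ∀ b, cand G F Y ∅ φ b = Y := fun b => by ext w; simp [mem_cand]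
  have h2 : ∀ b, nbh F ∅ b = ∅ := fun b => by ext w; simp
  rw [Finset.eq_empty_iff_forall_notMem]
  intro P hP
  unfold badPairs at hP
  classical
  refine (Finset.mem_filter.1 hP).2.2 ?_
  unfold PairOK
  rw [h1, h1, h2, h2]
  rw [Finset.inter_self, Finset.card_empty, pow_zero]
  have : (1 : ℝ) ≤ max 1 ε := le_max_left _ _
  calc (Y.card : ℝ) = 1 * Y.card := by ring
    _ ≤ _ := by gcongr

/-- Existence of a sparse set of about `p ^ 4 * k` vertices. -/
lemma exists_buffer {p d : ℝ} {Δ : ℕ} (hp : SmallParam p d Δ) (hF : DegLE F Δ)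
    (hk : 1 ≤ p ^ 17 * Fintype.card α) :
    ∃ A0 : Finset α, p ^ 4 / 2 * Fintype.card α ≤ A0.card ∧
      (A0.card : ℝ) ≤ p ^ 4 * Fintype.card α ∧
      ∀ a ∈ A0, ∀ a' ∈ A0, a ≠ a' → ∀ b, F.Adj a b → ¬ F.Adj a' b := by
  obtain ⟨p0, p16, hΔ, -, -, -, -⟩ := hp
  obtain ⟨k, hkdef⟩ : ∃ k : ℝ, (Fintype.card α : ℝ) = k := ⟨_, rfl⟩
  rw [hkdef] at hk ⊢
  have hk0 : 0 ≤ k := by rw [← hkdef]; positivity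
  have hbig : 2 ≤ p ^ 4 * k := by
    have h1 : p ^ 13 ≤ 1 / 16 := by
      calc p ^ 13 = p ^ 12 * p := by ring
        _ ≤ 1 * (1 / 16) := by gcongr; exact pow_le_one₀ p0.le (by linarith)
        _ = _ := one_mul _
    have h2 : p ^ 17 * k = p ^ 13 * (p ^ 4 * k) := by ring
    have h3 : 0 ≤ p ^ 4 * k := by positivity
    nlinarith
  have hfl1 := Nat.floor_le (show 0 ≤ p ^ 4 * k by positivity)
  have hfl2 := Nat.lt_floor_add_one (p ^ 4 * k)
  obtain ⟨A0, -, hc, h⟩ := exists_sparse hF Finset.univ ⌊p ^ 4 * k⌋₊ (by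
    rw [Finset.card_univ]
    have h1 : ((⌊p ^ 4 * k⌋₊ * (Δ * Δ + 1) : ℕ) : ℝ) ≤ Fintype.card α := by
      push_cast
      rw [hkdef]
      have h2 : p ^ 2 * (Δ * Δ : ℝ) ≤ 1 := by
        calc p ^ 2 * (Δ * Δ : ℝ) = (Δ * p) * (Δ * p) := by ring
          _ ≤ 1 * 1 := by gcongr
          _ = 1 := by ring
      have h4 : p ^ 2 ≤ 1 / 2 := by nlinarith
      calc (⌊p ^ 4 * k⌋₊ : ℝ) * (Δ * Δ + 1) ≤ (p ^ 4 * k) * (Δ * Δ + 1) := by gcongr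
        _ = p ^ 2 * (p ^ 2 * (Δ * Δ) + p ^ 2) * k := by ring
        _ ≤ 1 / 2 * (1 + 1 / 2) * k := by gcongr
        _ ≤ k := by linarith
    exact_mod_cast h1)
  rw [← hc] at hfl1 hfl2
  exact ⟨A0, by linarith, hfl1, h⟩

/-- In a regular pair with `Y` much larger than `X`, the double cover of `F` embeds with one side
covering `X` exactly. -/
lemma exact_one_sided {X Y : Finset V} {p d : ℝ} {Δ : ℕ} (hp : SmallParam p d Δ)
    (h : RegPair G X Y (p ^ 25) (p ^ 8) d) (hF : DegLE F Δ) (hcard : Fintype.card α = X.card)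
    (hk : 1 ≤ p ^ 17 * Fintype.card α) (hY : (Fintype.card α : ℝ) ≤ p * Y.card) :
    ∃ φ ψ : α → V, Function.Injective φ ∧ Function.Injective ψ ∧ (∀ a, φ a ∈ X) ∧
      (∀ b, ψ b ∈ Y) ∧ ∀ a b, F.Adj a b → G.Adj (φ a) (ψ b) := by
  have p0 := hp.pos
  have hYne : Y.Nonempty := by
    rw [Finset.nonempty_iff_ne_empty]
    rintro rfl
    simp only [Finset.card_empty, Nat.cast_zero, mul_zero] at hY
    have : p ^ 17 * (Fintype.card α : ℝ) ≤ 0 := mul_nonpos_of_nonneg_of_nonpos (by positivity) hY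
    linarith
  have : Nonempty V := ⟨hYne.choose⟩
  obtain ⟨A0, h1, -, h2⟩ := exists_buffer (F := F) hp hF hk
  obtain ⟨φ, -, hφ, hφX, hφc, -, -⟩ := buffer_lemma hp h hF hcard hYne hk A0 h1 h2 ∅
    (fun _ => Classical.arbitrary V) (candLarge_empty _ _ _)
    (by rw [badPairs_empty, Finset.card_empty, Nat.cast_zero]; positivity) (by simp) (by simp)
    (by simp)
  obtain ⟨ψ, hψ, hψc⟩ := exists_injOn_of_hall Finset.univ (cand G F Y Finset.univ φ) (by
    intro S _
    rcases S.eq_empty_or_nonempty with rfl | ⟨b, hb⟩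
    · simp
    -- Hall's condition is trivial here: a single candidate set has at least `p |Y| ≥ |α|` elements.
    have h3 : S.card ≤ (cand G F Y Finset.univ φ b).card := by
      have : (S.card : ℝ) ≤ (cand G F Y Finset.univ φ b).card :=
        le_trans (Nat.cast_le.2 (Finset.card_le_univ S)) (hY.trans (hφc b))
      exact_mod_cast this
    exact h3.trans (Finset.card_le_card fun x hx => Finset.mem_biUnion.2 ⟨b, hb, hx⟩))
  refine ⟨φ, ψ, hφ, fun a b hab => hψ (by simp) (by simp) hab, hφX,
    fun b => (mem_cand.1 (hψc b (Finset.mem_univ _))).1, fun a b hab => ?_⟩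
  exact (mem_cand.1 (hψc b (Finset.mem_univ _))).2 a (Finset.mem_univ _) hab

/-- A Hall-type matching criterion: small sets see many candidates, large sets miss few vertices,
and every vertex has many candidates. -/
lemma exists_injOn_of_large_cand {Y T : Finset V} {B0 B1 : Finset α} {C : α → Finset V} {m l : ℝ}
    (hTY : T ⊆ Y) (hB : Disjoint B0 B1) (hB1 : B1.card = T.card)
    (hcard : Fintype.card α = Y.card) (hC : ∀ b, m ≤ (C b \ T).card) (hCY : ∀ b, C b ⊆ Y)
    (hmiss : ∀ S : Finset α, m < S.card →
      (((Y \ T) \ S.biUnion fun b => C b \ T).card : ℝ) ≤ l)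
    (hgood : ∀ w ∈ Y \ T, l < ((B0.filter fun b => w ∈ C b).card : ℝ)) [Nonempty V] :
    ∃ f : α → V, Set.InjOn f (Finset.univ \ B1 : Finset α) ∧
      ∀ b ∈ Finset.univ \ B1, f b ∈ C b \ T := by
  refine exists_injOn_of_hall _ _ fun S hS => ?_
  rcases S.eq_empty_or_nonempty with rfl | ⟨b, hb⟩
  · simp
  obtain ⟨N, hN⟩ : ∃ N, N = S.biUnion (fun b => C b \ T) := ⟨_, rfl⟩
  rw [← hN]
  have hNsub : N ⊆ Y \ T := by
    rw [hN]
    exact Finset.biUnion_subset.2 fun b _ => Finset.sdiff_subset_sdiff (hCY b) subset_rfl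
  by_cases hsmall : (S.card : ℝ) ≤ m
  · have h3 : ((C b \ T).card : ℝ) ≤ N.card := by
      rw [hN]
      exact Nat.cast_le.2 (Finset.card_le_card fun x hx => Finset.mem_biUnion.2 ⟨b, hb, hx⟩)
    exact_mod_cast hsmall.trans ((hC b).trans h3)
  push Not at hsmall
  -- If Hall's condition fails for a large `S`, fewer vertices remain outside `S` than are missed by
  -- `S`, hence fewer than `l`. But a missed `w` is a candidate of more than `l` vertices of `B0`,
  -- all of which lie outside `S`.
  by_contra hlt
  push Not at hlt
  have h1 := hmiss S hsmall
  rw [← hN] at h1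
  have h2 : ((Y \ T) \ N).card + N.card = (Y \ T).card :=
    Finset.card_sdiff_add_card_eq_card hNsub
  have h3 : (Y \ T).card + T.card = Y.card := Finset.card_sdiff_add_card_eq_card hTY
  have h4 : ((Finset.univ \ B1) \ S).card + S.card = (Finset.univ \ B1).card :=
    Finset.card_sdiff_add_card_eq_card hS
  have h5 : (Finset.univ \ B1).card + B1.card = (Finset.univ : Finset α).card :=
    Finset.card_sdiff_add_card_eq_card (Finset.subset_univ _)
  rw [Finset.card_univ] at h5
  have h6 : ((Finset.univ \ B1) \ S).card < ((Y \ T) \ N).card := by omega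
  obtain ⟨w, hw⟩ : ((Y \ T) \ N).Nonempty := Finset.card_pos.1 (by omega)
  rw [Finset.mem_sdiff] at hw
  have h7 := hgood w hw.1
  have h8 : (B0.filter (fun b => w ∈ C b)).card ≤ ((Finset.univ \ B1) \ S).card := by
    refine Finset.card_le_card fun b' hb' => ?_
    rw [Finset.mem_filter] at hb'
    refine Finset.mem_sdiff.2 ⟨Finset.mem_sdiff.2 ⟨Finset.mem_univ _,
      Finset.disjoint_left.1 hB hb'.1⟩, fun hbS => hw.2 ?_⟩
    rw [hN]
    exact Finset.mem_biUnion.2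
      ⟨b', hbS, Finset.mem_sdiff.2 ⟨hb'.2, (Finset.mem_sdiff.1 hw.1).2⟩⟩
  have h9 : ((B0.filter (fun b => w ∈ C b)).card : ℝ) ≤ ((Y \ T) \ N).card := by
    exact_mod_cast h8.trans h6.le
  linarith

set_option maxHeartbeats 4000000 in
/-- In a balanced regular pair the double cover of `F` embeds as a spanning subgraph. -/
lemma exact_two_sided {X Y : Finset V} {p d : ℝ} {Δ : ℕ} (hp : SmallParam p d Δ)
    (h : RegPair G X Y (p ^ 25) (p ^ 8) d) (hF : DegLE F Δ) (hcard : Fintype.card α = X.card)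
    (hk : 1 ≤ p ^ 17 * Fintype.card α) (hXY : X.card = Y.card) :
    ∃ φ ψ : α → V, Function.Injective φ ∧ Function.Injective ψ ∧ (∀ a, φ a ∈ X) ∧
      (∀ b, ψ b ∈ Y) ∧ ∀ a b, F.Adj a b → G.Adj (φ a) (ψ b) := by
  classical
  have hp' := hp
  obtain ⟨p0, p16, hΔ, hd0, hd1, hpd', hpd⟩ := hp'
  obtain ⟨k, hkdef⟩ : ∃ k : ℝ, (Fintype.card α : ℝ) = k := ⟨_, rfl⟩
  have hkX : (X.card : ℝ) = k := by rw [← hkdef, hcard]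
  have hkY : (Y.card : ℝ) = k := by rw [← hkX, hXY]
  have hk' := hk
  rw [hkdef] at hk
  have hk0 : 0 < k := by
    by_contra hcon
    have : p ^ 17 * k ≤ 0 := mul_nonpos_of_nonneg_of_nonpos (by positivity) (not_lt.1 hcon)
    linarith
  have hp1 : p ≤ 1 := by linarith
  have hpow : ∀ n, p ^ n ≤ 1 := fun n => pow_le_one₀ p0.le hp1
  have hstep : ∀ n : ℕ, p ^ (n + 1) * k ≤ 1 / 16 * (p ^ n * k) := by
    intro n
    calc p ^ (n + 1) * k = p * (p ^ n * k) := by ring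
      _ ≤ 1 / 16 * (p ^ n * k) := by gcongr
  have hpk : ∀ n : ℕ, 0 ≤ p ^ n * k := fun n => by positivity
  have hs0 := hstep 0
  have hs1 := hstep 1
  have hs2 := hstep 2
  have hs3 := hstep 3
  have hs4 := hstep 4
  have hs5 := hstep 5
  have h24 : p ^ 24 * k ≤ p ^ 5 * k := by
    gcongr ?_ * k
    exact pow_le_pow_of_le_one p0.le hp1 (by norm_num)
  simp only [pow_zero, one_mul, zero_add, pow_one] at hs0 hs1
  norm_num only at hs1 hs2 hs3 hs4 hs5
  have hYne : Y.Nonempty := by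
    rw [← Finset.card_pos]
    have : (0 : ℝ) < Y.card := by rw [hkY]; exact hk0
    exact_mod_cast this
  have hVne : Nonempty V := ⟨hYne.choose⟩
  obtain ⟨A0, hA0l, hA0u, hA0⟩ := exists_buffer (F := F) hp hF hk'
  rw [hkdef] at hA0l hA0u
  -- the neighbours of a set of size at most `x`
  have hnbr : ∀ (S : Finset α) (n : ℕ), (S.card : ℝ) ≤ p ^ (n + 1) * k →
      ((S.biUnion (nbh F Finset.univ)).card : ℝ) ≤ p ^ n * k := by
    intro S n hS
    calc ((S.biUnion (nbh F Finset.univ)).card : ℝ) ≤ S.card * Δ := by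
          exact_mod_cast hF.card_biUnion_nbh_le S
      _ ≤ (p ^ (n + 1) * k) * Δ := by gcongr
      _ = (Δ * p) * (p ^ n * k) := by ring
      _ ≤ 1 * (p ^ n * k) := by gcongr
      _ = _ := one_mul _
  have hNA0 := hnbr A0 3 hA0u
  -- the set `B0`
  obtain ⟨B0, hB0sub, hB0c⟩ := Finset.exists_subset_card_eq (s := Finset.univ \
      A0.biUnion (nbh F Finset.univ)) (n := A0.card) (by
    have h1 := Finset.le_card_sdiff (A0.biUnion (nbh F Finset.univ)) Finset.univ
    refine le_trans ?_ h1
    rw [Finset.card_univ]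
    have h2 : (A0.card : ℝ) + (A0.biUnion (nbh F Finset.univ)).card ≤ Fintype.card α := by
      rw [hkdef]; linarith
    have h3 : A0.card + (A0.biUnion (nbh F Finset.univ)).card ≤ Fintype.card α := by
      exact_mod_cast h2
    omega)
  have hB0u : (B0.card : ℝ) ≤ p ^ 4 * k := by rw [hB0c]; exact hA0u
  have hB0l : p ^ 4 / 2 * k ≤ B0.card := by rw [hB0c]; exact hA0l
  -- Embedding all neighbours of `B0` first fixes the candidate sets of `B0` for good. Vertices of
  -- `Y` in too few of them are then known early and can be treated separately.
  set D1 := B0.biUnion (nbh F Finset.univ) with hD1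
  have hD1c : (D1.card : ℝ) ≤ p ^ 3 * k := hnbr B0 3 hB0u
  have hD1A0 : Disjoint D1 A0 := by
    rw [Finset.disjoint_left]
    intro a ha haA
    simp only [hD1, Finset.mem_biUnion, mem_nbh, Finset.mem_univ, true_and] at ha
    obtain ⟨b, hb, hba⟩ := ha
    have := (Finset.mem_sdiff.1 (hB0sub hb)).2
    exact this (Finset.mem_biUnion.2 ⟨a, haA, by simp [hba.symm]⟩)
  obtain ⟨φ1, -, hinj1, hX1, hI1, hbad1⟩ := extend_state hp h hF hcard (t := k / 2)
    (by positivity) (fun _ => X) D1 (fun _ _ => subset_rfl) ∅ (fun _ => Classical.arbitrary V)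
    (candLarge_empty _ _ _) (by simp) (by simp) (by
      intro a _
      rw [hkX]
      simp only [Finset.card_empty, Nat.cast_zero]
      linarith)
  rw [Finset.empty_union] at hinj1 hI1 hbad1
  rw [badPairs_empty, Finset.card_empty, Nat.cast_zero, zero_add, hkX] at hbad1
  have hbad1' : ((badPairs G F Y ((1 + p ^ 8) * d) (p ^ 25) D1 φ1).card : ℝ) ≤
      p ^ 18 / 16 * k ^ 2 := by
    refine hbad1.trans ?_
    calc (D1.card : ℝ) * (2 * p ^ 24 * k ^ 2 / (k / 2)) ≤ (p ^ 3 * k) * (2 * p ^ 24 * k ^ 2 / (k / 2)) := by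
          gcongr
      _ = (64 * p ^ 9) * (p ^ 18 / 16 * k ^ 2) := by field_simp; ring
      _ ≤ 1 * (p ^ 18 / 16 * k ^ 2) := by
        gcongr
        have : p ^ 9 = p ^ 7 * p * p := by ring
        nlinarith [hpow 7, mul_pos p0 p0]
      _ = _ := one_mul _
  -- exceptional vertices of `Y`
  set T := Y.filter (fun w => (∑ b ∈ B0, if w ∈ cand G F Y D1 φ1 b then
      1 / d ^ (nbh F D1 b).card else 0) ≤ B0.card / 2) with hT
  have hTY : T ⊆ Y := Finset.filter_subset _ _
  have hTc : (T.card : ℝ) ≤ 4 * (p ^ 6 * k) := by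
    have := few_light hp hF hI1 hk' (by
      rw [hkdef]
      refine hbad1'.trans ?_
      have : 0 ≤ p ^ 18 * k ^ 2 := by positivity
      linarith) B0 (by rw [hkdef]; linarith)
    rw [hkY] at this
    linarith
  -- The exceptional vertices `T` receive their preimages `B1` by hand. Avoiding `B0` and the
  -- neighbours of `A0 ∪ D1` ensures that the neighbours of `B1` are not yet embedded and do not lie
  -- in the buffer.
  obtain ⟨B1, hB1sub, hB1c, hB1⟩ := exists_sparse hF (Finset.univ \
    (B0 ∪ (A0 ∪ D1).biUnion (nbh F Finset.univ))) T.card (by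
      have h1 := Finset.le_card_sdiff (B0 ∪ (A0 ∪ D1).biUnion (nbh F Finset.univ)) Finset.univ
      refine le_trans ?_ h1
      rw [Finset.card_univ]
      have hAD : ((A0 ∪ D1).card : ℝ) ≤ p ^ 2 * k := by
        have : ((A0 ∪ D1).card : ℝ) ≤ A0.card + D1.card := by
          exact_mod_cast Finset.card_union_le _ _
        linarith [hpk 2]
      have h2 := hnbr _ 1 hAD
      have h3 : ((B0 ∪ (A0 ∪ D1).biUnion (nbh F Finset.univ)).card : ℝ) ≤
          B0.card + ((A0 ∪ D1).biUnion (nbh F Finset.univ)).card := by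
        exact_mod_cast Finset.card_union_le _ _
      have h4 : (T.card : ℝ) * (Δ * Δ + 1) ≤ k / 2 := by
        have h5 : (Δ * Δ : ℝ) * p ^ 2 ≤ 1 := by
          calc (Δ * Δ : ℝ) * p ^ 2 = (Δ * p) * (Δ * p) := by ring
            _ ≤ 1 * 1 := by gcongr
            _ = 1 := by ring
        calc (T.card : ℝ) * (Δ * Δ + 1) ≤ 4 * (p ^ 6 * k) * (Δ * Δ + 1) := by gcongr
          _ = 4 * (((Δ * Δ : ℝ) * p ^ 2) * (p ^ 4 * k)) + 4 * (p ^ 6 * k) := by ring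
          _ ≤ 4 * (1 * (p ^ 4 * k)) + 4 * (p ^ 6 * k) := by gcongr
          _ ≤ k / 2 := by norm_num at hs1 hs2 hs3 hs4 hs5 ⊢; linarith
      have h6 : ((T.card * (Δ * Δ + 1) + (B0 ∪ (A0 ∪ D1).biUnion (nbh F Finset.univ)).card : ℕ) : ℝ)
          ≤ (Fintype.card α : ℕ) := by
        push_cast
        rw [hkdef]
        linarith [hpk 1, hpk 2, hpk 4, hpk 3]
      have h7 := Nat.cast_le.1 h6
      omega)
  have hB1B0 : Disjoint B1 B0 := by
    rw [Finset.disjoint_left]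
    intro b hb hb0
    exact (Finset.mem_sdiff.1 (hB1sub hb)).2 (Finset.mem_union_left _ hb0)
  have hB1N : ∀ b ∈ B1, ∀ a, F.Adj a b → a ∉ A0 ∧ a ∉ D1 := by
    intro b hb a hab
    have := (Finset.mem_sdiff.1 (hB1sub hb)).2
    constructor <;> intro ha <;> refine this (Finset.mem_union_right _ (Finset.mem_biUnion.2
      ⟨a, ?_, by simp [hab]⟩))
    exacts [Finset.mem_union_left _ ha, Finset.mem_union_right _ ha]
  obtain ⟨eT⟩ : Nonempty (B1 ≃ T) := ⟨Finset.equivOfCardEq hB1c⟩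
  set tb : α → V := fun b => if hb : b ∈ B1 then (eT ⟨b, hb⟩ : V) else Classical.arbitrary V with htb
  have htbT : ∀ b ∈ B1, tb b ∈ T := by
    intro b hb
    simp only [htb, hb, dif_pos]
    exact (eT ⟨b, hb⟩).2
  have htbinj : Set.InjOn tb B1 := by
    intro b hb b' hb' heq
    simp only [Finset.mem_coe] at hb hb'
    simp only [htb, hb, hb', dif_pos] at heq
    exact congrArg Subtype.val (eT.injective (Subtype.ext heq))
  set D2 := B1.biUnion (nbh F Finset.univ) with hD2
  have hD2c : (D2.card : ℝ) ≤ 4 * (p ^ 5 * k) := by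
    calc (D2.card : ℝ) ≤ B1.card * Δ := by exact_mod_cast hF.card_biUnion_nbh_le B1
      _ ≤ 4 * (p ^ 6 * k) * Δ := by rw [hB1c]; gcongr
      _ = 4 * ((Δ * p) * (p ^ 5 * k)) := by ring
      _ ≤ 4 * (1 * (p ^ 5 * k)) := by gcongr
      _ = _ := by ring
  have hD2mem : ∀ a, a ∈ D2 ↔ ∃ b ∈ B1, F.Adj a b := by
    intro a
    simp only [hD2, Finset.mem_biUnion, mem_nbh, Finset.mem_univ, true_and]
    simp_rw [F.adj_comm]
  have hD12 : Disjoint D1 D2 := by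
    rw [Finset.disjoint_left]
    intro a ha ha2
    obtain ⟨b, hb, hab⟩ := (hD2mem a).1 ha2
    exact (hB1N b hb a hab).2 ha
  have hD2A0 : Disjoint D2 A0 := by
    rw [Finset.disjoint_left]
    intro a ha2 ha
    obtain ⟨b, hb, hab⟩ := (hD2mem a).1 ha2
    exact (hB1N b hb a hab).1 ha
  -- As `B1` is sparse, each `a ∈ D2` has exactly one neighbour in `B1`. So `Z a` is the
  -- neighbourhood of one vertex of `Y`, and the minimum degree bounds its size.
  set Z : α → Finset V := fun a => X.filter (fun x => ∀ b ∈ B1, F.Adj a b → G.Adj x (tb b)) with hZ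
  have hZc : ∀ a ∈ D2, (1 - p ^ 8) * d * k ≤ (Z a).card := by
    intro a ha
    obtain ⟨b, hb, hab⟩ := (hD2mem a).1 ha
    rw [← hkX]
    refine (h.degY (tb b) (hTY (htbT b hb))).trans (Nat.cast_le.2 (Finset.card_le_card ?_))
    intro x hx
    rw [mem_nbh] at hx
    refine Finset.mem_filter.2 ⟨hx.1, fun b' hb' hab' => ?_⟩
    by_cases hbb : b' = b
    · rw [hbb]; exact hx.2.symm
    · exact absurd hab.symm (hB1 b' hb' b hb hbb a hab'.symm)
  obtain ⟨φ2, hφ2, hinj2, hZ2, hI2, hbad2⟩ := extend_state hp h hF hcard (t := p * k)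
    (by positivity) Z D2 (fun _ _ => Finset.filter_subset _ _) D1 φ1 hI1 hD12 hinj1 (by
      intro a ha
      refine le_trans ?_ (hZc a ha)
      rw [hkX]
      have h8 : p ^ 8 ≤ 1 / 2 := by
        have : p ^ 8 = p ^ 7 * p := by ring
        nlinarith [hpow 7, pow_pos p0 7]
      have h9 : 1 / 2 * (16 * p) * k ≤ (1 - p ^ 8) * d * k := by
        gcongr
        · linarith only [h8]
        · linarith only [h8]
      have := hpk 1
      rw [pow_one] at this
      linarith)
  have hbad2' : ((badPairs G F Y ((1 + p ^ 8) * d) (p ^ 25) (D1 ∪ D2) φ2).card : ℝ) ≤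
      p ^ 18 / 8 * (Fintype.card α : ℝ) ^ 2 := by
    rw [hkdef]
    refine hbad2.trans ?_
    rw [hkX]
    have : (D2.card : ℝ) * (2 * p ^ 24 * k ^ 2 / (p * k)) ≤ p ^ 18 / 16 * k ^ 2 := by
      calc (D2.card : ℝ) * (2 * p ^ 24 * k ^ 2 / (p * k)) ≤
          (4 * (p ^ 5 * k)) * (2 * p ^ 24 * k ^ 2 / (p * k)) := by gcongr
        _ = (128 * p ^ 10) * (p ^ 18 / 16 * k ^ 2) := by field_simp; ring
        _ ≤ 1 * (p ^ 18 / 16 * k ^ 2) := by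
          gcongr
          have : p ^ 10 = p ^ 8 * p * p := by ring
          nlinarith [hpow 8, mul_pos p0 p0]
        _ = _ := one_mul _
    linarith
  have hφ21 : ∀ a ∈ D1, φ2 a = φ1 a := fun a ha => hφ2 a (Finset.disjoint_left.1 hD12 ha)
  obtain ⟨φ, hφ, hinj, hφX, hφc, hI3, hbad3⟩ := buffer_lemma hp h hF hcard hYne hk' A0
    (by rw [hkdef]; exact hA0l) hA0 (D1 ∪ D2) φ2 hI2 hbad2'
    (Finset.disjoint_union_left.2 ⟨hD1A0, hD2A0⟩) hinj2 (by
      intro a ha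
      rcases Finset.mem_union.1 ha with ha | ha
      · rw [hφ21 a ha]; exact hX1 a ha
      · exact (Finset.mem_filter.1 (hZ2 a ha)).1)
  have hφ1 : ∀ a ∈ D1, φ a = φ1 a := fun a ha => by
    rw [hφ a (Finset.mem_union_left _ ha), hφ21 a ha]
  set C := cand G F Y Finset.univ φ with hC
  have hCB0 : ∀ b ∈ B0, C b = cand G F Y D1 φ1 b := by
    intro b hb
    have hbD : ∀ a, F.Adj a b → a ∈ D1 := fun a hab =>
      Finset.mem_biUnion.2 ⟨b, hb, by simp [hab.symm]⟩
    exact cand_congr (fun a hab => by simp [hbD a hab]) fun a _ hab => hφ1 a (hbD a hab)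
  -- every unexceptional vertex of `Y` has many candidates in `B0`
  have hgood : ∀ w ∈ Y \ T, 4 * (p ^ 5 * k) ≤ ((B0.filter (fun b => w ∈ C b)).card : ℝ) := by
    intro w hw
    rw [Finset.mem_sdiff, hT, Finset.mem_filter, not_and, not_le] at hw
    have h1 := hw.2 hw.1
    -- A candidate set has weight at most `1/(16 p)`, so weight above `|B0| / 2` requires more than
    -- `8 p |B0| ≥ 4 p^5 k` sets.
    have h2 : (∑ b ∈ B0, if w ∈ cand G F Y D1 φ1 b then 1 / d ^ (nbh F D1 b).card else 0) ≤
        ∑ b ∈ B0, if w ∈ C b then 1 / (16 * p) else 0 := by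
      refine Finset.sum_le_sum fun b hb => ?_
      rw [hCB0 b hb]
      split_ifs
      · gcongr
        exact hpd.trans (pow_le_pow_of_le_one hd0.le hd1 (hF.card_nbh_le _ _))
      · exact le_rfl
    rw [← Finset.sum_filter (s := B0) (fun b => w ∈ C b), Finset.sum_const, nsmul_eq_mul] at h2
    have h3 : (B0.card : ℝ) / 2 < (B0.filter (fun b => w ∈ C b)).card * (1 / (16 * p)) :=
      h1.trans_le h2
    rw [mul_one_div, lt_div_iff₀ (by positivity)] at h3
    calc 4 * (p ^ 5 * k) = 8 * p * (p ^ 4 / 2 * k) := by ring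
      _ ≤ 8 * p * B0.card := by gcongr
      _ = B0.card / 2 * (16 * p) := by ring
      _ ≤ _ := h3.le
  obtain ⟨f, hf, hft⟩ := exists_injOn_of_large_cand (C := C) (m := p / 2 * k)
    (l := 4 * p ^ 6 * k) hTY hB1B0.symm hB1c (hcard.trans hXY)
    (fun b => by
      have h1 : ((C b).card : ℝ) ≤ (C b \ T).card + T.card := by
        exact_mod_cast (by have := Finset.le_card_sdiff T (C b); omega :
          (C b).card ≤ (C b \ T).card + T.card)
      have h2 := hφc b
      rw [hkY] at h2
      have := hpk 1
      rw [pow_one] at this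
      linarith [hpk 2, hpk 3, hpk 4, hpk 5])
    (fun b => cand_subset _ _ _ _)
    (by
      intro S hsmall
      -- Vertices without neighbours in the buffer already have their final candidate sets before it
      -- is embedded. Every `w` missed by `S` has weight zero for `S'` in that state, so `few_light`
      -- bounds the number of such `w`.
      obtain ⟨S', hS'⟩ : ∃ S', S' = S \ A0.biUnion (nbh F Finset.univ) := ⟨_, rfl⟩
      have hS'c : p ^ 5 * k ≤ S'.card := by
        have h1 : (S.card : ℝ) ≤ S'.card + (A0.biUnion (nbh F Finset.univ)).card := by
          exact_mod_cast (by
            have := Finset.le_card_sdiff (A0.biUnion (nbh F Finset.univ)) S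
            rw [hS']
            omega : S.card ≤ S'.card + (A0.biUnion (nbh F Finset.univ)).card)
        have := hpk 1
        rw [pow_one] at this
        linarith [hpk 2, hpk 3, hpk 4, hpk 5]
      have hlight := few_light hp hF hI3 hk' hbad3 S' (by rw [hkdef]; exact hS'c)
      rw [hkY] at hlight
      refine le_trans (Nat.cast_le.2 (Finset.card_le_card ?_)) hlight
      intro w hw
      rw [Finset.mem_sdiff, Finset.mem_sdiff] at hw
      refine Finset.mem_filter.2 ⟨hw.1.1, ?_⟩
      rw [Finset.sum_eq_zero]
      · exact div_nonneg (Nat.cast_nonneg _) zero_le_two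
      intro b' hb'
      rw [if_neg]
      intro hwc
      rw [hS', Finset.mem_sdiff] at hb'
      refine hw.2 (Finset.mem_biUnion.2 ⟨b', hb'.1, Finset.mem_sdiff.2 ⟨?_, hw.1.2⟩⟩)
      refine mem_cand.2 ⟨hw.1.1, fun a _ hab => (mem_cand.1 hwc).2 a ?_ hab⟩
      refine Finset.mem_sdiff.2 ⟨Finset.mem_univ _, fun ha => hb'.2 ?_⟩
      exact Finset.mem_biUnion.2 ⟨a, ha, mem_nbh.2 ⟨Finset.mem_univ _, hab⟩⟩)
    (fun w hw => by
      refine lt_of_lt_of_le ?_ (hgood w hw)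
      have : 0 < p ^ 5 * k := mul_pos (pow_pos p0 5) hk0
      linarith)
  refine ⟨φ, fun b => if b ∈ B1 then tb b else f b, hinj, ?_, hφX, ?_, ?_⟩
  · intro b b' hbb
    simp only at hbb
    split_ifs at hbb with h1 h2 h2
    · exact htbinj h1 h2 hbb
    · exact absurd (hbb ▸ htbT b h1) (Finset.mem_sdiff.1 (hft b' (by simp [h2]))).2
    · exact absurd (hbb ▸ htbT b' h2) (Finset.mem_sdiff.1 (hft b (by simp [h1]))).2
    · exact hf (by simp [h1]) (by simp [h2]) hbb
  · intro b
    simp only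
    split_ifs with h1
    · exact hTY (htbT b h1)
    · exact (mem_cand.1 (Finset.mem_sdiff.1 (hft b (by simp [h1]))).1).1
  · intro a b hab
    simp only
    split_ifs with h1
    · have ha : a ∈ D2 := (hD2mem a).2 ⟨b, h1, hab⟩
      rw [hφ a (Finset.mem_union_right _ ha)]
      exact (Finset.mem_filter.1 (hZ2 a ha)).2 b h1 hab
    · exact (mem_cand.1 (Finset.mem_sdiff.1 (hft b (by simp [h1]))).1).2 a (Finset.mem_univ _) hab

end Spanning


/-! ### Absorbing a small set of outer vertices into a regular pair. -/

section Absorb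

set_option linter.unusedSectionVars false

variable {V α : Type*} [DecidableEq V] [DecidableEq α] {G : SimpleGraph V}
  {F : SimpleGraph α}

/-- Convexity of the `n`-th power; it turns an average degree into an average number of tuples. -/
lemma card_mul_pow_le_sum_pow {ι : Type*} (s : Finset ι) (f : ι → ℝ) (hf : ∀ i ∈ s, 0 ≤ f i)
    {a : ℝ} (ha : 0 ≤ a) (h : a * s.card ≤ ∑ i ∈ s, f i) (n : ℕ) :
    s.card * a ^ n ≤ ∑ i ∈ s, f i ^ n := by
  rcases n with _ | n
  · simp
  rcases s.eq_empty_or_nonempty with rfl | hs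
  · simp
  have hc : (0 : ℝ) < s.card := by exact_mod_cast hs.card_pos
  refine le_trans ?_ (pow_sum_div_card_le_sum_pow (s := s) hf n)
  rw [le_div_iff₀ (by positivity)]
  calc s.card * a ^ (n + 1) * (s.card : ℝ) ^ n = (a * s.card) ^ (n + 1) := by ring
    _ ≤ _ := by gcongr

/-- A set of at most `q |W| / 2` vertices can be mapped injectively to `W` so that the images have
many common neighbours. -/
lemma exists_common_embedding {W Y : Finset V} {A : Finset α} {q : ℝ} (hq : 0 ≤ q) (hq1 : q ≤ 1)
    (hW : W.Nonempty) (heb : q * W.card * Y.card ≤ eb G W Y) (hA : 2 * (A.card : ℝ) ≤ q * W.card) :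
    ∃ g : α → V, Set.InjOn g A ∧ (∀ a ∈ A, g a ∈ W) ∧
      ∀ C : Finset V, (∀ y ∈ Y, (∀ a ∈ A, G.Adj (g a) y) → y ∈ C) →
        (q / 2) ^ A.card * Y.card ≤ C.card := by
  classical
  have hWc : (0 : ℝ) < W.card := by exact_mod_cast hW.card_pos
  obtain ⟨j, hj⟩ : ∃ j, A.card = j := ⟨_, rfl⟩
  rw [hj] at hA ⊢
  set E := (Finset.univ : Finset (A ↪ W)) with hE
  have hEcard : E.card = W.card.descFactorial j := by
    rw [hE, Finset.card_univ, Fintype.card_embedding_eq]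
    simp [hj]
  have hEne : E.Nonempty := by
    rw [← Finset.card_pos, hEcard, Nat.descFactorial_pos]
    have : (j : ℝ) ≤ W.card := by nlinarith
    exact_mod_cast this
  -- All injections of `A` into `W` are averaged over. Those into the neighbourhood of `y` number a
  -- falling factorial, at least `(deg - j)^j`, and `2j ≤ q |W|` keeps half of the average degree
  -- after the subtraction.
  have hy : ∀ y ∈ Y, (max ((nbh G W y).card - j : ℝ) 0) ^ j ≤
      ((E.filter (fun f => ∀ a : A, G.Adj (f a) y)).card : ℝ) := by
    intro y _
    have h1 : (nbh G W y).card.descFactorial j ≤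
        (E.filter (fun f => ∀ a : A, G.Adj (f a) y)).card := by
      have h2 : Fintype.card (A ↪ nbh G W y) = (nbh G W y).card.descFactorial j := by
        rw [Fintype.card_embedding_eq]; simp [hj]
      rw [← h2, ← Finset.card_univ]
      refine Finset.card_le_card_of_injOn
        (fun f => f.trans (Function.Embedding.mk (fun x : nbh G W y =>
          (⟨x, nbh_subset _ _ x.2⟩ : W)) (fun x x' h => Subtype.ext (Subtype.mk.inj h)))) ?_ ?_
      · intro f _
        simp only [hE, Finset.coe_filter, Finset.mem_univ, true_and, Set.mem_ofPred_eq]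
        intro a
        exact (mem_nbh.1 (f a).2).2.symm
      · intro f _ f' _ h
        ext a
        exact Subtype.mk.inj (DFunLike.congr_fun h a)
    have h3 := Nat.pow_sub_le_descFactorial (nbh G W y).card j
    have h4 : (max ((nbh G W y).card - j : ℝ) 0) ≤ (((nbh G W y).card + 1 - j : ℕ) : ℝ) := by
      refine max_le ?_ (by positivity)
      have : (nbh G W y).card ≤ ((nbh G W y).card + 1 - j) + j := by omega
      have : ((nbh G W y).card : ℝ) ≤ (((nbh G W y).card + 1 - j : ℕ) : ℝ) + j := by
        exact_mod_cast this
      linarith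
    calc (max ((nbh G W y).card - j : ℝ) 0) ^ j ≤ (((nbh G W y).card + 1 - j : ℕ) : ℝ) ^ j := by
          gcongr
      _ ≤ _ := by exact_mod_cast h3.trans h1
  have hsum : Y.card * (q / 2 * W.card) ^ j ≤
      ∑ f ∈ E, ((Y.filter (fun y => ∀ a : A, G.Adj (f a) y)).card : ℝ) := by
    calc Y.card * (q / 2 * W.card) ^ j ≤ ∑ y ∈ Y, (max ((nbh G W y).card - j : ℝ) 0) ^ j := by
          refine card_mul_pow_le_sum_pow Y _ (fun _ _ => le_max_right _ _) (by positivity) ?_ j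
          calc q / 2 * W.card * Y.card ≤ q * W.card * Y.card - j * Y.card := by
                have : (0 : ℝ) ≤ Y.card := by positivity
                nlinarith
            _ ≤ eb G Y W - j * Y.card := by rw [eb_comm]; linarith
            _ = ∑ y ∈ Y, ((nbh G W y).card - j : ℝ) := by
                rw [Finset.sum_sub_distrib, Finset.sum_const, nsmul_eq_mul, eb]; ring
            _ ≤ _ := Finset.sum_le_sum fun _ _ => le_max_left _ _
      _ ≤ ∑ y ∈ Y, ((E.filter (fun f => ∀ a : A, G.Adj (f a) y)).card : ℝ) :=
          Finset.sum_le_sum hy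
      _ = _ := by
          exact_mod_cast Finset.sum_card_bipartiteAbove_eq_sum_card_bipartiteBelow
            (fun y (f : A ↪ W) => ∀ a : A, G.Adj (f a) y)
  obtain ⟨f, -, hf⟩ : ∃ f ∈ E, (q / 2) ^ j * Y.card ≤
      ((Y.filter (fun y => ∀ a : A, G.Adj (f a) y)).card : ℝ) := by
    refine Finset.exists_le_of_sum_le hEne ?_
    rw [Finset.sum_const, nsmul_eq_mul]
    refine le_trans ?_ hsum
    have h1 : (E.card : ℝ) ≤ (W.card : ℝ) ^ j := by
      rw [hEcard]; exact_mod_cast Nat.descFactorial_le_pow _ _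
    calc E.card * ((q / 2) ^ j * Y.card) ≤ (W.card : ℝ) ^ j * ((q / 2) ^ j * Y.card) := by gcongr
      _ = _ := by rw [mul_pow]; ring
  refine ⟨fun a => if h : a ∈ A then f ⟨a, h⟩ else hW.choose, ?_, ?_, ?_⟩
  · intro a ha a' ha' h
    rw [Finset.mem_coe] at ha ha'
    simp only [ha, ha', dif_pos] at h
    exact congrArg Subtype.val (f.injective (Subtype.ext h))
  · intro a ha
    simp only [ha, dif_pos]
    exact (f ⟨a, ha⟩).2
  · intro C hC
    refine hf.trans (Nat.cast_le.2 (Finset.card_le_card fun y hy => ?_))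
    rw [Finset.mem_filter] at hy
    refine hC y hy.1 fun a ha => ?_
    simp only [ha, dif_pos]
    exact hy.2 ⟨a, ha⟩

variable [Fintype α]

/-- The neighbourhoods of the vertices `b ∈ I` can be embedded into the neighbourhoods of prescribed
vertices `τ b` with large common neighbourhoods. -/
lemma exists_attached {X1 Y : Finset V} {q M s : ℝ} {Δ : ℕ} (hq : 0 ≤ q) (hq1 : q ≤ 1)
    (heb : ∀ W ⊆ X1, q * W.card * Y.card ≤ eb G W Y) (hF : DegLE F Δ) (τ : α → V)
    (hs : 2 * Δ ≤ q * (s - M)) (hsM : M < s) (dflt : V) (I : Finset α) :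
    (∀ b ∈ I, s ≤ (nbh G X1 (τ b)).card) →
    (∀ b ∈ I, ∀ b' ∈ I, b ≠ b' → ∀ a, F.Adj a b → ¬ F.Adj a b') → (I.card : ℝ) * Δ ≤ M →
    ∃ φ : α → V, Set.InjOn φ (I.biUnion (nbh F Finset.univ) : Finset α) ∧
      (∀ b ∈ I, ∀ a, F.Adj a b → φ a ∈ X1 ∧ G.Adj (φ a) (τ b)) ∧
      ∀ b ∈ I, ∀ C : Finset V, (∀ y ∈ Y, (∀ a, F.Adj a b → G.Adj (φ a) y) → y ∈ C) →
        (q / 2) ^ Δ * Y.card ≤ C.card := by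
  induction I using Finset.induction_on with
  | empty => exact fun _ _ _ => ⟨fun _ => dflt, by simp, by simp, by simp⟩
  | insert b I hb ih =>
    intro hdeg hsep hM
    rw [Finset.card_insert_of_notMem hb] at hM
    push_cast at hM
    have hΔ0 : (0 : ℝ) ≤ Δ := Nat.cast_nonneg _
    obtain ⟨φ, hinj, hφ, hC⟩ := ih (fun b hb => hdeg b (Finset.mem_insert_of_mem hb))
      (fun b hb b' hb' => hsep b (Finset.mem_insert_of_mem hb) b' (Finset.mem_insert_of_mem hb'))
      (by linarith)
    set D := I.biUnion (nbh F Finset.univ) with hD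
    set A := nbh F Finset.univ b with hA
    have hAΔ : A.card ≤ Δ := hF.card_nbh_le _ _
    have hAmem : ∀ a, a ∈ A ↔ F.Adj a b := fun a => by simp [hA, F.adj_comm]
    have hDA : ∀ a ∈ D, a ∉ A := by
      intro a ha haA
      simp only [hD, Finset.mem_biUnion, mem_nbh, Finset.mem_univ, true_and] at ha
      obtain ⟨b', hb', h'⟩ := ha
      exact hsep b (Finset.mem_insert_self _ _) b' (Finset.mem_insert_of_mem hb')
        (fun h => hb (h ▸ hb')) a ((hAmem a).1 haA) h'.symm
    set W := nbh G X1 (τ b) \ D.image φ with hW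
    have hWc : s - M ≤ W.card := by
      have h1 := Finset.le_card_sdiff (D.image φ) (nbh G X1 (τ b))
      have h2 : (D.image φ).card ≤ I.card * Δ :=
        Finset.card_image_le.trans (hF.card_biUnion_nbh_le I)
      have h3 : (nbh G X1 (τ b)).card ≤ W.card + I.card * Δ := by rw [hW]; omega
      have h4 : ((nbh G X1 (τ b)).card : ℝ) ≤ W.card + I.card * Δ := by exact_mod_cast h3
      linarith [hdeg b (Finset.mem_insert_self _ _)]
    have hWX : W ⊆ X1 := Finset.sdiff_subset.trans (nbh_subset _ _)
    obtain ⟨g, hg, hgW, hgC⟩ := exists_common_embedding (A := A) hq hq1 (by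
      rw [← Finset.card_pos]
      have : (0 : ℝ) < W.card := by linarith
      exact_mod_cast this) (heb W hWX) (by
      calc 2 * (A.card : ℝ) ≤ 2 * Δ := by gcongr
        _ ≤ q * (s - M) := hs
        _ ≤ _ := by gcongr)
    have hmem : ∀ b' ∈ I, ∀ a, F.Adj a b' → a ∈ D := fun b' hb' a h =>
      Finset.mem_biUnion.2 ⟨b', hb', by simp [h.symm]⟩
    have hgD : ∀ a ∈ A, ∀ a' ∈ D, g a ≠ φ a' := by
      intro a ha a' ha' h
      have := (Finset.mem_sdiff.1 (hgW a ha)).2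
      exact this (Finset.mem_image.2 ⟨a', ha', h.symm⟩)
    refine ⟨fun a => if a ∈ A then g a else φ a, ?_, ?_, ?_⟩
    · rw [Finset.biUnion_insert]
      intro a ha a' ha' h
      simp only [Finset.coe_union, Set.mem_union, Finset.mem_coe] at ha ha'
      change a ∈ A ∨ a ∈ D at ha
      change a' ∈ A ∨ a' ∈ D at ha'
      simp only at h
      split_ifs at h with h1 h2 h2
      · exact hg h1 h2 h
      · exact absurd h (hgD a h1 a' (ha'.resolve_left h2))
      · exact absurd h.symm (hgD a' h2 a (ha.resolve_left h1))
      · exact hinj (ha.resolve_left h1) (ha'.resolve_left h2) h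
    · intro b' hb' a hab
      rcases Finset.mem_insert.1 hb' with rfl | hb'
      · simp only [(hAmem a).2 hab, if_true]
        have := hgW a ((hAmem a).2 hab)
        exact ⟨hWX this, (mem_nbh.1 (Finset.mem_sdiff.1 this).1).2.symm⟩
      · simp only [hDA a (hmem b' hb' a hab), if_false]
        exact hφ b' hb' a hab
    · intro b' hb' C h
      rcases Finset.mem_insert.1 hb' with rfl | hb'
      · refine le_trans ?_ (hgC C fun y hy hay => h y hy fun a hab => ?_)
        · gcongr ?_ * _
          exact pow_le_pow_of_le_one (by positivity) (by linarith) hAΔ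
        · simp only [(hAmem a).2 hab, if_true]
          exact hay a ((hAmem a).2 hab)
      · refine hC b' hb' C fun y hy hay => h y hy fun a hab => ?_
        simp only [hDA a (hmem b' hb' a hab), if_false]
        exact hay a hab

/-- Few vertices can share a path of length four with a given one. -/
lemma DegLE.exists_distant {Δ : ℕ} (hF : DegLE F Δ) (n : ℕ)
    (hn : n * (Δ ^ 4 + 1) ≤ Fintype.card α) :
    ∃ I : Finset α, I.card = n ∧ ∀ b ∈ I, ∀ b' ∈ I, b ≠ b' → ∀ a c a', F.Adj b a → F.Adj a c →
      F.Adj c a' → ¬ F.Adj a' b' := by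
  classical
  set N := fun S : Finset α => S.biUnion (nbh F Finset.univ)
  have hN : ∀ (S : Finset α) (m : ℕ), S.card ≤ m → (N S).card ≤ m * Δ := fun S m hS =>
    (hF.card_biUnion_nbh_le S).trans (Nat.mul_le_mul_right _ hS)
  have hmem : ∀ S : Finset α, ∀ a ∈ S, ∀ c, F.Adj a c → c ∈ N S := fun S a ha c hac =>
    Finset.mem_biUnion.2 ⟨a, ha, by simp [hac]⟩
  obtain ⟨I, -, hc, h⟩ := exists_independent
    (fun b b' => ∃ a c a', F.Adj b a ∧ F.Adj a c ∧ F.Adj c a' ∧ F.Adj a' b')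
    (fun b b' ⟨a, c, a', h1, h2, h3, h4⟩ => ⟨a', c, a, h4.symm, h3.symm, h2.symm, h1.symm⟩)
    (Δ ^ 4) n Finset.univ (fun b _ => by
      refine (Finset.card_le_card (t := N (N (N (N {b})))) ?_).trans
        ((hN _ _ (hN _ _ (hN _ _ (hN _ 1 (by simp))))).trans
          (by rw [one_mul]; exact le_of_eq (by ring)))
      intro b' hb'
      obtain ⟨-, a, c, a', h1, h2, h3, h4⟩ := Finset.mem_filter.1 hb'
      exact hmem _ a' (hmem _ c (hmem _ a (hmem _ b (by simp) _ h1) _ h2) _ h3) _ h4)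
    (by rwa [Finset.card_univ])
  exact ⟨I, hc, fun b hb b' hb' hne a c a' h1 h2 h3 h4 => h b hb b' hb' hne
    ⟨a, c, a', h1, h2, h3, h4⟩⟩

set_option maxHeartbeats 1000000 in
/-- In a regular pair, a small set of outer vertices of not too small degree can be absorbed. -/
lemma absorb {X Y X1 L0 : Finset V} {p d : ℝ} {Δ : ℕ} (hp : SmallParam p d Δ)
    (hp2 : 16 * p ≤ (1 / 2) ^ Δ) (h : RegPair G X Y (p ^ 25) (p ^ 8) d) (hF : DegLE F Δ)
    (hX1 : X1 ⊆ X) (hX1c : (X.card : ℝ) ≤ 2 * X1.card) (hL0Y : Disjoint L0 Y)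
    (hcard : Fintype.card α = L0.card * (Δ ^ 4 + 1)) (hX : (Fintype.card α : ℝ) ≤ p * X.card)
    (hY : (Fintype.card α : ℝ) ≤ p ^ 6 * Y.card)
    (hdeg : ∀ v ∈ L0, L0.card * Δ + 1 / p ^ 2 ≤ ((nbh G X1 v).card : ℝ)) :
    ∃ φ ψ : α → V, Function.Injective φ ∧ Function.Injective ψ ∧ (∀ a, φ a ∈ X1) ∧
      (∀ b, ψ b ∈ L0 ∪ Y) ∧ (∀ v ∈ L0, ∃ b, ψ b = v) ∧
      ∀ a b, F.Adj a b → G.Adj (φ a) (ψ b) := by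
  classical
  rcases L0.eq_empty_or_nonempty with rfl | hL0
  · have : IsEmpty α := by
      rw [← Fintype.card_eq_zero_iff, hcard]; simp
    exact ⟨fun a => isEmptyElim a, fun a => isEmptyElim a, fun a => isEmptyElim a,
      fun a => isEmptyElim a, fun a => isEmptyElim a, fun a => isEmptyElim a, by simp,
      fun a => isEmptyElim a⟩
  obtain ⟨dflt, hdflt⟩ := hL0
  have hVne : Nonempty V := ⟨dflt⟩
  have hp' := hp
  obtain ⟨p0, p16, hΔ, hd0, hd1, hpd', hpd⟩ := hp'
  have hp1 : p ≤ 1 := by linarith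
  have hpow : ∀ n, p ^ n ≤ 1 := fun n => pow_le_one₀ p0.le hp1
  obtain ⟨q, hq⟩ : ∃ q, (1 - p ^ 8) * d = q := ⟨_, rfl⟩
  have h8 : p ^ 8 ≤ 1 / 16 := by
    calc p ^ 8 = p * p ^ 7 := by ring
      _ ≤ 1 / 16 * 1 := by gcongr; exact hpow 7
      _ = _ := by ring
  have h80 : 0 ≤ p ^ 8 := by positivity
  have hq0 : 8 * p ≤ q := by rw [← hq]; nlinarith
  have hq00 : 0 ≤ q := by linarith
  have hq1 : q ≤ 1 := by rw [← hq]; nlinarith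
  have hqΔ : 8 * p ≤ q ^ Δ := by
    rw [← hq, mul_pow]
    calc 8 * p = 1 / 2 * (16 * p) := by ring
      _ ≤ _ := mul_le_mul (hp.half_le_pow le_rfl) hpd (by positivity)
          (le_trans (by norm_num) (hp.half_le_pow le_rfl))
  have hc0 : 128 * p ^ 2 ≤ (q / 2) ^ Δ := by
    calc 128 * p ^ 2 = (8 * p) * (16 * p) := by ring
      _ ≤ q ^ Δ * (1 / 2) ^ Δ := by gcongr
      _ = _ := by rw [← mul_pow]; ring
  have hc1 : (q / 2) ^ Δ ≤ 1 := pow_le_one₀ (by positivity) (by linarith)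
  have hcq : 1024 * p ^ 3 ≤ (q / 2) ^ Δ * q ^ Δ := by
    calc 1024 * p ^ 3 = (128 * p ^ 2) * (8 * p) := by ring
      _ ≤ _ := by gcongr
  -- The vertices of `I` will be mapped onto `L0`. No walk of length four joins two of them, so the
  -- neighbours of any vertex meet the neighbourhood of at most one element of `I`.
  obtain ⟨I, hIc, hI⟩ := hF.exists_distant L0.card hcard.ge
  have hsep : ∀ b ∈ I, ∀ b' ∈ I, b ≠ b' → ∀ a, F.Adj a b → ¬ F.Adj a b' :=
    fun b hb b' hb' hne a hab hab' => hI b hb b' hb' hne a b a hab.symm hab hab.symm hab'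
  obtain ⟨eI⟩ : Nonempty (I ≃ L0) := ⟨Finset.equivOfCardEq hIc⟩
  obtain ⟨τ, hτ⟩ : ∃ τ : α → V, ∀ b (hb : b ∈ I), τ b = eI ⟨b, hb⟩ :=
    ⟨fun b => if hb : b ∈ I then (eI ⟨b, hb⟩ : V) else dflt, fun b hb => by simp [hb]⟩
  have hτL : ∀ b ∈ I, τ b ∈ L0 := fun b hb => by rw [hτ b hb]; exact (eI ⟨b, hb⟩).2
  have hτinj : ∀ b ∈ I, ∀ b' ∈ I, τ b = τ b' → b = b' := by
    intro b hb b' hb' h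
    rw [hτ b hb, hτ b' hb'] at h
    exact congrArg Subtype.val (eI.injective (Subtype.ext h))
  have hτsurj : ∀ v ∈ L0, ∃ b ∈ I, τ b = v := by
    intro v hv
    refine ⟨eI.symm ⟨v, hv⟩, (eI.symm ⟨v, hv⟩).2, ?_⟩
    rw [hτ _ (eI.symm ⟨v, hv⟩).2]
    simp
  obtain ⟨φ0, hinj0, hφ0, hC0⟩ := exists_attached (q := q) (M := L0.card * Δ)
    (s := L0.card * Δ + 1 / p ^ 2) (X1 := X1) (Y := Y) (G := G) hq00 hq1 (by
      intro W hW
      unfold eb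
      rw [← nsmul_one W.card, mul_right_comm, mul_comm]
      rw [nsmul_eq_mul, mul_one, ← nsmul_eq_mul, ← Finset.sum_const]
      refine Finset.sum_le_sum fun x hx => ?_
      rw [← hq]
      exact h.degX x (hX1 (hW hx))) hF τ (by
        have h1 : q * (L0.card * Δ + 1 / p ^ 2 - L0.card * Δ) = q / p ^ 2 := by ring
        rw [h1, le_div_iff₀ (by positivity)]
        calc 2 * (Δ : ℝ) * p ^ 2 = 2 * (Δ * p) * p := by ring
          _ ≤ 2 * 1 * p := by gcongr
          _ ≤ q := by linarith) (by
        have : 0 < 1 / p ^ 2 := by positivity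
        linarith) dflt I (fun b hb => hdeg _ (hτL b hb)) hsep (by rw [hIc])
  set D := I.biUnion (nbh F Finset.univ) with hD
  have hDmem : ∀ a, a ∈ D ↔ ∃ b ∈ I, F.Adj a b := by
    intro a
    simp only [hD, Finset.mem_biUnion, mem_nbh, Finset.mem_univ, true_and]
    simp_rw [F.adj_comm]
  have hXpos : (0 : ℝ) < X.card := by
    have h1 := hdeg dflt hdflt
    have h2 : ((nbh G X1 dflt).card : ℝ) ≤ X.card :=
      Nat.cast_le.2 (Finset.card_le_card ((nbh_subset _ _).trans hX1))
    have : 0 < 1 / p ^ 2 := by positivity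
    have : (0 : ℝ) ≤ L0.card * Δ := by positivity
    linarith
  -- The remaining vertices preserve candidate sets measured from the starting proportion `(q/2)^Δ`
  -- instead of `1`. Exactness is not needed, so no cost is tracked.
  obtain ⟨φ, hφ, hinj, hφX, hφI, -⟩ := greedy_extend (CandLarge G F Y ((q / 2) ^ Δ) q)
    (fun _ _ => 0) X (Δ * (p ^ 25 * X.card)) 0 (X.card / 16) (by positivity)
    (by
      intro D' φ' a ha hInv B hB hB'
      rw [← hq] at hInv hB'
      refine candLarge_step h hF (by positivity) (by rw [hq]; exact hq00)
        (by rw [hq]; exact hq1) (by rw [hq]; positivity) ?_ ha hInv hB hB'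
      rw [hq]
      refine le_trans ?_ hcq
      calc p ^ 25 = p ^ 22 * p ^ 3 := by ring
        _ ≤ 1024 * p ^ 3 := by
          gcongr
          linarith [hpow 22])
    (by simp) (fun _ => X1) (Finset.univ \ D) (fun _ _ => hX1) D φ0 (by
      intro b
      have hcb : ∀ y, y ∈ cand G F Y D φ0 b ↔ y ∈ Y ∧ ∀ a ∈ D, F.Adj a b → G.Adj (φ0 a) y :=
        fun y => mem_cand
      by_cases hb : ∃ a ∈ D, F.Adj a b
      · obtain ⟨a, haD, hab⟩ := hb
        obtain ⟨b0, hb0, hab0⟩ := (hDmem a).1 haD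
        -- All embedded neighbours of `b` are neighbours of the single vertex `b0`, so the
        -- candidates of `b` include the common neighbourhood provided for `b0`.
        refine le_trans ?_ (hC0 b0 hb0 _ fun y hy hay => (hcb y).2 ⟨hy, fun a' ha' hab' => ?_⟩)
        · calc (q / 2) ^ Δ * q ^ (nbh F D b).card * Y.card ≤ (q / 2) ^ Δ * 1 * Y.card := by
                gcongr
                exact pow_le_one₀ hq00 hq1
            _ = _ := by ring
        · obtain ⟨b1, hb1, hab1⟩ := (hDmem a').1 ha'
          refine hay a' ?_
          by_cases hbb : b1 = b0
          · rwa [← hbb]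
          · exact absurd hab1 (hI b0 hb0 b1 hb1 (Ne.symm hbb) a b a' hab0.symm hab hab'.symm)
      · push Not at hb
        have h1 : cand G F Y D φ0 b = Y := by
          ext y
          rw [hcb]
          exact ⟨fun h => h.1, fun h => ⟨h, fun a ha hab => absurd hab (hb a ha)⟩⟩
        rw [h1]
        calc (q / 2) ^ Δ * q ^ (nbh F D b).card * Y.card ≤ 1 * Y.card :=
              mul_le_mul_of_nonneg_right (mul_le_one₀ hc1 (pow_nonneg hq00 _)
                (pow_le_one₀ hq00 hq1)) (Nat.cast_nonneg _)
          _ = _ := one_mul _)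
    Finset.disjoint_sdiff hinj0 (by
      intro a _
      have h1 : (D.card : ℝ) + (Finset.univ \ D : Finset α).card = Fintype.card α := by
        have := Finset.card_sdiff_add_card_eq_card (Finset.subset_univ D)
        rw [Finset.card_univ] at this
        rw [← this]; push_cast; ring
      have h2 : (Δ : ℝ) * (p ^ 25 * X.card) ≤ 1 / 16 * X.card := by
        calc (Δ : ℝ) * (p ^ 25 * X.card) = (Δ * p) * (p ^ 23 * p * X.card) := by ring
          _ ≤ 1 * (1 * (1 / 16) * (X.card : ℝ)) := by gcongr; exact hpow 23
          _ = _ := by ring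
      have h3 : p * X.card ≤ 1 / 16 * X.card := by gcongr
      rw [h1]
      linarith)
  rw [Finset.union_sdiff_of_subset (Finset.subset_univ D)] at hinj hφI
  have hφD : ∀ a ∈ D, φ a = φ0 a := fun a ha => hφ a (by simp [ha])
  obtain ⟨f, hf, hfc⟩ := exists_injOn_of_hall Finset.univ (cand G F Y Finset.univ φ) (by
    intro S _
    rcases S.eq_empty_or_nonempty with rfl | ⟨b, hb⟩
    · simp
    have h3 : S.card ≤ (cand G F Y Finset.univ φ b).card := by
      have : (S.card : ℝ) ≤ (cand G F Y Finset.univ φ b).card := by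
        refine le_trans (Nat.cast_le.2 (Finset.card_le_univ S)) (hY.trans ?_)
        refine le_trans ?_ (hφI b)
        gcongr ?_ * _
        calc p ^ 6 = p ^ 3 * p ^ 3 := by ring
          _ ≤ 1024 * p ^ 3 := by gcongr; linarith [hpow 3]
          _ ≤ (q / 2) ^ Δ * q ^ Δ := hcq
          _ ≤ _ := by
            gcongr ?_ * ?_
            exact pow_le_pow_of_le_one hq00 hq1 (hF.card_nbh_le _ _)
      exact_mod_cast this
    exact h3.trans (Finset.card_le_card fun x hx => Finset.mem_biUnion.2 ⟨b, hb, hx⟩))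
  have hfY : ∀ b, f b ∈ Y := fun b => (mem_cand.1 (hfc b (Finset.mem_univ _))).1
  refine ⟨φ, fun b => if b ∈ I then τ b else f b, ?_, ?_, ?_, ?_, ?_, ?_⟩
  · intro a a' haa
    exact hinj (by simp) (by simp) haa
  · intro b b' hbb
    simp only at hbb
    split_ifs at hbb with h1 h2 h2
    · exact hτinj b h1 b' h2 hbb
    · exact absurd (hfY b') (hbb ▸ Finset.disjoint_left.1 hL0Y (hτL b h1))
    · exact absurd (hfY b) (hbb ▸ Finset.disjoint_left.1 hL0Y (hτL b' h2))
    · exact hf (by simp) (by simp) hbb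
  · intro a
    by_cases ha : a ∈ D
    · obtain ⟨b, hb, hab⟩ := (hDmem a).1 ha
      rw [hφD a ha]
      exact (hφ0 b hb a hab).1
    · exact hφX a (by simp [ha])
  · intro b
    simp only
    split_ifs with h1
    · exact Finset.mem_union_left _ (hτL b h1)
    · exact Finset.mem_union_right _ (hfY b)
  · intro v hv
    obtain ⟨b, hb, hbv⟩ := hτsurj v hv
    exact ⟨b, by simp [hb, hbv]⟩
  · intro a b hab
    simp only
    split_ifs with h1
    · rw [hφD a ((hDmem a).2 ⟨b, h1, hab⟩)]
      exact (hφ0 b h1 a hab).2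
    · exact (mem_cand.1 (hfc b (Finset.mem_univ _))).2 a (Finset.mem_univ _) hab

end Absorb


/-! ### Dependent random choice and embeddings in dense pairs. -/

section DependentChoice

set_option linter.unusedSectionVars false

variable {V α : Type*} [DecidableEq V] [DecidableEq α] {G : SimpleGraph V}
  {F : SimpleGraph α}

open scoped Classical in
/-- The common neighbours in `T` of the vertices in `S`. -/
noncomputable def commonNbh (G : SimpleGraph V) (T S : Finset V) : Finset V :=
  T.filter (fun y => ∀ x ∈ S, G.Adj x y)

lemma mem_commonNbh {T S : Finset V} {y : V} :
    y ∈ commonNbh G T S ↔ y ∈ T ∧ ∀ x ∈ S, G.Adj x y := by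
  simp [commonNbh]

/-- The number of ways to extend `S` by `m` elements of `U`, in order and with repetition, to a set
with fewer than `δ` common neighbours in `T`. -/
noncomputable def badExt (G : SimpleGraph V) (T U : Finset V) (δ : ℝ) : ℕ → Finset V → ℝ
  | 0, S => if ((commonNbh G T S).card : ℝ) < δ then 1 else 0
  | m + 1, S => ∑ x ∈ U, badExt G T U δ m (insert x S)

lemma badExt_nonneg (T U : Finset V) (δ : ℝ) (m : ℕ) (S : Finset V) :
    0 ≤ badExt G T U δ m S := by
  induction m generalizing S with
  | zero => rw [badExt]; split_ifs <;> norm_num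
  | succ m ih => rw [badExt]; exact Finset.sum_nonneg fun _ _ => ih _

/-- Adding vertices only shrinks a common neighbourhood, so every extension of a poor set is poor.
Conversely, a bound below `|U|^m` certifies that the set itself is rich. -/
lemma badExt_of_lt {T U : Finset V} {δ : ℝ} (m : ℕ) {S : Finset V}
    (h : ((commonNbh G T S).card : ℝ) < δ) : badExt G T U δ m S = (U.card : ℝ) ^ m := by
  induction m generalizing S with
  | zero => rw [badExt, if_pos h, pow_zero]
  | succ m ih =>
    rw [badExt, Finset.sum_congr rfl fun x _ => ih (lt_of_le_of_lt (Nat.cast_le.2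
      (Finset.card_le_card (t := commonNbh G T S) ?_)) h), Finset.sum_const, nsmul_eq_mul, pow_succ']
    intro y hy
    rw [mem_commonNbh] at hy ⊢
    exact ⟨hy.1, fun z hz => hy.2 z (Finset.mem_insert_of_mem hz)⟩

open scoped Classical in
/-- The vertices of `S1` adjacent to all members of a tuple. -/
noncomputable def tupleNbh (G : SimpleGraph V) (S1 : Finset V) {t : ℕ} (y : Fin t → V) : Finset V :=
  S1.filter (fun x => ∀ i, G.Adj x (y i))

lemma mem_tupleNbh {S1 : Finset V} {t : ℕ} {y : Fin t → V} {x : V} :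
    x ∈ tupleNbh G S1 y ↔ x ∈ S1 ∧ ∀ i, G.Adj x (y i) := by
  simp [tupleNbh]

lemma nbh_insert_eq {D : Finset α} {a b : α} (h : F.Adj a b) :
    nbh F (insert a D) b = insert a (nbh F D b) := by
  ext c
  simp only [mem_nbh, Finset.mem_insert]
  constructor
  · rintro ⟨rfl | hc, h'⟩
    exacts [.inl rfl, .inr ⟨hc, h'⟩]
  · rintro (rfl | ⟨hc, h'⟩)
    exacts [⟨.inl rfl, h.symm⟩, ⟨.inr hc, h'⟩]

lemma card_filter_subset_tupleNbh {S1 S2 S : Finset V} (hS : S ⊆ S1) (t : ℕ) :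
    ((Fintype.piFinset (fun _ : Fin t => S2)).filter (fun y => S ⊆ tupleNbh G S1 y)).card =
      (commonNbh G S2 S).card ^ t := by
  have : (Fintype.piFinset (fun _ : Fin t => S2)).filter (fun y => S ⊆ tupleNbh G S1 y) =
      Fintype.piFinset (fun _ : Fin t => commonNbh G S2 S) := by
    ext y
    simp only [Finset.mem_filter, Fintype.mem_piFinset, mem_commonNbh, Finset.subset_iff,
      mem_tupleNbh]
    constructor
    · exact fun h i => ⟨h.1 i, fun x hx => (h.2 hx).2 i⟩
    · exact fun h => ⟨fun i => (h i).1, fun x hx => ⟨hS hx, fun i => (h i).2 x hx⟩⟩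
  rw [this, Fintype.card_piFinset_const]

/-- A subset of `S1` lies in the neighbourhood of a tuple exactly when all entries are common
neighbours of it, so a poor set occurs for at most `δ^t` tuples. The induction sums this over the
`|S1|^m` ordered extensions. -/
lemma sum_badExt_le {S1 S2 : Finset V} {δ : ℝ} (hδ : 0 ≤ δ) (t m : ℕ) :
    ∀ S ⊆ S1, ∑ y ∈ Fintype.piFinset (fun _ : Fin t => S2),
      (if S ⊆ tupleNbh G S1 y then badExt G S2 (tupleNbh G S1 y) δ m S else 0) ≤
        (S1.card : ℝ) ^ m * δ ^ t := by
  induction m with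
  | zero =>
    intro S hS
    simp only [badExt, pow_zero, one_mul]
    split_ifs with h
    · rw [Finset.sum_boole, card_filter_subset_tupleNbh hS]
      push_cast
      gcongr
    · simp; positivity
  | succ m ih =>
    intro S hS
    calc _ ≤ ∑ y ∈ Fintype.piFinset (fun _ : Fin t => S2), ∑ x ∈ S1,
          (if insert x S ⊆ tupleNbh G S1 y then
            badExt G S2 (tupleNbh G S1 y) δ m (insert x S) else 0) := by
          refine Finset.sum_le_sum fun y _ => ?_
          split_ifs with h
          · rw [badExt, ← Finset.sum_filter]
            refine Finset.sum_le_sum_of_subset_of_nonneg (fun x hx => ?_)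
              fun _ _ _ => badExt_nonneg _ _ _ _ _
            exact Finset.mem_filter.2 ⟨(mem_tupleNbh.1 hx).1,
              Finset.insert_subset hx h⟩
          · refine Finset.sum_nonneg fun x _ => ?_
            split_ifs
            exacts [badExt_nonneg _ _ _ _ _, le_rfl]
      _ = ∑ x ∈ S1, ∑ y ∈ Fintype.piFinset (fun _ : Fin t => S2),
          (if insert x S ⊆ tupleNbh G S1 y then
            badExt G S2 (tupleNbh G S1 y) δ m (insert x S) else 0) := Finset.sum_comm
      _ ≤ ∑ _x ∈ S1, (S1.card : ℝ) ^ m * δ ^ t :=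
          Finset.sum_le_sum fun x hx => ih _ (Finset.insert_subset hx hS)
      _ = _ := by rw [Finset.sum_const, nsmul_eq_mul]; ring

/-- Dependent random choice. -/
lemma exists_rich_subset {S1 S2 : Finset V} {d : ℝ} {Δ : ℕ} (hd : 0 < d) (hΔ : 1 ≤ Δ)
    (hS1 : S1.Nonempty) (hS2 : S2.Nonempty) (heb : d * S1.card * S2.card ≤ eb G S1 S2) :
    ∃ U ⊆ S1, S1.card * d ^ Δ / 2 ≤ U.card ∧
      badExt G S2 U (d ^ Δ / (4 * Δ) * S2.card) Δ ∅ < (U.card / (2 * Δ) : ℝ) ^ Δ := by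
  classical
  have hΔ0 : (0 : ℝ) < Δ := by exact_mod_cast hΔ
  have hs1 : (0 : ℝ) < S1.card := by exact_mod_cast hS1.card_pos
  have hs2 : (0 : ℝ) < S2.card := by exact_mod_cast hS2.card_pos
  set δ := d ^ Δ / (4 * Δ) * S2.card with hδ
  set Ω := Fintype.piFinset (fun _ : Fin Δ => S2) with hΩ
  have hΩc : (Ω.card : ℝ) = (S2.card : ℝ) ^ Δ := by
    rw [hΩ, Fintype.card_piFinset_const]; push_cast; rfl
  have hΩne : Ω.Nonempty := by
    rw [← Finset.card_pos]
    have : (0 : ℝ) < Ω.card := by rw [hΩc]; positivity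
    exact_mod_cast this
  set a := S1.card * d ^ Δ with ha
  have ha0 : 0 < a := by positivity
  have h1 : a * Ω.card ≤ ∑ y ∈ Ω, ((tupleNbh G S1 y).card : ℝ) := by
    have h2 : ∑ y ∈ Ω, (tupleNbh G S1 y).card = ∑ x ∈ S1, (nbh G S2 x).card ^ Δ := by
      calc ∑ y ∈ Ω, (tupleNbh G S1 y).card
          = ∑ x ∈ S1, (Ω.filter (fun y => ∀ i, G.Adj x (y i))).card :=
            Finset.sum_card_bipartiteAbove_eq_sum_card_bipartiteBelow
              (fun (y : Fin Δ → V) x => ∀ i, G.Adj x (y i))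
        _ = _ := by
          refine Finset.sum_congr rfl fun x _ => ?_
          rw [← Fintype.card_piFinset_const]
          congr 1
          ext y
          simp only [hΩ, Finset.mem_filter, Fintype.mem_piFinset, mem_nbh]
          exact ⟨fun h i => ⟨h.1 i, h.2 i⟩, fun h => ⟨fun i => (h i).1, fun i => (h i).2⟩⟩
    have h3 := card_mul_pow_le_sum_pow S1 (fun x => ((nbh G S2 x).card : ℝ))
      (fun _ _ => by positivity) (a := d * S2.card) (by positivity)
      (by refine le_trans (le_of_eq ?_) heb; ring) Δ
    calc a * Ω.card = S1.card * (d * S2.card) ^ Δ := by rw [hΩc, ha, mul_pow]; ring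
      _ ≤ _ := h3
      _ = ∑ y ∈ Ω, ((tupleNbh G S1 y).card : ℝ) := by exact_mod_cast h2.symm
  have h2 := card_mul_pow_le_sum_pow Ω (fun y => ((tupleNbh G S1 y).card : ℝ))
    (fun _ _ => by positivity) ha0.le h1 Δ
  have h3 : ∑ y ∈ Ω, badExt G S2 (tupleNbh G S1 y) δ Δ ∅ ≤ (S1.card : ℝ) ^ Δ * δ ^ Δ := by
    have := sum_badExt_le (G := G) (S1 := S1) (S2 := S2) (δ := δ) (by positivity) Δ Δ ∅ (by simp)
    simpa using this
  -- On average `|U|^Δ` is at least `a^Δ`, while `δ` is chosen so that the weighted number of bad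
  -- extensions averages at most `(a/2)^Δ`. One tuple for the difference gives both the size of `U`
  -- and the scarcity of poor sets.
  obtain ⟨y, -, hy⟩ : ∃ y ∈ Ω, (a / 2) ^ Δ ≤ ((tupleNbh G S1 y).card : ℝ) ^ Δ -
      (2 * Δ) ^ Δ * badExt G S2 (tupleNbh G S1 y) δ Δ ∅ := by
    refine Finset.exists_le_of_sum_le hΩne ?_
    rw [Finset.sum_const, nsmul_eq_mul, Finset.sum_sub_distrib, ← Finset.mul_sum]
    have h4 : (2 * Δ : ℝ) ^ Δ * ((S1.card : ℝ) ^ Δ * δ ^ Δ) = Ω.card * (a / 2) ^ Δ := by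
      rw [hΩc, ← mul_pow, ← mul_pow, ← mul_pow, hδ, ha]
      congr 1
      field_simp
      ring
    have h5 : (2 * Δ : ℝ) ^ Δ * ∑ y ∈ Ω, badExt G S2 (tupleNbh G S1 y) δ Δ ∅ ≤
        Ω.card * (a / 2) ^ Δ := by
      rw [← h4]
      gcongr
    have h6 : 2 * (a / 2) ^ Δ ≤ a ^ Δ := by
      rw [div_pow]
      have : (2 : ℝ) ≤ 2 ^ Δ := by
        calc (2 : ℝ) = 2 ^ 1 := by norm_num
          _ ≤ 2 ^ Δ := by gcongr; norm_num
      rw [mul_div_assoc', div_le_iff₀ (by positivity)]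
      have : 0 ≤ a ^ Δ := by positivity
      nlinarith
    have h7 : (Ω.card : ℝ) * (2 * (a / 2) ^ Δ) ≤ Ω.card * a ^ Δ := by gcongr
    linarith
  have hb0 := badExt_nonneg (G := G) S2 (tupleNbh G S1 y) δ Δ ∅
  have hpos : 0 < (a / 2) ^ Δ := by positivity
  refine ⟨tupleNbh G S1 y, Finset.filter_subset _ _, ?_, ?_⟩
  · refine le_of_pow_le_pow_left₀ (n := Δ) (by omega) (by positivity) (hy.trans ?_)
    have : 0 ≤ (2 * Δ : ℝ) ^ Δ * badExt G S2 (tupleNbh G S1 y) δ Δ ∅ := by positivity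
    linarith
  · rw [div_pow, lt_div_iff₀ (by positivity)]
    linarith

variable [Fintype α]

/-- Embedding the double cover of a graph of bounded degree in a dense pair. -/
lemma exists_embedding_of_dense {S1 S2 : Finset V} {d : ℝ} {Δ : ℕ} (hd : 0 < d) (hΔ : 1 ≤ Δ)
    (hS1 : S1.Nonempty) (hS2 : S2.Nonempty) (heb : d * S1.card * S2.card ≤ eb G S1 S2)
    (hF : DegLE F Δ) (h1 : 8 * (Fintype.card α : ℝ) ≤ S1.card * d ^ Δ)
    (h2 : 4 * Δ * (Fintype.card α : ℝ) ≤ S2.card * d ^ Δ) :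
    ∃ φ ψ : α → V, Function.Injective φ ∧ Function.Injective ψ ∧ (∀ a, φ a ∈ S1) ∧
      (∀ b, ψ b ∈ S2) ∧ ∀ a b, F.Adj a b → G.Adj (φ a) (ψ b) := by
  classical
  have hVne : Nonempty V := ⟨hS1.choose⟩
  have hΔ0 : (0 : ℝ) < Δ := by exact_mod_cast hΔ
  obtain ⟨U, hU, hUc, hbad⟩ := exists_rich_subset hd hΔ hS1 hS2 heb
  have hs1 : (0 : ℝ) < S1.card := by exact_mod_cast hS1.card_pos
  have hUpos : (0 : ℝ) < U.card := lt_of_lt_of_le (by positivity) hUc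
  set δ := d ^ Δ / (4 * Δ) * S2.card with hδ
  set θ : ℝ := U.card / (2 * Δ) with hθ
  have hθ0 : 0 < θ := by positivity
  -- For each `b`, fewer than `θ^m` ways to fill the `m` open places among `Δ` lead to a poor set,
  -- the places being counted as `Δ` even if `b` has smaller degree. By Markov's inequality an
  -- unembedded neighbour of `b` has at most `θ` images that spoil this, hence `a` has at most `Δ θ
  -- = |U| / 2` bad images in all.
  set Inv : Finset α → (α → V) → Prop := fun D φ => ∀ b,
    badExt G S2 U δ (Δ - (nbh F D b).card) ((nbh F D b).image φ) < θ ^ (Δ - (nbh F D b).card)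
    with hInv
  obtain ⟨φ, -, hinj, hφU, hI, -⟩ := greedy_extend Inv (fun _ _ => 0) U (U.card / 2) 0
    (U.card / 4) (by positivity)
    (by
      intro D φ a ha hI B hB hB'
      have hsub : B ⊆ (nbh F Finset.univ a).biUnion (fun b => U.filter (fun x =>
          θ ^ (Δ - ((nbh F D b).card + 1)) ≤
            badExt G S2 U δ (Δ - ((nbh F D b).card + 1)) (insert x ((nbh F D b).image φ)))) := by
        intro x hx
        have h3 := hB' x hx
        simp only [hInv] at h3
        push Not at h3
        obtain ⟨b, hb⟩ := h3
        have himg : (nbh F D b).image (Function.update φ a x) = (nbh F D b).image φ := by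
          refine Finset.image_congr fun a' ha' => ?_
          rw [Function.update_of_ne]
          rintro rfl
          exact ha (mem_nbh.1 ha').1
        by_cases hab : F.Adj a b
        · rw [nbh_insert_eq hab, Finset.card_insert_of_notMem
            (fun h => ha (mem_nbh.1 h).1), Finset.image_insert, himg, Function.update_self] at hb
          exact Finset.mem_biUnion.2 ⟨b, by simp [hab], Finset.mem_filter.2 ⟨hB hx, hb⟩⟩
        · rw [nbh_insert_of_not_adj hab, himg] at hb
          exact absurd (hI b) (not_lt.2 hb)
      have hcard : ∀ b ∈ nbh F Finset.univ a, ((U.filter (fun x =>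
          θ ^ (Δ - ((nbh F D b).card + 1)) ≤ badExt G S2 U δ (Δ - ((nbh F D b).card + 1))
            (insert x ((nbh F D b).image φ)))).card : ℝ) ≤ θ := by
        intro b hb
        have hlt : (nbh F D b).card + 1 ≤ Δ := by
          rw [← Finset.card_insert_of_notMem (a := a) (s := nbh F D b)
            (fun h => ha (mem_nbh.1 h).1), ← nbh_insert_eq (mem_nbh.1 hb).2]
          exact hF.card_nbh_le _ _
        obtain ⟨m, hm⟩ : ∃ m, Δ - (nbh F D b).card = m + 1 :=
          ⟨Δ - ((nbh F D b).card + 1), by omega⟩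
        have hm' : Δ - ((nbh F D b).card + 1) = m := by omega
        have h3 := hI b
        rw [hm, badExt] at h3
        rw [hm']
        by_contra hcon
        push Not at hcon
        refine absurd h3 (not_lt.2 ?_)
        calc θ ^ (m + 1) = θ * θ ^ m := pow_succ' _ _
          _ ≤ (U.filter (fun x => θ ^ m ≤ badExt G S2 U δ m
                (insert x ((nbh F D b).image φ)))).card * θ ^ m := by gcongr
          _ = ∑ _x ∈ U.filter (fun x => θ ^ m ≤ badExt G S2 U δ m
                (insert x ((nbh F D b).image φ))), θ ^ m := by
              rw [Finset.sum_const, nsmul_eq_mul]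
          _ ≤ ∑ x ∈ U.filter (fun x => θ ^ m ≤ badExt G S2 U δ m
                (insert x ((nbh F D b).image φ))),
                badExt G S2 U δ m (insert x ((nbh F D b).image φ)) :=
              Finset.sum_le_sum fun x hx => (Finset.mem_filter.1 hx).2
          _ ≤ _ := Finset.sum_le_sum_of_subset_of_nonneg (Finset.filter_subset _ _)
              fun _ _ _ => badExt_nonneg _ _ _ _ _
      calc (B.card : ℝ) ≤ ∑ b ∈ nbh F Finset.univ a, ((U.filter (fun x =>
          θ ^ (Δ - ((nbh F D b).card + 1)) ≤ badExt G S2 U δ (Δ - ((nbh F D b).card + 1))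
            (insert x ((nbh F D b).image φ)))).card : ℝ) := by
            exact_mod_cast (Finset.card_le_card hsub).trans Finset.card_biUnion_le
        _ ≤ ∑ _b ∈ nbh F Finset.univ a, θ := Finset.sum_le_sum hcard
        _ = (nbh F Finset.univ a).card * θ := by rw [Finset.sum_const, nsmul_eq_mul]
        _ ≤ Δ * θ := by gcongr; exact hF.card_nbh_le _ _
        _ = U.card / 2 := by rw [hθ]; field_simp)
    (by simp) (fun _ => U) Finset.univ (fun _ _ => subset_rfl) ∅ (fun _ => hVne.some) (by
      intro b
      have : nbh F ∅ b = ∅ := by ext; simp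
      rw [this]
      simpa using hbad) (by simp) (by simp) (by
      intro a _
      rw [Finset.card_univ, Finset.card_empty, Nat.cast_zero]
      linarith)
  rw [Finset.empty_union] at hinj hI
  obtain ⟨ψ, hψ, hψc⟩ := exists_injOn_of_hall Finset.univ
    (fun b => commonNbh G S2 ((nbh F Finset.univ b).image φ)) (by
    intro S _
    rcases S.eq_empty_or_nonempty with rfl | ⟨b, hb⟩
    · simp
    have h3 : S.card ≤ (commonNbh G S2 ((nbh F Finset.univ b).image φ)).card := by
      by_contra hcon
      push Not at hcon
      have h4 := hI b
      have h5 : ((commonNbh G S2 ((nbh F Finset.univ b).image φ)).card : ℝ) < δ := by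
        calc ((commonNbh G S2 ((nbh F Finset.univ b).image φ)).card : ℝ) < S.card := by
              exact_mod_cast hcon
          _ ≤ Fintype.card α := by exact_mod_cast Finset.card_le_univ S
          _ ≤ δ := by
            rw [hδ, div_mul_eq_mul_div, le_div_iff₀ (by positivity)]
            linarith
      rw [badExt_of_lt _ h5] at h4
      refine absurd h4 (not_lt.2 ?_)
      gcongr
      rw [hθ, div_le_iff₀ (by positivity)]
      have : (1 : ℝ) ≤ Δ := by exact_mod_cast hΔ
      nlinarith
    exact h3.trans (Finset.card_le_card fun x hx => Finset.mem_biUnion.2 ⟨b, hb, hx⟩))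
  refine ⟨φ, ψ, fun a b hab => hinj (by simp) (by simp) hab,
    fun a b hab => hψ (by simp) (by simp) hab, fun a => hU (hφU a (Finset.mem_univ _)),
    fun b => (mem_commonNbh.1 (hψc b (Finset.mem_univ _))).1, fun a b hab => ?_⟩
  exact (mem_commonNbh.1 (hψc b (Finset.mem_univ _))).2 _
    (Finset.mem_image.2 ⟨a, by simp [hab.symm], rfl⟩)

end DependentChoice


/-! ### Dense colours, monochromatic copies and greedy covering. -/

section Colours

set_option linter.unusedSectionVars false

variable {V K α : Type*} [DecidableEq V] {χ : TopEdgeLabeling V K}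

open scoped Classical in
/-- The neighbours of `v` in `X` along edges with colour in `J`. -/
noncomputable def colNbh (χ : TopEdgeLabeling V K) (J : Finset K) (X : Finset V) (v : V) :
    Finset V :=
  X.filter (fun x => ∃ c ∈ J, (χ.labelGraph c).Adj v x)

lemma mem_colNbh {J : Finset K} {X : Finset V} {v x : V} :
    x ∈ colNbh χ J X v ↔ x ∈ X ∧ ∃ c ∈ J, (χ.labelGraph c).Adj v x := by
  simp [colNbh]

lemma exists_labelGraph_adj (χ : TopEdgeLabeling V K) {v x : V} (h : v ≠ x) :
    ∃ c, (χ.labelGraph c).Adj v x :=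
  ⟨χ.get v x h, (TopEdgeLabeling.labelGraph_adj v x).2 ⟨h, rfl⟩⟩

lemma colNbh_univ [Fintype K] {X : Finset V} {v : V} (hv : v ∉ X) :
    colNbh χ Finset.univ X v = X := by
  ext x
  rw [mem_colNbh]
  refine ⟨fun h => h.1, fun h => ⟨h, ?_⟩⟩
  obtain ⟨c, hc⟩ := exists_labelGraph_adj χ (show v ≠ x from fun h' => hv (h' ▸ h))
  exact ⟨c, Finset.mem_univ _, hc⟩

lemma card_colNbh_insert_le [DecidableEq K] (J : Finset K) (c : K) (X : Finset V) (v : V) :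
    (colNbh χ (insert c J) X v).card ≤
      (nbh (χ.labelGraph c) X v).card + (colNbh χ J X v).card := by
  refine le_trans (Finset.card_le_card ?_) (Finset.card_union_le _ _)
  intro x hx
  rw [mem_colNbh] at hx
  obtain ⟨hxX, c', hc', h⟩ := hx
  rcases Finset.mem_insert.1 hc' with rfl | hc'
  · exact Finset.mem_union_left _ (mem_nbh.2 ⟨hxX, h⟩)
  · exact Finset.mem_union_right _ (mem_colNbh.2 ⟨hxX, c', hc', h⟩)

lemma colNbh_mono (J : Finset K) {X X' : Finset V} (h : X' ⊆ X) (v : V) :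
    colNbh χ J X' v ⊆ colNbh χ J X v := fun _ hx =>
  mem_colNbh.2 ⟨h (mem_colNbh.1 hx).1, (mem_colNbh.1 hx).2⟩

lemma card_le_colNbh_add_sum [Fintype K] [DecidableEq K] (J : Finset K) {X : Finset V} {v : V}
    (hv : v ∉ X) : X.card ≤ (colNbh χ J X v).card +
      ∑ c ∈ Jᶜ, (nbh (χ.labelGraph c) X v).card := by
  have h : X ⊆ colNbh χ J X v ∪ Jᶜ.biUnion (fun c => nbh (χ.labelGraph c) X v) := by
    intro x hx
    obtain ⟨c, hc⟩ := exists_labelGraph_adj χ (show v ≠ x from fun h' => hv (h' ▸ hx))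
    by_cases hcJ : c ∈ J
    · exact Finset.mem_union_left _ (mem_colNbh.2 ⟨hx, c, hcJ, hc⟩)
    · exact Finset.mem_union_right _ (Finset.mem_biUnion.2
        ⟨c, Finset.mem_compl.2 hcJ, mem_nbh.2 ⟨hx, hc⟩⟩)
  refine (Finset.card_le_card h).trans ((Finset.card_union_le _ _).trans ?_)
  gcongr
  exact Finset.card_biUnion_le

/-- Some colour outside `J` is dense between `X` and `Y` if the colours in `J` are rare. -/
lemma exists_dense_colour [Fintype K] (J : Finset K) {X Y : Finset V} (hXY : Disjoint X Y)
    (hX : X.Nonempty) (hY : Y.Nonempty) {τ : ℝ} (hτ : τ < 1)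
    (hJ : ∀ y ∈ Y, ((colNbh χ J X y).card : ℝ) ≤ τ * X.card) :
    ∃ c ∉ J, (1 - τ) / Fintype.card K * X.card * Y.card ≤ eb (χ.labelGraph c) X Y := by
  classical
  have hx : (0 : ℝ) < X.card := by exact_mod_cast hX.card_pos
  have hy : (0 : ℝ) < Y.card := by exact_mod_cast hY.card_pos
  have hsum : (1 - τ) * X.card * Y.card ≤ ∑ c ∈ Jᶜ, eb (χ.labelGraph c) X Y := by
    simp_rw [fun c => eb_comm (G := χ.labelGraph c) X Y, eb]
    rw [Finset.sum_comm]
    calc (1 - τ) * X.card * Y.card = ∑ _y ∈ Y, (1 - τ) * (X.card : ℝ) := by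
          rw [Finset.sum_const, nsmul_eq_mul]; ring
      _ ≤ _ := by
        refine Finset.sum_le_sum fun y hy => ?_
        have h1 := card_le_colNbh_add_sum (χ := χ) J (Finset.disjoint_right.1 hXY hy)
        have h2 : (X.card : ℝ) ≤ (colNbh χ J X y).card +
            ∑ c ∈ Jᶜ, ((nbh (χ.labelGraph c) X y).card : ℝ) := by exact_mod_cast h1
        linarith [hJ y hy]
  have hpos : 0 < (1 - τ) * X.card * Y.card := by
    have : 0 < 1 - τ := by linarith
    positivity
  by_contra hcon
  push Not at hcon
  have hne : (Jᶜ : Finset K).Nonempty := by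
    rw [Finset.nonempty_iff_ne_empty]
    intro h
    rw [h, Finset.sum_empty] at hsum
    linarith
  have hK : (0 : ℝ) < Fintype.card K := by
    exact_mod_cast Fintype.card_pos_iff.2 ⟨hne.choose⟩
  have h1 : ∑ c ∈ Jᶜ, eb (χ.labelGraph c) X Y <
      ∑ _c ∈ Jᶜ, (1 - τ) / Fintype.card K * X.card * Y.card :=
    Finset.sum_lt_sum_of_nonempty hne fun c hc => hcon c (Finset.mem_compl.1 hc)
  rw [Finset.sum_const, nsmul_eq_mul] at h1
  have h2 : ((Jᶜ : Finset K).card : ℝ) ≤ Fintype.card K := by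
    exact_mod_cast Finset.card_le_univ _
  have h3 : ((Jᶜ : Finset K).card : ℝ) * ((1 - τ) / Fintype.card K * X.card * Y.card) ≤
      Fintype.card K * ((1 - τ) / Fintype.card K * X.card * Y.card) := by
    gcongr
  have h4 : Fintype.card K * ((1 - τ) / Fintype.card K * X.card * Y.card) =
      (1 - τ) * X.card * Y.card := by
    field_simp
  linarith

/-- A two-colouring selects one sheet of the double cover over each vertex, and the edges of `F`
join different sheets. -/
lemma exists_copy_of_double_cover {F : SimpleGraph α} {G : SimpleGraph V} (hF : F.IsBipartite)
    {φ ψ : α → V} (hφ : Function.Injective φ) (hψ : Function.Injective ψ)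
    (hd : ∀ a b, φ a ≠ ψ b) (hadj : ∀ a b, F.Adj a b → G.Adj (φ a) (ψ b)) :
    ∃ f : α → V, Function.Injective f ∧ (∀ a, f a = φ a ∨ f a = ψ a) ∧
      ∀ a b, F.Adj a b → G.Adj (f a) (f b) := by
  classical
  obtain ⟨col⟩ := hF
  refine ⟨fun v => if col v = 0 then φ v else ψ v, ?_, ?_, ?_⟩
  · intro u v h
    dsimp only at h
    split_ifs at h with h1 h2 h2
    · exact hφ h
    · exact absurd h (hd _ _)
    · exact absurd h.symm (hd _ _)
    · exact hψ h
  · intro a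
    dsimp only
    split_ifs
    exacts [.inl rfl, .inr rfl]
  · intro u v h
    have hne := col.valid h
    dsimp only
    split_ifs with h1 h2 h2
    · exact absurd (h1.trans h2.symm) hne
    · exact hadj u v h
    · exact (hadj v u h.symm).symm
    · exfalso; generalize col u = x at *; generalize col v = y at *; omega

/-- A Ramsey-type bound: large vertex sets contain monochromatic copies of bipartite graphs of
bounded degree. -/
lemma exists_mono_copy [Fintype K] [Fintype α] {F : SimpleGraph α} {Δ : ℕ} (hΔ : 1 ≤ Δ)
    (hK : 1 ≤ Fintype.card K) (hF : DegLE F Δ) (hbip : F.IsBipartite) (hα : 1 ≤ Fintype.card α)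
    {S : Finset V} (hS : 24 * Δ * Fintype.card K ^ Δ * Fintype.card α ≤ S.card) :
    ∃ (c : K) (f : α → V), Function.Injective f ∧ (∀ a, f a ∈ S) ∧
      ∀ a b, F.Adj a b → (χ.labelGraph c).Adj (f a) (f b) := by
  classical
  obtain ⟨m, hm⟩ : ∃ m, m = Δ * Fintype.card K ^ Δ * Fintype.card α := ⟨_, rfl⟩
  have hm1 : 1 ≤ m := by
    rw [hm]
    exact Nat.mul_pos (Nat.mul_pos hΔ (pow_pos hK _)) hα
  have hS' : 24 * m ≤ S.card := by rw [hm]; linarith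
  obtain ⟨S1, hS1, hS1c⟩ := Finset.exists_subset_card_eq (s := S) (n := S.card / 2) (by omega)
  obtain ⟨S2, hS2, hS2c⟩ := Finset.exists_subset_card_eq (s := S \ S1) (n := S.card / 2) (by
    rw [Finset.card_sdiff_of_subset hS1]; omega)
  have hdisj : Disjoint S1 S2 := Finset.disjoint_of_subset_right hS2 Finset.disjoint_sdiff
  have hS1ne : S1.Nonempty := by rw [← Finset.card_pos]; omega
  have hS2ne : S2.Nonempty := by rw [← Finset.card_pos]; omega
  obtain ⟨c, -, hc⟩ := exists_dense_colour (χ := χ) ∅ hdisj hS1ne hS2ne (τ := 0) (by norm_num)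
    (by intro y _; simp [colNbh])
  have hKpos : (0 : ℝ) < Fintype.card K := by exact_mod_cast hK
  have hsize : 8 * (Δ : ℝ) * Fintype.card α ≤ (S.card / 2 : ℕ) *
      ((1 - 0) / Fintype.card K : ℝ) ^ Δ := by
    rw [sub_zero, one_div, inv_pow, ← div_eq_mul_inv, le_div_iff₀ (by positivity)]
    have h1 : 8 * m ≤ S.card / 2 := by omega
    rw [hm] at h1
    calc 8 * (Δ : ℝ) * Fintype.card α * (Fintype.card K : ℝ) ^ Δ =
        ((8 * (Δ * Fintype.card K ^ Δ * Fintype.card α) : ℕ) : ℝ) := by push_cast; ring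
      _ ≤ _ := by exact_mod_cast h1
  have hΔ1 : (1 : ℝ) ≤ Δ := by exact_mod_cast hΔ
  have hα0 : (0 : ℝ) ≤ Fintype.card α := by positivity
  obtain ⟨φ, ψ, hφ, hψ, hφS, hψS, hadj⟩ := exists_embedding_of_dense (F := F) (Δ := Δ)
    (d := (1 - 0) / Fintype.card K) (by simp; exact_mod_cast hK) hΔ hS1ne hS2ne hc hF
    (by rw [hS1c]; refine le_trans ?_ hsize; nlinarith)
    (by rw [hS2c]; refine le_trans ?_ hsize; nlinarith)
  obtain ⟨f, hf, hfm, hfadj⟩ := exists_copy_of_double_cover hbip hφ hψ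
    (fun a b h => Finset.disjoint_left.1 hdisj (hφS a) (h ▸ hψS b)) hadj
  refine ⟨c, f, hf, fun a => ?_, hfadj⟩
  rcases hfm a with h | h <;> rw [h]
  · exact hS1 (hφS a)
  · exact (Finset.mem_sdiff.1 (hS2 (hψS a))).1

/-- Every set of at least `N * k` vertices contains a monochromatic copy of `F k`. -/
def HasMonoCopies (F : GraphSequence) (χ : TopEdgeLabeling V K) (N : ℕ) : Prop :=
  ∀ (S : Finset V) (k : ℕ), 1 ≤ k → N * k ≤ S.card → ∃ (c : K) (f : Fin k → V),
    Function.Injective f ∧ (∀ a, f a ∈ S) ∧ ∀ a b, (F k).Adj a b → (χ.labelGraph c).Adj (f a) (f b)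

variable {F : GraphSequence}

/-- Each set of vertices can be covered by tiles up to an exponentially small part. -/
lemma HasMonoCopies.exists_cover [Nonempty K] {N : ℕ} (h : HasMonoCopies F χ N) (hN : 1 ≤ N)
    (t : ℕ) (S : Finset V) :
    ∃ S' ⊆ S, (S'.card : ℝ) ≤ Real.exp (-(t / (2 * N))) * S.card ∧ Coverable F χ (S \ S') t := by
  induction t with
  | zero => exact ⟨S, subset_rfl, by simp, by simpa using Coverable.empty⟩
  | succ t ih =>
    obtain ⟨S', hS', hc, hcov⟩ := ih
    have hN0 : (0 : ℝ) < N := by exact_mod_cast hN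
    rcases S'.eq_empty_or_nonempty with rfl | hne
    · exact ⟨∅, by simp, by simp; positivity, hcov.mono (by omega)⟩
    -- Each tile takes a proportion at least `1/(2N)`: a single vertex if fewer than `N` remain,
    -- otherwise a copy on `S'.card / N` vertices, where rounding costs the factor `2`.
    obtain ⟨P, hP, hPc, hPcov⟩ : ∃ P ⊆ S', S'.card ≤ 2 * N * P.card ∧ Coverable F χ P 1 := by
      by_cases hlt : S'.card < N
      · refine ⟨{hne.choose}, by simpa using hne.choose_spec, ?_, Coverable.singleton _⟩
        rw [Finset.card_singleton]; omega
      · push Not at hlt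
        have hk : 1 ≤ S'.card / N := (Nat.one_le_div_iff (by omega)).2 hlt
        obtain ⟨c, f, hf, hfS, hadj⟩ := h S' (S'.card / N) hk (Nat.mul_div_le _ _)
        refine ⟨Finset.univ.image f, by
          intro x hx
          obtain ⟨a, -, rfl⟩ := Finset.mem_image.1 hx
          exact hfS a, ?_, Coverable.of_copy hk c f hf hadj⟩
        rw [Finset.card_image_of_injective _ hf, Finset.card_univ, Fintype.card_fin]
        have := Nat.lt_mul_div_succ S'.card (show 0 < N by omega)
        nlinarith
    refine ⟨S' \ P, Finset.sdiff_subset.trans hS', ?_, ?_⟩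
    · have h1 : ((S' \ P).card : ℝ) + P.card = S'.card := by
        exact_mod_cast Finset.card_sdiff_add_card_eq_card hP
      have h2 : (S'.card : ℝ) ≤ 2 * N * P.card := by exact_mod_cast hPc
      have h3 : (S'.card : ℝ) / (2 * N) ≤ P.card := by
        rw [div_le_iff₀ (by positivity)]; linarith
      have h4 := Real.add_one_le_exp (-(1 / (2 * N : ℝ)))
      calc ((S' \ P).card : ℝ) ≤ (-(1 / (2 * N : ℝ)) + 1) * S'.card := by
            have : (-(1 / (2 * N : ℝ)) + 1) * S'.card = S'.card - S'.card / (2 * N) := by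
              field_simp; ring
            linarith
        _ ≤ Real.exp (-(1 / (2 * N))) * S'.card := by gcongr
        _ ≤ Real.exp (-(1 / (2 * N))) * (Real.exp (-(t / (2 * N))) * S.card) := by gcongr
        _ = _ := by
          rw [← mul_assoc, ← Real.exp_add]
          congr 2
          push_cast
          ring
    · have := hcov.union hPcov (Finset.disjoint_of_subset_right hP Finset.sdiff_disjoint)
      refine cast (congrArg (fun T => Coverable F χ T (t + 1)) ?_) this
      ext x
      simp only [Finset.mem_union, Finset.mem_sdiff]
      have := @hS' x
      have := @hP x
      tauto

/-- Once the exponential bound on the remainder falls below `1`, the remainder is empty. -/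
lemma HasMonoCopies.coverable [Nonempty K] {N : ℕ} (h : HasMonoCopies F χ N) (hN : 1 ≤ N)
    {t : ℕ} {S : Finset V} (hS : (S.card : ℝ) < Real.exp (t / (2 * N))) : Coverable F χ S t := by
  obtain ⟨S', hS', hc, hcov⟩ := h.exists_cover hN t S
  have h1 : (S'.card : ℝ) < 1 := by
    refine hc.trans_lt ?_
    rw [Real.exp_neg, inv_mul_lt_iff₀ (Real.exp_pos _), mul_one]
    exact hS
  have h2 : S' = ∅ := by
    rw [← Finset.card_eq_zero]
    have : S'.card < 1 := by exact_mod_cast h1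
    omega
  rwa [h2, Finset.sdiff_empty] at hcov

end Colours


/-! ### The parameters of the tiling and one absorption step. -/

section Stage

set_option linter.unusedSectionVars false

variable {V K : Type*} [DecidableEq V] [Fintype K] {χ : TopEdgeLabeling V K} {F : GraphSequence}

lemma RegPair.symm {G : SimpleGraph V} {X Y : Finset V} {ε e d : ℝ} (h : RegPair G X Y ε e d) :
    RegPair G Y X ε e d where
  lower := fun Y' hY' X' hX' h1 h2 => by
    rw [eb_comm, mul_right_comm]; exact h.lower X' hX' Y' hY' h2 h1
  upper := fun Y' hY' X' hX' h1 h2 => by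
    rw [eb_comm, mul_right_comm]; exact h.upper X' hX' Y' hY' h2 h1
  degX := h.degY
  degY := h.degX

/-- The case `k = 0` is allowed because the set to be absorbed or covered may turn out to be empty.
-/
lemma Coverable.of_double_cover' {k : ℕ} (hF : (F k).IsBipartite) (c : K) (φ ψ : Fin k → V)
    (hφ : Function.Injective φ) (hψ : Function.Injective ψ) (hd : ∀ a b, φ a ≠ ψ b)
    (hadj : ∀ a b, (F k).Adj a b → (χ.labelGraph c).Adj (φ a) (ψ b)) :
    Coverable F χ (Finset.univ.image φ ∪ Finset.univ.image ψ) 2 := by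
  rcases Nat.eq_zero_or_pos k with rfl | hk
  · simpa using Coverable.empty.mono (by norm_num : 0 ≤ 2)
  · exact Coverable.of_double_cover hk hF c φ ψ hφ hψ hd hadj

/-- The standing assumptions on the graph sequence, the colouring and the parameter `p`. -/
structure TilingSetup (F : GraphSequence) (χ : TopEdgeLabeling V K) (p : ℝ) (Δ N : ℕ) : Prop where
  pos : 0 < p
  le_sixteenth : p ≤ 1 / 16
  degree : Δ * p ≤ 1
  colours : 1 ≤ Fintype.card K
  density : 16 * p ≤ 1 / (2 * Fintype.card K)
  density_pow : 16 * p ≤ (1 / (2 * Fintype.card K)) ^ Δ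
  degLE : ∀ k, DegLE (F k) Δ
  bipartite : ∀ k, (F k).IsBipartite
  one_le : 1 ≤ N
  ratio : 2 * N * p ≤ 1
  copies : HasMonoCopies F χ N

/-- The relative size of the regular pairs used. -/
noncomputable def pairSize (p : ℝ) : ℝ := Real.exp (-(1 / p ^ 60))

lemma pairSize_pos (p : ℝ) : 0 < pairSize p := Real.exp_pos _

/-- One factor `pairSize p` thus absorbs the polynomial losses in `p` that occur later. -/
lemma pairSize_le {p : ℝ} (hp : 0 < p) : pairSize p ≤ p ^ 60 := by
  have h1 : 0 < 1 / p ^ 60 := by positivity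
  have h2 := Real.add_one_le_exp (1 / p ^ 60)
  rw [pairSize, Real.exp_neg]
  calc (Real.exp (1 / p ^ 60))⁻¹ ≤ (1 / p ^ 60)⁻¹ := by
        gcongr
        linarith
    _ = p ^ 60 := by rw [one_div, inv_inv]

namespace TilingSetup

variable {p : ℝ} {Δ N : ℕ}

lemma le_one (H : TilingSetup F χ p Δ N) : p ≤ 1 := by linarith [H.le_sixteenth]

lemma pow_le_one (H : TilingSetup F χ p Δ N) (n : ℕ) : p ^ n ≤ 1 :=
  pow_le_one₀ H.pos.le H.le_one

lemma pairSize_le_pow (H : TilingSetup F χ p Δ N) {n : ℕ} (hn : n ≤ 60) : pairSize p ≤ p ^ n :=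
  (pairSize_le H.pos).trans (pow_le_pow_of_le_one H.pos.le H.le_one hn)

lemma card_pos (H : TilingSetup F χ p Δ N) : (0 : ℝ) < Fintype.card K := by
  exact_mod_cast H.colours

lemma density_le_half (H : TilingSetup F χ p Δ N) : 1 / (2 * Fintype.card K : ℝ) ≤ 1 / 2 := by
  have h : (1 : ℝ) ≤ Fintype.card K := by exact_mod_cast H.colours
  gcongr
  linarith

lemma half_pow (H : TilingSetup F χ p Δ N) : 16 * p ≤ (1 / 2) ^ Δ := by
  refine H.density_pow.trans ?_
  have := H.density_le_half
  have := H.card_pos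
  gcongr

lemma smallParam (H : TilingSetup F χ p Δ N) {d : ℝ} (hd : 1 / (2 * Fintype.card K : ℝ) ≤ d)
    (hd1 : d ≤ 1) : SmallParam p d Δ where
  pos := H.pos
  le_sixteenth := H.le_sixteenth
  degree := H.degree
  density_pos := lt_of_lt_of_le (by have := H.card_pos; positivity) hd
  density_le_one := hd1
  le_density := H.density.trans hd
  le_density_pow := H.density_pow.trans (by have := H.card_pos; gcongr)

lemma exists_cover (H : TilingSetup F χ p Δ N) (t : ℕ) (S : Finset V) :
    ∃ S' ⊆ S, (S'.card : ℝ) ≤ Real.exp (-(p * t)) * S.card ∧ Coverable F χ (S \ S') t := by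
  have : Nonempty K := Fintype.card_pos_iff.1 H.colours
  obtain ⟨S', hS', hc, h⟩ := H.copies.exists_cover H.one_le t S
  refine ⟨S', hS', hc.trans ?_, h⟩
  have hN : (0 : ℝ) < N := by exact_mod_cast H.one_le
  gcongr
  rw [le_div_iff₀ (by positivity)]
  have h1 := H.ratio
  have h2 : (0 : ℝ) ≤ t := by positivity
  nlinarith

lemma coverable (H : TilingSetup F χ p Δ N) {t : ℕ} {S : Finset V}
    (hS : (S.card : ℝ) < Real.exp (p * t)) : Coverable F χ S t := by
  have : Nonempty K := Fintype.card_pos_iff.1 H.colours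
  refine H.copies.coverable H.one_le (hS.trans_le ?_)
  have hN : (0 : ℝ) < N := by exact_mod_cast H.one_le
  gcongr
  rw [le_div_iff₀ (by positivity)]
  have h1 := H.ratio
  have h2 : (0 : ℝ) ≤ t := by positivity
  nlinarith

/-- The regularity parameters are half of those used by the embedding lemmas, which leaves room for
deleting a few vertices. -/
lemma exists_regPair (H : TilingSetup F χ p Δ N) {G : SimpleGraph V} {X0 Y0 : Finset V}
    (hX0 : X0.Nonempty) (hY0 : Y0.Nonempty)
    (heb : 1 / (2 * Fintype.card K : ℝ) * X0.card * Y0.card ≤ eb G X0 Y0) :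
    ∃ X ⊆ X0, ∃ Y ⊆ Y0, ∃ d : ℝ, 1 / (2 * Fintype.card K : ℝ) ≤ d ∧ d ≤ 1 ∧
      RegPair G X Y (p ^ 25 / 2) (p ^ 8 / 2) d ∧
      pairSize p * X0.card ≤ X.card ∧ pairSize p * Y0.card ≤ Y.card ∧
      (X0.card = Y0.card → X.card = Y.card) := by
  have hK := H.card_pos
  have p0 := H.pos
  have hd0 : (0 : ℝ) < 1 / (2 * Fintype.card K : ℝ) := by positivity
  obtain ⟨X, hX, Y, hY, d, hd, hd1, hreg, hXc, hYc, heq⟩ := _root_.exists_regPair X0 Y0 hX0 hY0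
    (ε := p ^ 25 / 2) (e := p ^ 8 / 2) hd0 (by positivity) (by linarith [H.pow_le_one 25])
    (by positivity) (by linarith [H.pow_le_one 8]) heb
  -- The exponent is `32/p^58`, and `log (1/D) ≤ 1/(16 p)` because `D ≥ 16 p`. The product `2/p^59`
  -- is at most `1/p^60`, whence the `60` in `pairSize`.
  have key : pairSize p ≤ (1 / (2 * Fintype.card K : ℝ)) ^ (4 / ((p ^ 25 / 2) ^ 2 * (p ^ 8 / 2))) := by
    obtain ⟨D, hD⟩ : ∃ D, 1 / (2 * Fintype.card K : ℝ) = D := ⟨_, rfl⟩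
    rw [hD] at hd0 ⊢
    have hDp : 16 * p ≤ D := hD ▸ H.density
    rw [Real.rpow_def_of_pos hd0, pairSize]
    refine Real.exp_le_exp.2 ?_
    have h1 : -(1 / (16 * p)) ≤ Real.log D := by
      have h2 := Real.one_sub_inv_le_log_of_pos hd0
      have h3 : D⁻¹ ≤ (16 * p)⁻¹ := by gcongr
      rw [one_div]
      linarith
    have h2 : 4 / ((p ^ 25 / 2) ^ 2 * (p ^ 8 / 2)) = 32 / p ^ 58 := by field_simp; norm_num
    rw [h2]
    calc -(1 / p ^ 60) ≤ -(1 / (16 * p)) * (32 / p ^ 58) := by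
          have h3 : -(1 / (16 * p)) * (32 / p ^ 58) = -(2 * p * (1 / p ^ 60)) := by
            field_simp; norm_num
          have h4 : 0 < 1 / p ^ 60 := by positivity
          have := H.le_sixteenth
          rw [h3]
          nlinarith
      _ ≤ _ := by gcongr
  refine ⟨X, hX, Y, hY, d, hd, hd1, hreg, le_trans ?_ hXc, le_trans ?_ hYc, heq⟩ <;> gcongr

end TilingSetup

/-- Small sets `L` with small degree in the colours of `J` into `X` can be covered by at most `k`
tiles in `L ∪ X`, using few vertices of `X`. -/
def CoversInto (F : GraphSequence) (χ : TopEdgeLabeling V K) (J : Finset K) (σ : ℝ) (k : ℕ) :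
    Prop :=
  ∀ L X : Finset V, Disjoint L X → (L.card : ℝ) ≤ σ * X.card →
    (∀ v ∈ L, ((colNbh χ J X v).card : ℝ) ≤ σ * X.card) →
    ∃ S : Finset V, L ⊆ S ∧ S ⊆ L ∪ X ∧ (S ∩ X).card ≤ 3 * L.card ∧ Coverable F χ S k

/-- The base of the recursion. A vertex outside `X` is joined to all of `X` by some colour, so for
nonempty `L` and `σ < 1` the degree condition forces `X = ∅`, against `|L| ≤ σ |X|`. -/
lemma coversInto_univ {σ : ℝ} (hσ : σ < 1) : CoversInto F χ Finset.univ σ 0 := by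
  intro L X hd hL hdeg
  rcases L.eq_empty_or_nonempty with rfl | ⟨v, hv⟩
  · exact ⟨∅, by simp, by simp, by simp, Coverable.empty⟩
  · exfalso
    have h1 := hdeg v hv
    rw [colNbh_univ (Finset.disjoint_left.1 hd hv)] at h1
    have h2 : (0 : ℝ) < L.card := by exact_mod_cast Finset.card_pos.2 ⟨v, hv⟩
    have h3 : (0 : ℝ) ≤ X.card := by positivity
    have h4 : (X.card : ℝ) = 0 := by nlinarith
    rw [h4] at hL
    linarith

variable {p : ℝ} {Δ N : ℕ}

set_option maxHeartbeats 1000000 in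
/-- A set `L` which is small compared to a regular pair can be covered, using few vertices
of the pair. -/
lemma TilingSetup.absorb_small [DecidableEq K] (H : TilingSetup F χ p Δ N) {X Y L : Finset V}
    {c : K} {J : Finset K} {d σ : ℝ} {k : ℕ} (hXY : Disjoint X Y) (hLX : Disjoint L X)
    (hLY : Disjoint L Y) (hreg : RegPair (χ.labelGraph c) X Y (p ^ 25 / 2) (p ^ 8 / 2) d)
    (hd : 1 / (2 * Fintype.card K : ℝ) ≤ d) (hd1 : d ≤ 1)
    (hcov : CoversInto F χ (insert c J) σ k) (hσ : 0 < σ) (hσ1 : σ ≤ 1)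
    (hL : (L.card : ℝ) ≤ p ^ 20 * (σ * X.card)) (hL' : (L.card : ℝ) ≤ p ^ 20 * Y.card)
    (hJ : ∀ v ∈ L, ((colNbh χ J X v).card : ℝ) ≤ σ / 2 * X.card)
    (hX : 1 ≤ p ^ 3 * (σ * X.card)) :
    ∃ X' ⊆ X, ∃ Y' ⊆ Y, p ^ 5 * ((X \ X').card : ℝ) ≤ L.card ∧ p ^ 5 * ((Y \ Y').card : ℝ) ≤ L.card ∧
      Coverable F χ (L ∪ (X \ X' ∪ Y \ Y')) (k + 2) := by
  classical
  have p0 := H.pos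
  have p16 := H.le_sixteenth
  have hpow := H.pow_le_one
  have hsp := H.smallParam hd hd1
  have hreg' : RegPair (χ.labelGraph c) X Y (p ^ 25) (p ^ 8) d := by
    have hdp := hsp.density_pos
    have := hreg.mono subset_rfl subset_rfl (by positivity) (by positivity) hdp
      (by rw [sub_self]; positivity) (by rw [sub_self]; positivity) (by
        have := hpow 8
        have : 0 < p ^ 8 := by positivity
        nlinarith)
    rwa [mul_div_cancel₀ _ (two_ne_zero' ℝ), mul_div_cancel₀ _ (two_ne_zero' ℝ)] at this
  obtain ⟨x, hx⟩ : ∃ x : ℝ, σ * X.card = x := ⟨_, rfl⟩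
  have hXx : x ≤ X.card := by
    rw [← hx]
    have : (0 : ℝ) ≤ X.card := by positivity
    nlinarith
  have hx0 : 0 ≤ x := by rw [← hx]; positivity
  rw [hx] at hL hX
  have h20 : p ^ 20 ≤ p ^ 2 * (1 / 16) ^ 4 := by
    calc p ^ 20 = p ^ 2 * (p ^ 14 * p ^ 4) := by ring
      _ ≤ p ^ 2 * (1 * (1 / 16) ^ 4) := by gcongr; exact hpow 14
      _ = _ := by ring
  have hp2 : p ^ 2 ≤ 1 / 256 := by nlinarith
  -- Vertices with few `c`-neighbours in `X` have small degree in all colours of `insert c J`, so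
  -- the recursive hypothesis covers them. The others keep enough neighbours after that for
  -- `absorb`.
  set A := L.filter (fun v => ((nbh (χ.labelGraph c) X v).card : ℝ) ≤ σ / 2 * X.card) with hA
  have hAL : A ⊆ L := Finset.filter_subset _ _
  have hAc : (A.card : ℝ) ≤ L.card := Nat.cast_le.2 (Finset.card_le_card hAL)
  have hLx : (L.card : ℝ) ≤ 1 / 256 * (1 / 16) ^ 4 * x := by
    calc (L.card : ℝ) ≤ p ^ 20 * x := hL
      _ ≤ (p ^ 2 * (1 / 16) ^ 4) * x := by gcongr
      _ ≤ _ := by gcongr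
  obtain ⟨S1, hAS, hSA, hSX, hScov⟩ := hcov A X (Finset.disjoint_of_subset_left hAL hLX)
    (by rw [hx]; linarith) (fun v hv => by
      have h1 := card_colNbh_insert_le (χ := χ) J c X v
      have h2 : ((colNbh χ (insert c J) X v).card : ℝ) ≤ (nbh (χ.labelGraph c) X v).card +
        (colNbh χ J X v).card := by exact_mod_cast h1
      have h3 := (Finset.mem_filter.1 hv).2
      linarith [hJ v (hAL hv)])
  set X1 := X \ S1 with hX1
  set L0 := L \ A with hL0
  have hL0c : (L0.card : ℝ) ≤ L.card := Nat.cast_le.2 (Finset.card_le_card Finset.sdiff_subset)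
  have hS1X : ((S1 ∩ X).card : ℝ) ≤ 3 * L.card := by
    have : ((S1 ∩ X).card : ℝ) ≤ 3 * A.card := by exact_mod_cast hSX
    linarith
  have hsd : ∀ T ⊆ X, (T.card : ℝ) ≤ (T \ S1).card + (S1 ∩ X).card := by
    intro T hT
    have h1 : T ⊆ (T \ S1) ∪ (S1 ∩ X) := by
      intro v hv
      by_cases h : v ∈ S1
      · exact Finset.mem_union_right _ (Finset.mem_inter.2 ⟨h, hT hv⟩)
      · exact Finset.mem_union_left _ (Finset.mem_sdiff.2 ⟨hv, h⟩)
    exact_mod_cast (Finset.card_le_card h1).trans (Finset.card_union_le _ _)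
  have hΔ4 : ((L0.card * (Δ ^ 4 + 1) : ℕ) : ℝ) * p ^ 4 ≤ 2 * L.card := by
    push_cast
    calc (L0.card : ℝ) * (Δ ^ 4 + 1) * p ^ 4 = L0.card * ((Δ * p) ^ 4 + p ^ 4) := by ring
      _ ≤ (L.card : ℝ) * (1 ^ 4 + 1) := by
        have := H.degree
        gcongr
        exact hpow 4
      _ = _ := by ring
  -- The double cover has `m` vertices on each side. By `Δ p ≤ 1` this is at most `2 |L| / p^4`,
  -- which keeps the loss in `X` and in `Y` below `|L| / p^5`.
  obtain ⟨m, hm⟩ : ∃ m, L0.card * (Δ ^ 4 + 1) = m := ⟨_, rfl⟩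
  rw [hm] at hΔ4
  have hm10 : ∀ y : ℝ, (L.card : ℝ) ≤ p ^ 20 * y → (m : ℝ) ≤ p ^ 6 * y := by
    intro y hy
    have hy0 : 0 ≤ y := by
      have h1 : 0 ≤ p ^ 20 * y := le_trans (Nat.cast_nonneg _) hy
      exact nonneg_of_mul_nonneg_right h1 (by positivity)
    have h1 : (m : ℝ) * p ^ 4 ≤ (p ^ 6 * y) * p ^ 4 := by
      calc (m : ℝ) * p ^ 4 ≤ 2 * L.card := hΔ4
        _ ≤ 2 * (p ^ 20 * y) := by gcongr
        _ = (2 * p ^ 10) * (p ^ 10 * y) := by ring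
        _ ≤ 1 * (p ^ 10 * y) := by
          gcongr
          calc 2 * p ^ 10 = 2 * p ^ 2 * p ^ 8 := by ring
            _ ≤ 2 * (1 / 256) * 1 := by gcongr; exact hpow 8
            _ ≤ 1 := by norm_num
        _ = _ := by ring
    exact le_of_mul_le_mul_right h1 (by positivity)
  obtain ⟨φ, ψ, hφ, hψ, hφX, hψY, hψL, hadj⟩ := absorb (F := F m) (X1 := X1) (L0 := L0) hsp
    H.half_pow hreg' (H.degLE m) Finset.sdiff_subset
    (by have := hsd X subset_rfl; rw [hX1]; linarith)
    (Finset.disjoint_of_subset_left Finset.sdiff_subset hLY)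
    (by rw [Fintype.card_fin, hm])
    (by
      rw [Fintype.card_fin]
      calc (m : ℝ) ≤ p ^ 6 * x := hm10 _ hL
        _ = p ^ 5 * p * x := by ring
        _ ≤ 1 * p * X.card := by gcongr; exact hpow 5
        _ = _ := by ring)
    (by rw [Fintype.card_fin]; exact hm10 _ hL')
    (by
      intro v hv
      rw [hL0, Finset.mem_sdiff, hA, Finset.mem_filter, not_and, not_le] at hv
      have h1 := hv.2 hv.1
      have h2 := hsd _ (nbh_subset (G := χ.labelGraph c) X v)
      have h3 : nbh (χ.labelGraph c) X v \ S1 ⊆ nbh (χ.labelGraph c) X1 v := by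
        intro y hy
        rw [Finset.mem_sdiff, mem_nbh] at hy
        exact mem_nbh.2 ⟨Finset.mem_sdiff.2 ⟨hy.1.1, hy.2⟩, hy.1.2⟩
      have h4 : ((nbh (χ.labelGraph c) X v \ S1).card : ℝ) ≤
          (nbh (χ.labelGraph c) X1 v).card := Nat.cast_le.2 (Finset.card_le_card h3)
      have h5 : (L0.card : ℝ) * Δ ≤ 1 / 16 * x := by
        calc (L0.card : ℝ) * Δ ≤ (p ^ 20 * x) * Δ := by gcongr; linarith
          _ = (Δ * p) * (p ^ 18 * p * x) := by ring
          _ ≤ 1 * (1 * (1 / 16) * x) := by gcongr; exacts [H.degree, hpow 18]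
          _ = _ := by ring
      have h6 : 1 / p ^ 2 ≤ 1 / 16 * x := by
        rw [div_le_iff₀ (by positivity)]
        calc 1 ≤ p ^ 3 * x := hX
          _ = p * (x * p ^ 2) := by ring
          _ ≤ 1 / 16 * (x * p ^ 2) := by gcongr
          _ = _ := by ring
      have h7 : σ / 2 * X.card = x / 2 := by rw [← hx]; ring
      rw [h7] at h1
      linarith)
  have hφX1 : ∀ a, φ a ∈ X ∧ φ a ∉ S1 := fun a => Finset.mem_sdiff.1 (hφX a)
  have hL0X : ∀ v ∈ L0 ∪ Y, v ∉ X := by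
    intro v hv hvX
    rcases Finset.mem_union.1 hv with h | h
    · exact Finset.disjoint_left.1 hLX (Finset.mem_sdiff.1 h).1 hvX
    · exact Finset.disjoint_left.1 hXY hvX h
  have htile := Coverable.of_double_cover' (F := F) (χ := χ) (H.bipartite m) c φ ψ hφ hψ
    (fun a b h => hL0X _ (hψY b) (h ▸ (hφX1 a).1)) hadj
  have hψS1 : ∀ b, ψ b ∉ S1 := by
    intro b hb
    rcases Finset.mem_union.1 (hSA hb) with h | h
    · rcases Finset.mem_union.1 (hψY b) with h' | h'
      · exact (Finset.mem_sdiff.1 h').2 h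
      · exact Finset.disjoint_left.1 hLY (hAL h) h'
    · exact hL0X _ (hψY b) h
  have hcovall := hScov.union htile (by
    rw [Finset.disjoint_left]
    intro v hv hv'
    rcases Finset.mem_union.1 hv' with h | h <;> obtain ⟨a, -, rfl⟩ := Finset.mem_image.1 h
    exacts [(hφX1 a).2 hv, hψS1 a hv])
  have hmL : p ^ 5 * (m : ℝ) ≤ 1 / 2 * L.card := by
    calc p ^ 5 * (m : ℝ) = p * (m * p ^ 4) := by ring
      _ ≤ 1 / 16 * (2 * (L.card : ℝ)) := by gcongr
      _ ≤ _ := by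
        have : (0 : ℝ) ≤ L.card := by positivity
        linarith
  refine ⟨X1 \ Finset.univ.image φ, Finset.sdiff_subset.trans Finset.sdiff_subset,
    Y \ Finset.univ.image ψ, Finset.sdiff_subset, ?_, ?_, ?_⟩
  · have h1 : X \ (X1 \ Finset.univ.image φ) ⊆ (S1 ∩ X) ∪ Finset.univ.image φ := by
      intro v hv
      simp only [hX1, Finset.mem_sdiff, Finset.mem_union, Finset.mem_inter] at hv ⊢
      tauto
    have h2 : ((X \ (X1 \ Finset.univ.image φ)).card : ℝ) ≤ (S1 ∩ X).card + m := by
      have h3 := (Finset.card_le_card h1).trans (Finset.card_union_le _ _)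
      rw [Finset.card_image_of_injective _ hφ, Finset.card_univ, Fintype.card_fin] at h3
      exact_mod_cast h3
    calc p ^ 5 * ((X \ (X1 \ Finset.univ.image φ)).card : ℝ) ≤ p ^ 5 * (3 * L.card + m) := by
          gcongr; linarith
      _ = p ^ 3 * p ^ 2 * (3 * L.card) + p ^ 5 * m := by ring
      _ ≤ 1 * (1 / 256) * (3 * L.card) + 1 / 2 * L.card := by gcongr; exact hpow 3
      _ ≤ L.card := by
        have : (0 : ℝ) ≤ L.card := by positivity
        linarith
  · have h1 : Y \ (Y \ Finset.univ.image ψ) ⊆ Finset.univ.image ψ := by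
      intro v hv
      simp only [Finset.mem_sdiff] at hv
      tauto
    have h2 : ((Y \ (Y \ Finset.univ.image ψ)).card : ℝ) ≤ m := by
      have h3 := Finset.card_le_card h1
      rw [Finset.card_image_of_injective _ hψ, Finset.card_univ, Fintype.card_fin] at h3
      exact_mod_cast h3
    calc p ^ 5 * ((Y \ (Y \ Finset.univ.image ψ)).card : ℝ) ≤ p ^ 5 * (m : ℝ) := by gcongr
      _ ≤ (L.card : ℝ) := by
        have : (0 : ℝ) ≤ L.card := by positivity
        linarith
  · refine cast (congrArg (fun T => Coverable F χ T (k + 2)) ?_) hcovall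
    ext v
    have e1 : v ∈ S1 → v ∈ A ∨ v ∈ X := fun h => Finset.mem_union.1 (hSA h)
    have e2 : v ∈ A → v ∈ S1 := @hAS v
    have e3 : v ∈ Finset.univ.image φ → v ∈ X := fun h => by
      obtain ⟨a, -, rfl⟩ := Finset.mem_image.1 h
      exact (hφX1 a).1
    have e4 : v ∈ Finset.univ.image ψ → v ∈ L0 ∨ v ∈ Y := fun h => by
      obtain ⟨a, -, rfl⟩ := Finset.mem_image.1 h
      exact Finset.mem_union.1 (hψY a)
    have e5 : v ∈ L0 → v ∈ Finset.univ.image ψ := fun h => by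
      obtain ⟨b, hb⟩ := hψL v h
      exact Finset.mem_image.2 ⟨b, Finset.mem_univ _, hb⟩
    have e6 : v ∈ L0 ↔ v ∈ L ∧ v ∉ A := Finset.mem_sdiff
    have e7 := @hAL v
    have e8 : v ∈ X1 ↔ v ∈ X ∧ v ∉ S1 := Finset.mem_sdiff
    simp only [Finset.mem_union, Finset.mem_sdiff]
    constructor
    · rintro (h | h | h)
      · rcases e1 h with h' | h'
        · exact .inl (e7 h')
        · exact .inr (.inl ⟨h', fun hh => (e8.1 hh.1).2 h⟩)
      · exact .inr (.inl ⟨e3 h, fun hh => hh.2 h⟩)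
      · rcases e4 h with h' | h'
        · exact .inl (e6.1 h').1
        · exact .inr (.inr ⟨h', fun hh => hh.2 h⟩)
    · rintro (h | ⟨h, h'⟩ | ⟨h, h'⟩)
      · by_cases hvA : v ∈ A
        · exact .inl (e2 hvA)
        · exact .inr (.inr (e5 (e6.2 ⟨h, hvA⟩)))
      · by_contra hc
        exact h' ⟨e8.2 ⟨h, fun hs => hc (.inl hs)⟩, fun hi => hc (.inr (.inl hi))⟩
      · by_contra hc
        exact h' ⟨h, fun hi => hc (.inr (.inr hi))⟩

end Stage


/-! ### Recursion on the set of rare colours. -/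

section Main

set_option linter.unusedSectionVars false

variable {V K : Type*} [DecidableEq V] [Fintype K] {χ : TopEdgeLabeling V K} {F : GraphSequence}
  {p : ℝ} {Δ N : ℕ}

lemma card_sdiff_real {X X' : Finset V} (h : X' ⊆ X) :
    ((X \ X').card : ℝ) + X'.card = X.card := by
  exact_mod_cast Finset.card_sdiff_add_card_eq_card h

/-- As `d ≥ 16 p`, the deleted proportion `2 p^15` is far below `p^8 d / 2`, the loss that
`RegPair.mono` tolerates. -/
lemma TilingSetup.regPair_of_removal (H : TilingSetup F χ p Δ N) {G : SimpleGraph V}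
    {X Y X' Y' : Finset V} {d : ℝ} (h : RegPair G X Y (p ^ 25 / 2) (p ^ 8 / 2) d)
    (hd : 1 / (2 * Fintype.card K : ℝ) ≤ d) (hd1 : d ≤ 1) (hX : X' ⊆ X) (hY : Y' ⊆ Y)
    (hXc : ((X \ X').card : ℝ) ≤ 2 * p ^ 15 * X.card)
    (hYc : ((Y \ Y').card : ℝ) ≤ 2 * p ^ 15 * Y.card) : RegPair G X' Y' (p ^ 25) (p ^ 8) d := by
  have p0 := H.pos
  have hpow := H.pow_le_one
  have hsp := H.smallParam hd hd1
  have hdp := hsp.density_pos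
  have key : 2 * p ^ 15 ≤ p ^ 8 / 2 * d := by
    calc 2 * p ^ 15 = p ^ 6 * (p ^ 8 / 2 * (4 * p)) := by ring
      _ ≤ 1 * (p ^ 8 / 2 * d) := by
        gcongr
        · exact hpow 6
        · linarith [hsp.le_density]
      _ = _ := one_mul _
  have h1 : ∀ T T' : Finset V, T' ⊆ T → ((T \ T').card : ℝ) ≤ 2 * p ^ 15 * T.card →
      (T.card : ℝ) - T'.card ≤ p ^ 8 / 2 * d * T.card := by
    intro T T' hT hTc
    have h2 := card_sdiff_real hT
    have h3 : 2 * p ^ 15 * (T.card : ℝ) ≤ p ^ 8 / 2 * d * T.card := by gcongr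
    linarith
  have := h.mono hX hY (by positivity) (by positivity) hdp (h1 X X' hX hXc) (h1 Y Y' hY hYc) (by
    have := hpow 8
    have : 0 < p ^ 8 := by positivity
    nlinarith)
  rwa [mul_div_cancel₀ _ (two_ne_zero' ℝ), mul_div_cancel₀ _ (two_ne_zero' ℝ)] at this

/-- After removing a single tile a set has a prescribed, not much smaller size. -/
lemma TilingSetup.exists_trim (H : TilingSetup F χ p Δ N) {A : Finset V} {m : ℕ} (hm : m ≤ A.card)
    (hmA : (A.card : ℝ) - m ≤ p * A.card) :
    ∃ A' ⊆ A, A'.card = m ∧ Coverable F χ (A \ A') 1 := by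
  classical
  rcases hm.eq_or_lt with rfl | hlt
  · exact ⟨A, subset_rfl, rfl, by simpa using Coverable.empty.mono (by norm_num : 0 ≤ 1)⟩
  have hN := H.one_le
  -- The surplus is at most `p |A|` and `N p ≤ 1/2`, so `A` contains a copy of the member with
  -- exactly that many vertices.
  obtain ⟨c, f, hf, hfA, hadj⟩ := H.copies A (A.card - m) (by omega) (by
    have h1 : ((A.card - m : ℕ) : ℝ) = A.card - m := by push_cast [hm]; rfl
    have h2 : ((N * (A.card - m) : ℕ) : ℝ) ≤ A.card := by
      push_cast [h1]
      have h3 := H.ratio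
      have h4 : (0 : ℝ) ≤ A.card := by positivity
      have h5 : (N : ℝ) * (A.card - m) ≤ N * (p * A.card) := by gcongr
      nlinarith
    exact_mod_cast h2)
  have hsub : Finset.univ.image f ⊆ A := by
    intro x hx
    obtain ⟨a, -, rfl⟩ := Finset.mem_image.1 hx
    exact hfA a
  have hcard : (Finset.univ.image f).card = A.card - m := by
    rw [Finset.card_image_of_injective _ hf, Finset.card_univ, Fintype.card_fin]
  refine ⟨A \ Finset.univ.image f, Finset.sdiff_subset, ?_, ?_⟩
  · rw [Finset.card_sdiff_of_subset hsub, hcard]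
    omega
  · rw [Finset.sdiff_sdiff_eq_self hsub]
    exact Coverable.of_copy (by omega) c f hf hadj

set_option maxHeartbeats 1000000 in
/-- The induction step on the number of colours. -/
lemma TilingSetup.coversInto_of_insert [DecidableEq K] (H : TilingSetup F χ p Δ N) {J : Finset K}
    {σ : ℝ} {k t : ℕ} (hσ : 0 < σ) (hσ1 : σ ≤ 1)
    (hJ : ∀ c ∉ J, CoversInto F χ (insert c J) σ k)
    (ht : Real.exp (-(p * t)) ≤ pairSize p ^ 3 * σ) :
    CoversInto F χ J (pairSize p ^ 2 * σ) (t + (k + 2) + 2) := by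
  classical
  intro L X hLX hLc hdeg
  have p0 := H.pos
  have p16 := H.le_sixteenth
  have hpow := H.pow_le_one
  have hρ0 := pairSize_pos p
  have hρp := fun (n : ℕ) (hn : n ≤ 60) => H.pairSize_le_pow hn
  obtain ⟨ρ, hρ⟩ : ∃ ρ, pairSize p = ρ := ⟨_, rfl⟩
  rw [hρ] at hρ0 hρp ht hLc hdeg
  have hρ16 : ρ ≤ 1 / 16 := by have := hρp 1 (by norm_num); rw [pow_one] at this; linarith
  -- A set of bounded size is exhausted by `t` greedy tiles. Otherwise `L` is large enough for the
  -- embedding lemmas inside a pair of proportion `ρ`.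
  by_cases hsmall : (L.card : ℝ) < 1 / ρ ^ 2
  · refine ⟨L, subset_rfl, Finset.subset_union_left, ?_, (H.coverable (t := t) ?_).mono (by omega)⟩
    · exact (Finset.card_le_card Finset.inter_subset_left).trans (by omega)
    · refine hsmall.trans_le ?_
      rw [← neg_neg (p * t : ℝ), Real.exp_neg, one_div]
      gcongr
      refine ht.trans ?_
      calc ρ ^ 3 * σ = ρ ^ 2 * (ρ * σ) := by ring
        _ ≤ ρ ^ 2 * 1 := by
          gcongr
          exact mul_le_one₀ (by linarith) hσ.le hσ1
        _ = ρ ^ 2 := mul_one _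
  push Not at hsmall
  rw [div_le_iff₀ (by positivity)] at hsmall
  have hL0 : (0 : ℝ) < L.card := by
    by_contra hcon
    have : (L.card : ℝ) * ρ ^ 2 ≤ 0 := mul_nonpos_of_nonpos_of_nonneg (by linarith) (by positivity)
    linarith
  have hX0 : (0 : ℝ) < X.card := by
    by_contra hcon
    have : ρ ^ 2 * σ * (X.card : ℝ) ≤ 0 := mul_nonpos_of_nonneg_of_nonpos (by positivity)
      (by linarith)
    linarith
  have hLne : L.Nonempty := Finset.card_pos.1 (by exact_mod_cast hL0)
  have hXne : X.Nonempty := Finset.card_pos.1 (by exact_mod_cast hX0)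
  have hρσ : ρ ^ 2 * σ ≤ 1 / 2 := by
    calc ρ ^ 2 * σ ≤ (1 / 16) ^ 2 * 1 := by gcongr
      _ ≤ 1 / 2 := by norm_num
  -- The colours of `J` account for at most half of the edges between `X` and `L`, so a new colour
  -- is dense there.
  obtain ⟨c, hcJ, hc⟩ := exists_dense_colour (χ := χ) J hLX.symm hXne hLne (τ := 1 / 2)
    (by norm_num) (fun y hy => (hdeg y hy).trans (by gcongr))
  have hd0 : (1 - 1 / 2) / (Fintype.card K : ℝ) = 1 / (2 * Fintype.card K) := by
    have := H.card_pos
    field_simp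
    norm_num
  rw [hd0] at hc
  obtain ⟨X2, hX2, Y2, hY2, d, hd, hd1, hreg, hX2c, hY2c, -⟩ := H.exists_regPair hXne hLne hc
  rw [hρ] at hX2c hY2c
  -- The part of `L` outside the pair shrinks to at most `ρ³ σ |L|`, which is tiny even against the
  -- sides of the pair.
  obtain ⟨L2, hL2, hL2c, hcov0⟩ := H.exists_cover t (L \ Y2)
  obtain ⟨x, hx⟩ : ∃ x : ℝ, (X2.card : ℝ) = x := ⟨_, rfl⟩
  obtain ⟨y, hy⟩ : ∃ y : ℝ, (Y2.card : ℝ) = y := ⟨_, rfl⟩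
  obtain ⟨l, hl⟩ : ∃ l : ℝ, (L.card : ℝ) = l := ⟨_, rfl⟩
  obtain ⟨l2, hl2⟩ : ∃ l2 : ℝ, (L2.card : ℝ) = l2 := ⟨_, rfl⟩
  rw [hx] at hX2c
  rw [hy, hl] at hY2c
  rw [hl] at hLc hsmall hL0
  have hx0 : 0 ≤ x := by rw [← hx]; positivity
  have hy0 : 0 ≤ y := by rw [← hy]; positivity
  have hl20 : 0 ≤ l2 := by rw [← hl2]; positivity
  have hyl : y ≤ l := by rw [← hy, ← hl]; exact Nat.cast_le.2 (Finset.card_le_card hY2)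
  have hlx : l ≤ ρ * σ * x := by
    calc l ≤ ρ ^ 2 * σ * X.card := hLc
      _ = ρ * σ * (ρ * X.card) := by ring
      _ ≤ ρ * σ * x := by gcongr
  have hl2l : l2 ≤ ρ ^ 3 * σ * l := by
    rw [← hl2]
    refine hL2c.trans ?_
    rw [← hl]
    gcongr
    exact Finset.sdiff_subset
  have hl2y : l2 ≤ p ^ 20 * y := by
    calc l2 ≤ ρ ^ 3 * σ * l := hl2l
      _ = ρ * (ρ * σ) * (ρ * l) := by ring
      _ ≤ p ^ 20 * 1 * y := by
        gcongr
        · exact hρp 20 (by norm_num)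
        · exact mul_le_one₀ (by linarith) hσ.le hσ1
      _ = _ := by ring
  have hl2x : l2 ≤ p ^ 20 * (σ * x) := by
    calc l2 ≤ ρ ^ 3 * σ * l := hl2l
      _ ≤ ρ ^ 3 * σ * (ρ * σ * x) := by gcongr
      _ = ρ * (ρ ^ 3 * σ) * (σ * x) := by ring
      _ ≤ p ^ 20 * 1 * (σ * x) := by
        gcongr
        · exact hρp 20 (by norm_num)
        · exact mul_le_one₀ (pow_le_one₀ hρ0.le (by linarith)) hσ.le hσ1
      _ = _ := by ring
  have hXY2 : Disjoint X2 Y2 :=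
    Finset.disjoint_of_subset_left hX2 (Finset.disjoint_of_subset_right hY2 hLX.symm)
  have hL2L : L2 ⊆ L := hL2.trans Finset.sdiff_subset
  have hLX2 : Disjoint L X2 := Finset.disjoint_of_subset_right hX2 hLX
  have hL2Y2 : Disjoint L2 Y2 := Finset.disjoint_of_subset_left hL2 Finset.sdiff_disjoint
  obtain ⟨X', hX', Y', hY', hXr, hYr, hcov1⟩ := H.absorb_small hXY2
    (Finset.disjoint_of_subset_left hL2L hLX2) hL2Y2 hreg hd hd1 (hJ c hcJ) hσ hσ1
    (by rw [hx, hl2]; exact hl2x) (by rw [hy, hl2]; exact hl2y) (by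
      intro v hv
      rw [hx]
      calc ((colNbh χ J X2 v).card : ℝ) ≤ (colNbh χ J X v).card :=
            Nat.cast_le.2 (Finset.card_le_card (colNbh_mono J hX2 v))
        _ ≤ ρ ^ 2 * σ * X.card := hdeg v (hL2L hv)
        _ = ρ * σ * (ρ * X.card) := by ring
        _ ≤ 1 / 2 * σ * x := by gcongr; linarith
        _ = _ := by ring) (by
      rw [hx]
      have h1 : 1 ≤ ρ * (ρ * (σ * x)) * ρ := by
        calc 1 ≤ l * ρ ^ 2 := hsmall
          _ ≤ ρ * σ * x * ρ ^ 2 := by gcongr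
          _ = _ := by ring
      calc 1 ≤ ρ * (ρ * (σ * x)) * ρ := h1
        _ ≤ 1 * (p ^ 3 * (σ * x)) * 1 := by
          gcongr
          · linarith
          · exact hρp 3 (by norm_num)
          · linarith
        _ = _ := by ring)
  rw [hl2] at hXr hYr
  have h5 : 0 < p ^ 5 := by positivity
  have hXr' : ((X2 \ X').card : ℝ) ≤ p ^ 15 * x := by
    refine le_of_mul_le_mul_left (hXr.trans (hl2x.trans ?_)) h5
    calc p ^ 20 * (σ * x) ≤ p ^ 20 * (1 * x) := by gcongr
      _ = _ := by ring
  have hYr' : ((Y2 \ Y').card : ℝ) ≤ p ^ 15 * y := by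
    refine le_of_mul_le_mul_left (hYr.trans (hl2y.trans (le_of_eq ?_))) h5
    ring
  have hXry : ((X2 \ X').card : ℝ) ≤ p ^ 15 * y := by
    refine le_of_mul_le_mul_left (hXr.trans (hl2y.trans (le_of_eq ?_))) h5
    ring
  have h15 : p ^ 15 ≤ 1 / 16 := by
    calc p ^ 15 = p ^ 14 * p := by ring
      _ ≤ 1 * (1 / 16) := by gcongr; exact hpow 14
      _ = _ := one_mul _
  have hreg' := H.regPair_of_removal hreg hd hd1 hX' hY'
    (hXr'.trans (by rw [hx]; gcongr; linarith [pow_pos p0 15]))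
    (hYr'.trans (by rw [hy]; gcongr; linarith [pow_pos p0 15]))
  have hYc' := card_sdiff_real hY'
  have hXc' := card_sdiff_real hX'
  rw [hy] at hYc'
  rw [hx] at hXc'
  have hYhalf : 1 / 2 * y ≤ Y'.card := by nlinarith
  have hXhalf : 1 / 2 * x ≤ X'.card := by nlinarith
  have hYle : (Y'.card : ℝ) ≤ y := by rw [← hy]; exact Nat.cast_le.2 (Finset.card_le_card hY')
  -- What is left of `Y2 ⊆ L` must be covered exactly, while `X'` is much larger and may be used
  -- only in part. Hence the sides are exchanged and the one-sided embedding suffices.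
  obtain ⟨φ, ψ, hφ, hψ, hφY, hψX, hadj⟩ := exact_one_sided (F := F Y'.card)
    (H.smallParam hd hd1) hreg'.symm (H.degLE _) (by rw [Fintype.card_fin]) (by
      rw [Fintype.card_fin]
      calc (1 : ℝ) ≤ l * ρ ^ 2 := hsmall
        _ = ρ * (ρ * l) := by ring
        _ ≤ p ^ 18 * y := by gcongr; exact hρp 18 (by norm_num)
        _ = p ^ 17 * (p * y) := by ring
        _ ≤ p ^ 17 * (1 / 2 * y) := by gcongr; linarith
        _ ≤ _ := by gcongr) (by
      rw [Fintype.card_fin]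
      calc (Y'.card : ℝ) ≤ l := hYle.trans hyl
        _ ≤ ρ * σ * x := hlx
        _ ≤ p ^ 2 * 1 * x := by gcongr; exact hρp 2 (by norm_num)
        _ = p * (p * x) := by ring
        _ ≤ p * (1 / 2 * x) := by gcongr; linarith
        _ ≤ _ := by gcongr)
  have hφim : Finset.univ.image φ = Y' := by
    refine Finset.eq_of_subset_of_card_le ?_ ?_
    · intro v hv
      obtain ⟨a, -, rfl⟩ := Finset.mem_image.1 hv
      exact hφY a
    · rw [Finset.card_image_of_injective _ hφ, Finset.card_univ, Fintype.card_fin]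
  have hψim : Finset.univ.image ψ ⊆ X' := by
    intro v hv
    obtain ⟨a, -, rfl⟩ := Finset.mem_image.1 hv
    exact hψX a
  have hψc : (Finset.univ.image ψ).card = Y'.card := by
    rw [Finset.card_image_of_injective _ hψ, Finset.card_univ, Fintype.card_fin]
  have hcov2 := Coverable.of_double_cover' (F := F) (χ := χ) (H.bipartite _) c φ ψ hφ hψ
    (fun a b h => Finset.disjoint_right.1 hXY2 (hY' (hφY a)) (h ▸ hX' (hψX b)))
    hadj
  rw [hφim] at hcov2
  have hcov01 := hcov0.union hcov1 (by
    rw [Finset.disjoint_left]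
    intro v hv hv'
    rw [Finset.mem_sdiff, Finset.mem_sdiff] at hv
    rcases Finset.mem_union.1 hv' with h | h
    · exact hv.2 h
    rcases Finset.mem_union.1 h with h | h
    · exact Finset.disjoint_left.1 hLX2 hv.1.1 (Finset.mem_sdiff.1 h).1
    · exact hv.1.2 (Finset.mem_sdiff.1 h).1)
  have hcov := hcov01.union hcov2 (by
    rw [Finset.disjoint_right]
    intro v hv hv'
    have hv2 : (v ∈ Y' ∧ v ∈ Y2) ∨ (v ∈ X' ∧ v ∈ X2) := by
      rcases Finset.mem_union.1 hv with h | h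
      · exact .inl ⟨h, hY' h⟩
      · exact .inr ⟨hψim h, hX' (hψim h)⟩
    rcases Finset.mem_union.1 hv' with h | h
    · rw [Finset.mem_sdiff, Finset.mem_sdiff] at h
      rcases hv2 with h2 | h2
      · exact h.1.2 h2.2
      · exact Finset.disjoint_left.1 hLX2 h.1.1 h2.2
    rcases Finset.mem_union.1 h with h | h
    · rcases hv2 with h2 | h2
      · exact Finset.disjoint_left.1 hL2Y2 h h2.2
      · exact Finset.disjoint_left.1 hLX2 (hL2L h) h2.2
    rcases Finset.mem_union.1 h with h | h <;> rw [Finset.mem_sdiff] at h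
    · rcases hv2 with h2 | h2
      · exact Finset.disjoint_left.1 hXY2 h.1 h2.2
      · exact h.2 h2.1
    · rcases hv2 with h2 | h2
      · exact h.2 h2.1
      · exact Finset.disjoint_left.1 hXY2 h2.2 h.1)
  refine ⟨_, ?_, ?_, ?_, hcov⟩
  · intro v hv
    by_cases h1 : v ∈ Y2
    · by_cases h2 : v ∈ Y'
      · exact Finset.mem_union_right _ (Finset.mem_union_left _ h2)
      · exact Finset.mem_union_left _ (Finset.mem_union_right _ (Finset.mem_union_right _
          (Finset.mem_union_right _ (Finset.mem_sdiff.2 ⟨h1, h2⟩))))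
    · by_cases h2 : v ∈ L2
      · exact Finset.mem_union_left _ (Finset.mem_union_right _ (Finset.mem_union_left _ h2))
      · exact Finset.mem_union_left _ (Finset.mem_union_left _ (Finset.mem_sdiff.2
          ⟨Finset.mem_sdiff.2 ⟨hv, h1⟩, h2⟩))
  · refine Finset.union_subset (Finset.union_subset ?_ (Finset.union_subset ?_
      (Finset.union_subset ?_ ?_))) (Finset.union_subset ?_ ?_)
    · exact (Finset.sdiff_subset.trans Finset.sdiff_subset).trans Finset.subset_union_left
    · exact hL2L.trans Finset.subset_union_left
    · exact (Finset.sdiff_subset.trans hX2).trans Finset.subset_union_right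
    · exact (Finset.sdiff_subset.trans hY2).trans Finset.subset_union_left
    · exact (hY'.trans hY2).trans Finset.subset_union_left
    · exact (hψim.trans (hX'.trans hX2)).trans Finset.subset_union_right
  · have hsub : ((L \ Y2) \ L2 ∪ (L2 ∪ (X2 \ X' ∪ Y2 \ Y')) ∪ (Y' ∪ Finset.univ.image ψ)) ∩ X ⊆
        (X2 \ X') ∪ Finset.univ.image ψ := by
      intro v hv
      rw [Finset.mem_inter] at hv
      have hvL : v ∉ L := Finset.disjoint_right.1 hLX hv.2
      rcases Finset.mem_union.1 hv.1 with h | h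
      · rcases Finset.mem_union.1 h with h | h
        · exact absurd (Finset.mem_sdiff.1 (Finset.mem_sdiff.1 h).1).1 hvL
        rcases Finset.mem_union.1 h with h | h
        · exact absurd (hL2L h) hvL
        rcases Finset.mem_union.1 h with h | h
        · exact Finset.mem_union_left _ h
        · exact absurd (hY2 (Finset.mem_sdiff.1 h).1) hvL
      · rcases Finset.mem_union.1 h with h | h
        · exact absurd (hY2 (hY' h)) hvL
        · exact Finset.mem_union_right _ h
    have h1 := (Finset.card_le_card hsub).trans (Finset.card_union_le _ _)
    rw [hψc] at h1
    have h2 : ((X2 \ X').card : ℝ) + Y'.card ≤ 3 * L.card := by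
      rw [hl]
      nlinarith
    have h3 : (X2 \ X').card + Y'.card ≤ 3 * L.card := by exact_mod_cast h2
    exact h1.trans h3

end Main


/-! ### Assembling the tiling of the whole vertex set. -/

section Conclusion

set_option linter.unusedSectionVars false

variable {V K : Type*} [DecidableEq V] [Fintype K] {χ : TopEdgeLabeling V K} {F : GraphSequence}
  {p : ℝ} {Δ N : ℕ}

-- The count is `t` tiles for the greedy cover outside a balanced pair, `k + 2` to absorb the
-- leftover, one on each side to equalise the sizes, and two from a spanning double cover. The
-- degree condition for `J = ∅` is void.
set_option maxHeartbeats 1000000 in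
lemma TilingSetup.coverable_univ [Fintype V] [DecidableEq K] (H : TilingSetup F χ p Δ N)
    {σ : ℝ} {k t : ℕ} (hσ : 0 < σ) (hσ1 : σ ≤ 1)
    (hJ : ∀ c, CoversInto F χ (insert c ∅) σ k)
    (ht : Real.exp (-(p * t)) ≤ pairSize p ^ 3 * σ) :
    Coverable F χ Finset.univ (t + (k + 2) + (1 + 1) + 2) := by
  classical
  have p0 := H.pos
  have p16 := H.le_sixteenth
  have hpow := H.pow_le_one
  have hρ0 := pairSize_pos p
  have hρp := fun (n : ℕ) (hn : n ≤ 60) => H.pairSize_le_pow hn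
  obtain ⟨ρ, hρ⟩ : ∃ ρ, pairSize p = ρ := ⟨_, rfl⟩
  rw [hρ] at hρ0 hρp ht
  have hρ16 : ρ ≤ 1 / 16 := by have := hρp 1 (by norm_num); rw [pow_one] at this; linarith
  obtain ⟨n, hn⟩ : ∃ n : ℝ, (Fintype.card V : ℝ) = n := ⟨_, rfl⟩
  by_cases hsmall : n < 1 / (ρ ^ 3 * σ)
  · refine (H.coverable (t := t) ?_).mono (by omega)
    rw [Finset.card_univ, hn]
    refine hsmall.trans_le ?_
    rw [← neg_neg (p * t : ℝ), Real.exp_neg, one_div]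
    gcongr
  push Not at hsmall
  rw [div_le_iff₀ (by positivity)] at hsmall
  have hn0 : 0 ≤ n := by rw [← hn]; positivity
  have hρ3σ : ρ ^ 3 * σ ≤ 1 / 16 := by
    calc ρ ^ 3 * σ ≤ (1 / 16) ^ 3 * 1 := by gcongr
      _ ≤ 1 / 16 := by norm_num
  have hn16 : 16 ≤ n := by nlinarith
  have hncard : 16 ≤ Fintype.card V := by
    have : ((16 : ℕ) : ℝ) ≤ Fintype.card V := by rw [hn]; exact_mod_cast hn16
    exact_mod_cast this
  obtain ⟨X0, -, hX0c⟩ := Finset.exists_subset_card_eq (s := (Finset.univ : Finset V))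
    (n := Fintype.card V / 2) (by rw [Finset.card_univ]; omega)
  obtain ⟨Y0, hY0, hY0c⟩ := Finset.exists_subset_card_eq (s := Finset.univ \ X0)
    (n := Fintype.card V / 2) (by
      rw [Finset.card_sdiff_of_subset (Finset.subset_univ _), Finset.card_univ]; omega)
  have hXY0 : Disjoint X0 Y0 := Finset.disjoint_of_subset_right hY0 Finset.disjoint_sdiff
  have hX0ne : X0.Nonempty := by rw [← Finset.card_pos]; omega
  have hY0ne : Y0.Nonempty := by rw [← Finset.card_pos]; omega
  obtain ⟨c, -, hc⟩ := exists_dense_colour (χ := χ) ∅ hXY0 hX0ne hY0ne (τ := 1 / 2)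
    (by norm_num) (by intro y _; simp [colNbh])
  have hd0 : (1 - 1 / 2) / (Fintype.card K : ℝ) = 1 / (2 * Fintype.card K) := by
    have := H.card_pos
    field_simp
    norm_num
  rw [hd0] at hc
  obtain ⟨X, hX, Y, hY, d, hd, hd1, hreg, hXc, -, heq⟩ := H.exists_regPair hX0ne hY0ne hc
  have heq' := heq (by omega)
  have hXY : Disjoint X Y := Finset.disjoint_of_subset_left hX
    (Finset.disjoint_of_subset_right hY hXY0)
  obtain ⟨L, hL, hLc, hcov0⟩ := H.exists_cover t (Finset.univ \ (X ∪ Y))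
  obtain ⟨x, hx⟩ : ∃ x : ℝ, (X.card : ℝ) = x := ⟨_, rfl⟩
  obtain ⟨l, hl⟩ : ∃ l : ℝ, (L.card : ℝ) = l := ⟨_, rfl⟩
  have hy : (Y.card : ℝ) = x := by rw [← heq', hx]
  rw [hρ, hx, hX0c] at hXc
  have hx0 : 0 ≤ x := by rw [← hx]; positivity
  have hl0 : 0 ≤ l := by rw [← hl]; positivity
  have hnx : ρ * n ≤ 3 * x := by
    have h1 : Fintype.card V ≤ 3 * (Fintype.card V / 2) := by omega
    have h2 : n ≤ 3 * (Fintype.card V / 2 : ℕ) := by rw [← hn]; exact_mod_cast h1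
    calc ρ * n ≤ ρ * (3 * (Fintype.card V / 2 : ℕ)) := by gcongr
      _ = 3 * (ρ * (Fintype.card V / 2 : ℕ)) := by ring
      _ ≤ 3 * x := by gcongr
  have hln : l ≤ ρ ^ 3 * σ * n := by
    rw [← hl]
    refine hLc.trans ?_
    rw [← hn]
    gcongr
    exact Finset.card_le_univ _
  have hlx : l ≤ p ^ 20 * (σ * x) := by
    calc l ≤ ρ ^ 3 * σ * n := hln
      _ = ρ ^ 2 * σ * (ρ * n) := by ring
      _ ≤ ρ ^ 2 * σ * (3 * x) := by gcongr
      _ = ρ * (3 * ρ) * (σ * x) := by ring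
      _ ≤ p ^ 20 * 1 * (σ * x) := by
        gcongr
        · exact hρp 20 (by norm_num)
        · linarith
      _ = _ := by ring
  have hly : l ≤ p ^ 20 * x := by
    refine hlx.trans ?_
    gcongr
    nlinarith
  have hx1 : 1 ≤ p ^ 18 * (σ * x) := by
    calc 1 ≤ n * (ρ ^ 3 * σ) := hsmall
      _ = ρ ^ 2 * σ * (ρ * n) := by ring
      _ ≤ ρ ^ 2 * σ * (3 * x) := by gcongr
      _ = ρ * (3 * ρ) * (σ * x) := by ring
      _ ≤ p ^ 18 * 1 * (σ * x) := by
        gcongr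
        · exact hρp 18 (by norm_num)
        · linarith
      _ = _ := by ring
  have hLX : Disjoint L X := Finset.disjoint_of_subset_left hL
    (Finset.disjoint_of_subset_right Finset.subset_union_left Finset.sdiff_disjoint)
  have hLY : Disjoint L Y := Finset.disjoint_of_subset_left hL
    (Finset.disjoint_of_subset_right Finset.subset_union_right Finset.sdiff_disjoint)
  obtain ⟨X', hX', Y', hY', hXr, hYr, hcov1⟩ := H.absorb_small hXY hLX hLY hreg hd hd1 (hJ c)
    hσ hσ1 (by rw [hx, hl]; exact hlx) (by rw [hy, hl]; exact hly) (by
      intro v _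
      have : colNbh χ ∅ X v = ∅ := by ext; simp [mem_colNbh]
      rw [this]
      simp only [Finset.card_empty, Nat.cast_zero]
      positivity) (by
      rw [hx]
      refine hx1.trans ?_
      gcongr ?_ * _
      exact pow_le_pow_of_le_one p0.le H.le_one (by norm_num))
  rw [hl] at hXr hYr
  have h5 : 0 < p ^ 5 := by positivity
  have hXr' : ((X \ X').card : ℝ) ≤ p ^ 15 * x := by
    refine le_of_mul_le_mul_left (hXr.trans (hly.trans (le_of_eq ?_))) h5
    ring
  have hYr' : ((Y \ Y').card : ℝ) ≤ p ^ 15 * x := by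
    refine le_of_mul_le_mul_left (hYr.trans (hly.trans (le_of_eq ?_))) h5
    ring
  have hXc' := card_sdiff_real hX'
  have hYc' := card_sdiff_real hY'
  rw [hx] at hXc'
  rw [hy] at hYc'
  have h15 : p ^ 15 ≤ 1 / 16 * p := by
    calc p ^ 15 = p ^ 13 * p * p := by ring
      _ ≤ 1 * (1 / 16) * p := by gcongr; exact hpow 13
      _ = _ := by ring
  have h15x : p ^ 15 * x ≤ 1 / 16 * p * x := by gcongr
  have hpx : p * x ≤ 1 / 16 * x := by gcongr
  have hpx0 : 0 ≤ p * x := by positivity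
  -- Absorption may take different numbers of vertices from the two sides. Both are trimmed to the
  -- smaller size, as the spanning embedding needs exact balance.
  obtain ⟨m, hm⟩ : ∃ m, min X'.card Y'.card = m := ⟨_, rfl⟩
  have hmX : m ≤ X'.card := hm ▸ min_le_left _ _
  have hmY : m ≤ Y'.card := hm ▸ min_le_right _ _
  have hXnn : (0 : ℝ) ≤ (X \ X').card := by positivity
  have hYnn : (0 : ℝ) ≤ (Y \ Y').card := by positivity
  have hmx : x - p ^ 15 * x ≤ m := by
    rcases min_choice X'.card Y'.card with h | h <;> rw [← hm, h] <;> linarith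
  have htrim : ∀ T : Finset V, (T.card : ℝ) ≤ x → x - p ^ 15 * x ≤ T.card →
      (T.card : ℝ) - m ≤ p * T.card := by
    intro T hT hT'
    have h1 : 1 / 2 * x ≤ T.card := by linarith
    have h2 : p * (1 / 2 * x) ≤ p * T.card := by gcongr
    linarith
  obtain ⟨X'', hX'', hX''c, hcov2⟩ := H.exists_trim hmX (htrim _ (by linarith) (by linarith))
  obtain ⟨Y'', hY'', hY''c, hcov3⟩ := H.exists_trim hmY (htrim _ (by linarith) (by linarith))
  have hXs := card_sdiff_real (hX''.trans hX')
  have hYs := card_sdiff_real (hY''.trans hY')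
  rw [hx, hX''c] at hXs
  rw [hy, hY''c] at hYs
  have h15n : 0 ≤ p ^ 15 * x := by positivity
  have hreg' := H.regPair_of_removal hreg hd hd1 (hX''.trans hX') (hY''.trans hY')
    (by rw [hx]; linarith) (by rw [hy]; linarith)
  obtain ⟨φ, ψ, hφ, hψ, hφX, hψY, hadj⟩ := exact_two_sided (F := F m)
    (H.smallParam hd hd1) hreg' (H.degLE _) (by rw [Fintype.card_fin, hX''c]) (by
      rw [Fintype.card_fin]
      calc 1 ≤ p ^ 18 * (σ * x) := hx1
        _ ≤ p ^ 18 * (1 * x) := by gcongr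
        _ = p ^ 17 * (p * x) := by ring
        _ ≤ p ^ 17 * m := by gcongr; linarith) (by rw [hX''c, hY''c])
  have himg : ∀ (f : Fin m → V) (T : Finset V), Function.Injective f → (∀ a, f a ∈ T) →
      T.card = m → Finset.univ.image f = T := by
    intro f T hf hfT hT
    refine Finset.eq_of_subset_of_card_le ?_ ?_
    · intro v hv
      obtain ⟨a, -, rfl⟩ := Finset.mem_image.1 hv
      exact hfT a
    · rw [Finset.card_image_of_injective _ hf, Finset.card_univ, Fintype.card_fin, hT]
  have hcov4 := Coverable.of_double_cover' (F := F) (χ := χ) (H.bipartite _) c φ ψ hφ hψ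
    (fun a b h => Finset.disjoint_left.1 hXY (hX' (hX'' (hφX a))) (h ▸ hY' (hY'' (hψY b)))) hadj
  rw [himg φ X'' hφ hφX hX''c, himg ψ Y'' hψ hψY hY''c] at hcov4
  have hdXY : ∀ v, v ∈ X → v ∉ Y := fun v h => Finset.disjoint_left.1 hXY h
  have hdLX : ∀ v, v ∈ L → v ∉ X := fun v h => Finset.disjoint_left.1 hLX h
  have hdLY : ∀ v, v ∈ L → v ∉ Y := fun v h => Finset.disjoint_left.1 hLY h
  have hcov23 := hcov2.union hcov3 (Finset.disjoint_of_subset_left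
    (Finset.sdiff_subset.trans hX') (Finset.disjoint_of_subset_right
      (Finset.sdiff_subset.trans hY') hXY))
  have hcov234 := hcov23.union hcov4 (by
    rw [Finset.disjoint_left]
    intro v hv hv'
    rcases Finset.mem_union.1 hv with h | h <;> rw [Finset.mem_sdiff] at h <;>
      rcases Finset.mem_union.1 hv' with h' | h'
    · exact h.2 h'
    · exact hdXY v (hX' h.1) (hY' (hY'' h'))
    · exact hdXY v (hX' (hX'' h')) (hY' h.1)
    · exact h.2 h')
  have hU : X' \ X'' ∪ Y' \ Y'' ∪ (X'' ∪ Y'') = X' ∪ Y' := by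
    ext v
    have e1 := @hX'' v
    have e2 := @hY'' v
    simp only [Finset.mem_union, Finset.mem_sdiff]
    tauto
  rw [hU] at hcov234
  have hcov01 := hcov0.union hcov1 (by
    rw [Finset.disjoint_left]
    intro v hv hv'
    rw [Finset.mem_sdiff, Finset.mem_sdiff, Finset.mem_union] at hv
    rcases Finset.mem_union.1 hv' with h | h
    · exact hv.2 h
    rcases Finset.mem_union.1 h with h | h
    · exact hv.1.2 (.inl (Finset.mem_sdiff.1 h).1)
    · exact hv.1.2 (.inr (Finset.mem_sdiff.1 h).1))
  have hcov := hcov01.union hcov234 (by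
    rw [Finset.disjoint_right]
    intro v hv hv'
    have hvXY : v ∈ X ∨ v ∈ Y := (Finset.mem_union.1 hv).imp (@hX' v) (@hY' v)
    rcases Finset.mem_union.1 hv' with h | h
    · rw [Finset.mem_sdiff, Finset.mem_sdiff, Finset.mem_union] at h
      exact h.1.2 hvXY
    rcases Finset.mem_union.1 h with h | h
    · exact hvXY.elim (hdLX v h) (hdLY v h)
    rcases Finset.mem_union.1 h with h | h <;> rw [Finset.mem_sdiff] at h <;>
      rcases Finset.mem_union.1 hv with h' | h'
    · exact h.2 h'
    · exact hdXY v h.1 (hY' h')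
    · exact hdXY v (hX' h') h.1
    · exact h.2 h')
  refine (cast (congrArg (fun T => Coverable F χ T _) ?_) hcov).mono (by omega)
  rw [Finset.eq_univ_iff_forall]
  intro v
  by_cases hvX : v ∈ X
  · by_cases hv' : v ∈ X'
    · exact Finset.mem_union_right _ (Finset.mem_union_left _ hv')
    · exact Finset.mem_union_left _ (Finset.mem_union_right _ (Finset.mem_union_right _
        (Finset.mem_union_left _ (Finset.mem_sdiff.2 ⟨hvX, hv'⟩))))
  by_cases hvY : v ∈ Y
  · by_cases hv' : v ∈ Y'
    · exact Finset.mem_union_right _ (Finset.mem_union_right _ hv')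
    · exact Finset.mem_union_left _ (Finset.mem_union_right _ (Finset.mem_union_right _
        (Finset.mem_union_right _ (Finset.mem_sdiff.2 ⟨hvY, hv'⟩))))
  by_cases hvL : v ∈ L
  · exact Finset.mem_union_left _ (Finset.mem_union_right _ (Finset.mem_union_left _ hvL))
  · refine Finset.mem_union_left _ (Finset.mem_union_left _ (Finset.mem_sdiff.2
      ⟨Finset.mem_sdiff.2 ⟨Finset.mem_univ _, fun h => ?_⟩, hvL⟩))
    exact (Finset.mem_union.1 h).elim hvX hvY

/-- Here `i` counts the colours outside `J`. Each step of the recursion costs a factor `pairSize p ^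
2` in the threshold and `t + 4` tiles. -/
lemma TilingSetup.coversInto [DecidableEq K] (H : TilingSetup F χ p Δ N) {t : ℕ}
    (ht : Real.exp (-(p * t)) ≤ pairSize p ^ (2 * Fintype.card K + 4)) (i : ℕ) :
    ∀ J : Finset K, J.card + i = Fintype.card K →
      CoversInto F χ J (pairSize p ^ (2 * i + 1)) (i * (t + 4)) := by
  have hρ0 := pairSize_pos p
  have hρ1 : pairSize p ≤ 1 / 16 :=
    (H.pairSize_le_pow (n := 1) (by norm_num)).trans (by rw [pow_one]; exact H.le_sixteenth)
  induction i with
  | zero =>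
    intro J hJ
    rw [(Finset.card_eq_iff_eq_univ J).1 (by omega), zero_mul]
    exact coversInto_univ (by rw [mul_zero, zero_add, pow_one]; linarith)
  | succ i ih =>
    intro J hJ
    have := H.coversInto_of_insert (J := J) (σ := pairSize p ^ (2 * i + 1)) (t := t)
      (by positivity) (pow_le_one₀ hρ0.le (by linarith))
      (fun c hc => ih _ (by rw [Finset.card_insert_of_notMem hc]; omega)) (ht.trans (by
        rw [← pow_add]
        exact pow_le_pow_of_le_one hρ0.le (by linarith) (by omega)))
    rw [← pow_add] at this
    convert this using 2
    · ring
    · ring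

/-- One colour is spent on the balanced pair, so the recursion runs through the other `Fintype.card
K - 1`. -/
lemma TilingSetup.coverable_univ' [Fintype V] (H : TilingSetup F χ p Δ N) {t : ℕ}
    (ht : Real.exp (-(p * t)) ≤ pairSize p ^ (2 * Fintype.card K + 4)) :
    Coverable F χ Finset.univ (Fintype.card K * (t + 6)) := by
  classical
  have hρ0 := pairSize_pos p
  have hρ1 : pairSize p ≤ 1 :=
    (H.pairSize_le_pow (n := 0) (by norm_num)).trans (by rw [pow_zero])
  obtain ⟨i, hi⟩ : ∃ i, Fintype.card K = i + 1 :=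
    ⟨Fintype.card K - 1, by have := H.colours; omega⟩
  refine (H.coverable_univ (t := t) (σ := pairSize p ^ (2 * i + 1)) (k := i * (t + 4))
    (by positivity) (pow_le_one₀ hρ0.le hρ1)
    (fun c => H.coversInto ht i _ (by rw [Finset.card_insert_of_notMem (by simp)]; simp; omega))
    (ht.trans ?_)).mono ?_
  · rw [← pow_add]
    exact pow_le_pow_of_le_one hρ0.le hρ1 (by omega)
  · rw [hi]
    nlinarith

end Conclusion


/-! ### Choice of parameters and numerical bounds. -/

section Bounds

open Classical in
lemma degLE_of_maxDegree_le {α : Type*} [Fintype α] {F : SimpleGraph α} {Δ : ℕ}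
    (h : F.maxDegree ≤ Δ) : DegLE F Δ := by
  intro v s hs
  refine le_trans ?_ ((F.degree_le_maxDegree v).trans h)
  rw [← F.card_neighborFinset_eq_degree]
  exact Finset.card_le_card fun u hu => (F.mem_neighborFinset v u).2 (hs u hu)

lemma DegLE.not_adj {α : Type*} {F : SimpleGraph α} (h : DegLE F 0) (a b : α) : ¬ F.Adj a b := by
  intro hab
  have := h a {b} (by simpa using hab)
  simp at this

open Classical in
lemma IsBipartiteBoundedSequence.degLE {Δ : ℕ} {F : GraphSequence}
    (h : IsBipartiteBoundedSequence Δ F) (k : ℕ) : DegLE (F k) Δ := by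
  rcases Nat.eq_zero_or_pos k with rfl | hk
  · exact fun v => v.elim0
  · refine degLE_of_maxDegree_le ?_
    convert h.maxDegree_le k hk

lemma IsBipartiteBoundedSequence.isBipartite {Δ : ℕ} {F : GraphSequence}
    (h : IsBipartiteBoundedSequence Δ F) (k : ℕ) : (F k).IsBipartite := by
  rcases Nat.eq_zero_or_pos k with rfl | hk
  · exact ⟨SimpleGraph.Coloring.mk (fun v => v.elim0) (fun {v} => v.elim0)⟩
  · exact h.bipartite k hk

lemma tilingNumber_le_of_coverable {r : ℕ} {F : GraphSequence} {s : ℕ}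
    (h : ∀ (n : ℕ) (χ : TopEdgeLabeling (Fin n) (Fin r)), Coverable F χ Finset.univ s) :
    tilingNumber r F ≤ s := by
  refine sInf_le ⟨s, fun n χ => ?_, rfl⟩
  obtain ⟨T, h1, h2, h3, h4, h5⟩ := h n χ
  exact ⟨T, ⟨h1, h2, h3, fun v => (h4 v).1 (Finset.mem_univ v)⟩, h5⟩

/-- Without edges the member with `n` vertices is a tile by itself. The case is separate because
`invParam` vanishes at `Δ = 0`. -/
lemma coverable_univ_of_degLE_zero {K : Type*} [Nonempty K] {F : GraphSequence}
    (hF : ∀ k, DegLE (F k) 0) (n : ℕ) (χ : TopEdgeLabeling (Fin n) K) :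
    Coverable F χ Finset.univ 1 := by
  rcases Nat.eq_zero_or_pos n with rfl | hn
  · exact Coverable.empty.mono zero_le_one
  · have := Coverable.of_copy (F := F) (χ := χ) hn (Classical.arbitrary K) id
      Function.injective_id fun u v h => absurd h ((hF n).not_adj u v)
    rwa [Finset.image_id] at this

/-- The inverse of the parameter used for `r` colours and maximum degree `Δ`. -/
def invParam (r Δ : ℕ) : ℕ := 48 * Δ * (2 * r) ^ Δ

lemma tilingSetup {r Δ n : ℕ} (hr : 1 ≤ r) (hΔ : 1 ≤ Δ) {F : GraphSequence}
    (hdeg : ∀ k, DegLE (F k) Δ) (hbip : ∀ k, (F k).IsBipartite)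
    (χ : TopEdgeLabeling (Fin n) (Fin r)) :
    TilingSetup F χ (1 / invParam r Δ) Δ (24 * Δ * r ^ Δ) := by
  have hr0 : (1 : ℝ) ≤ r := by exact_mod_cast hr
  have hΔ0 : (1 : ℝ) ≤ Δ := by exact_mod_cast hΔ
  have h2r : (1 : ℝ) ≤ 2 * r := by linarith
  have hpow : (1 : ℝ) ≤ (2 * r) ^ Δ := one_le_pow₀ h2r
  have hpow1 : (2 * r : ℝ) ≤ (2 * r) ^ Δ := le_self_pow₀ h2r (by omega)
  have hM : (invParam r Δ : ℝ) = 48 * Δ * (2 * r) ^ Δ := by simp [invParam]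
  have hΔpow : (2 * r : ℝ) ^ Δ ≤ Δ * (2 * r) ^ Δ := le_mul_of_one_le_left (by positivity) hΔ0
  have hMpos : (0 : ℝ) < 48 * Δ * (2 * r) ^ Δ := by positivity
  constructor
  · rw [hM]; positivity
  · rw [hM]
    gcongr
    linarith
  · rw [hM, mul_one_div, div_le_one hMpos]
    nlinarith
  · simpa using hr
  · rw [hM, Fintype.card_fin, mul_one_div, div_le_div_iff₀ hMpos (by positivity)]
    linarith
  · rw [hM, Fintype.card_fin, one_div_pow, mul_one_div, div_le_div_iff₀ hMpos (by positivity)]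
    linarith
  · exact hdeg
  · exact hbip
  · exact Nat.mul_pos (Nat.mul_pos (by norm_num) hΔ) (pow_pos hr _)
  · rw [hM, mul_one_div, div_le_one hMpos]
    push_cast
    have : (r : ℝ) ^ Δ ≤ (2 * r) ^ Δ := by gcongr; linarith
    calc 2 * (24 * (Δ : ℝ) * r ^ Δ) = 48 * Δ * r ^ Δ := by ring
      _ ≤ _ := by gcongr
  · intro S k hk hS
    exact exists_mono_copy hΔ (by simpa using hr) (hdeg k) (hbip k) (by simpa using hk)
      (by simpa using hS)

lemma coverable_univ_of_bounded {r Δ n : ℕ} (hr : 1 ≤ r) (hΔ : 1 ≤ Δ) {F : GraphSequence}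
    (hdeg : ∀ k, DegLE (F k) Δ) (hbip : ∀ k, (F k).IsBipartite)
    (χ : TopEdgeLabeling (Fin n) (Fin r)) :
    Coverable F χ Finset.univ (r * ((2 * r + 4) * invParam r Δ ^ 61 + 6)) := by
  have H := tilingSetup hr hΔ hdeg hbip χ
  have hM : (0 : ℝ) < invParam r Δ := by simpa using H.pos
  -- With `p = 1 / invParam r Δ` this gives `p t = (2r + 4) / p^60`, so the required inequality is
  -- an equality.
  have := H.coverable_univ' (t := (2 * r + 4) * invParam r Δ ^ 61) (by
    rw [pairSize, ← Real.exp_nat_mul, Fintype.card_fin]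
    refine le_of_eq (congrArg _ ?_)
    push_cast
    field_simp)
  rwa [Fintype.card_fin] at this

lemma isContained_of_bounded {r Δ n N : ℕ} (hr : 1 ≤ r) {H : SimpleGraph (Fin n)}
    (hdeg : DegLE H Δ) (hbip : H.IsBipartite) (hN : n ≤ N) (hN' : 24 * Δ * r ^ Δ * n ≤ N)
    (χ : TopEdgeLabeling (Fin N) (Fin r)) : ∃ c, H.IsContained (χ.labelGraph c) := by
  have : Nonempty (Fin r) := ⟨⟨0, hr⟩⟩
  rcases Nat.eq_zero_or_pos Δ with rfl | hΔ
  · exact ⟨Classical.arbitrary _, ⟨⟨⟨Fin.castLE hN, fun {a b} h => absurd h (hdeg.not_adj a b)⟩,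
      Fin.castLE_injective hN⟩⟩⟩
  rcases Nat.eq_zero_or_pos n with rfl | hn
  · exact ⟨Classical.arbitrary _, ⟨⟨⟨fun a => a.elim0, fun {a} => a.elim0⟩, fun a => a.elim0⟩⟩⟩
  obtain ⟨c, f, hf, -, hadj⟩ := exists_mono_copy (χ := χ) (F := H) (S := Finset.univ) hΔ
    (by simpa using hr) hdeg hbip (by rw [Fintype.card_fin]; exact hn) (by simpa using hN')
  exact ⟨c, ⟨⟨⟨f, fun {a b} h => hadj a b h⟩, hf⟩⟩⟩

lemma invParam_le_exp {r : ℕ} (hr : 1 ≤ r) (Δ : ℕ) (hΔ : 1 ≤ Δ) :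
    (invParam r Δ : ℝ) ≤ Real.exp ((49 + 2 * r) * Δ) := by
  have hexp : ∀ x : ℝ, x ≤ Real.exp x := fun x => by linarith [Real.add_one_le_exp x]
  have hΔ0 : (1 : ℝ) ≤ Δ := by exact_mod_cast hΔ
  have h1 : (48 : ℝ) ≤ Real.exp (48 * Δ) := le_trans (by linarith) (hexp _)
  have h2 : (2 * r : ℝ) ^ Δ ≤ Real.exp (2 * r * Δ) := by
    rw [mul_comm (2 * r : ℝ), Real.exp_nat_mul]
    gcongr
    exact hexp _
  have h3 : (invParam r Δ : ℝ) = 48 * Δ * (2 * r) ^ Δ := by simp [invParam]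
  rw [h3, show (49 + 2 * (r : ℝ)) * Δ = 48 * Δ + Δ + 2 * r * Δ by ring, Real.exp_add, Real.exp_add]
  gcongr
  exact hexp _

/-- The constant in the exponent. -/
noncomputable def tilingConst (r : ℕ) : ℝ := 61 * (49 + 2 * r) + (r + (2 * r + 10))

lemma tilingBound_le_exp {r : ℕ} (hr : 1 ≤ r) (Δ : ℕ) (hΔ : 1 ≤ Δ) :
    ((r * ((2 * r + 4) * invParam r Δ ^ 61 + 6) : ℕ) : ℝ) ≤ Real.exp (tilingConst r * Δ) := by
  have hexp : ∀ x : ℝ, x ≤ Real.exp x := fun x => by linarith [Real.add_one_le_exp x]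
  have hΔ0 : (1 : ℝ) ≤ Δ := by exact_mod_cast hΔ
  have hr0 : (1 : ℝ) ≤ r := by exact_mod_cast hr
  have hM1 : 1 ≤ invParam r Δ := by
    exact Nat.mul_pos (Nat.mul_pos (by norm_num) hΔ) (pow_pos (by omega) _)
  have hM1' : (1 : ℝ) ≤ (invParam r Δ : ℝ) ^ 61 := one_le_pow₀ (by exact_mod_cast hM1)
  have hM : (invParam r Δ : ℝ) ^ 61 ≤ Real.exp (61 * ((49 + 2 * r) * Δ)) := by
    calc (invParam r Δ : ℝ) ^ 61 ≤ Real.exp ((49 + 2 * r) * Δ) ^ 61 := by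
          gcongr
          exact invParam_le_exp hr Δ hΔ
      _ = _ := by rw [← Real.exp_nat_mul]; norm_num
  have h1 : (r : ℝ) ≤ Real.exp (r * Δ) := le_trans (by nlinarith) (hexp _)
  have h2 : (2 * r + 10 : ℝ) ≤ Real.exp ((2 * r + 10) * Δ) := le_trans (by nlinarith) (hexp _)
  push_cast
  calc (r : ℝ) * ((2 * r + 4) * (invParam r Δ : ℝ) ^ 61 + 6)
      ≤ r * ((2 * r + 10) * (invParam r Δ : ℝ) ^ 61) := by
        gcongr
        linarith
    _ ≤ Real.exp (r * Δ) * (Real.exp ((2 * r + 10) * Δ) * Real.exp (61 * ((49 + 2 * r) * Δ))) := by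
        gcongr
    _ = _ := by
        rw [← Real.exp_add, ← Real.exp_add, tilingConst]
        congr 1
        ring

/-- The maximum with `n` takes care of `Δ = 0`, where the other term vanishes although `n` vertices
are still needed. -/
lemma ramseyBound_le_exp {r : ℕ} (hr : 1 ≤ r) (Δ n : ℕ) :
    ((max n (24 * Δ * r ^ Δ * n) : ℕ) : ℝ) ≤ Real.exp (tilingConst r * Δ) * n := by
  have hr0 : (1 : ℝ) ≤ r := by exact_mod_cast hr
  have hC : 49 + 2 * (r : ℝ) ≤ tilingConst r := by rw [tilingConst]; linarith
  have hn : (0 : ℝ) ≤ n := by positivity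
  have hC0 : 0 ≤ tilingConst r * Δ := mul_nonneg (by linarith) (by positivity)
  rw [Nat.cast_max, max_le_iff]
  constructor
  · exact le_mul_of_one_le_left hn (Real.one_le_exp hC0)
  · rcases Nat.eq_zero_or_pos Δ with rfl | hΔ
    · simp
    push_cast
    gcongr
    calc 24 * (Δ : ℝ) * r ^ Δ ≤ 48 * Δ * (2 * r) ^ Δ := by gcongr <;> linarith
      _ = (invParam r Δ : ℝ) := by simp [invParam]
      _ ≤ Real.exp ((49 + 2 * r) * Δ) := invParam_le_exp hr Δ hΔ
      _ ≤ _ := by gcongr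

lemma toENNReal_le_ofReal {x : ℕ∞} {m : ℕ} {y : ℝ} (h : x ≤ m) (hy : (m : ℝ) ≤ y) :
    (x : ℝ≥0∞) ≤ ENNReal.ofReal y := by
  calc (x : ℝ≥0∞) ≤ ((m : ℕ∞) : ℝ≥0∞) := ENat.toENNReal_le.2 h
    _ = ENNReal.ofReal m := by simp
    _ ≤ _ := ENNReal.ofReal_le_ofReal hy

end Bounds

open Classical in
theorem mainTheorem1 (r : ℕ) (hr : 1 ≤ r) :
    ∃ C : ℝ,
      (∀ (Δ : ℕ) (F : GraphSequence), IsBipartiteBoundedSequence Δ F →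
        (tilingNumber r F : ℝ≥0∞) ≤ ENNReal.ofReal (Real.exp (C * Δ))) ∧
      (∀ (Δ n : ℕ) (H : SimpleGraph (Fin n)), H.IsBipartite → H.maxDegree ≤ Δ →
        (multicolourRamsey r H : ℝ≥0∞) ≤ ENNReal.ofReal (Real.exp (C * Δ) * n)) := by
  refine ⟨tilingConst r, fun Δ F hF => ?_, fun Δ n H hbip hdeg => ?_⟩
  · rcases Nat.eq_zero_or_pos Δ with rfl | hΔ
    · have : Nonempty (Fin r) := ⟨⟨0, hr⟩⟩
      exact toENNReal_le_ofReal (tilingNumber_le_of_coverable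
        (coverable_univ_of_degLE_zero hF.degLE)) (by simp)
    · exact toENNReal_le_ofReal (tilingNumber_le_of_coverable fun n χ =>
        coverable_univ_of_bounded hr hΔ hF.degLE hF.isBipartite χ) (tilingBound_le_exp hr Δ hΔ)
  · refine toENNReal_le_ofReal (sInf_le ⟨max n (24 * Δ * r ^ Δ * n), fun χ => ?_, rfl⟩)
      (ramseyBound_le_exp hr Δ n)
    exact isContained_of_bounded hr (degLE_of_maxDegree_le hdeg) hbip (le_max_left _ _)
      (le_max_right _ _) χ
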